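/- **Lemma (the maximum principle).** *Geometry.* Let $\ell_0\in(0,\frac13)$, $\ell_i\ge 1$, and let $h_i\in C^3([0,\ell_i])$ be positive, $i\in\{1,2,3\}$. Let $\delta>0$ be such that $h_i\equiv h_i(0)$ on $[0,\delta]\cap[0,\ell_i]$ and $h_i\equiv h_i(\ell_i)$ on $[\ell_i-\delta,\ell_i]\cap[0,\ell_i]$. For $x\in\mathbb R^3$ let $\overline{x}_i$ denote the pair of the coordinates $x_j$, $j\ne i$. Let $\Xi\subset\bigcap_i\{\xi_i<\ell_0\}$ be a bounded domain in $\mathbb R^3$ that contains the origin and coincides, near each plane $\{\xi_i=\ell_0\}$, with the right circular cylinder $\{|\overline{\xi}_i|<h_i(0),\ \xi_i<\ell_0\}$. Put $\Upsilon^{(i)}=\{\xi_i=\ell_0,\ |\overline{\xi}_i|\le h_i(0)\}$ and let $\Gamma^{(0)}=\partial\Xi\setminus\bigcup_i\Upsilon^{(i)}$ be of class $C^3$. For $\varepsilon>0$ let $\Omega^{(0)}_\varepsilon=\varepsilon\,\Xi$, $\Gamma^{(0)}_\varepsilon=\varepsilon\,\Gamma^{(0)}$, $$\Omega^{(i)}_\varepsilon=\{x:\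 \varepsilon\ell_0<x_i<\ell_i,\ |\overline{x}_i|<\varepsilon h_i(x_i)\},\qquad \Gamma^{(i)}_\varepsilon=\partial\Omega^{(i)}_\varepsilon\cap\{\varepsilon\ell_0<x_i<\ell_i\},\qquad i=1,2,3,$$ let $\Upsilon^{(i)}_\varepsilon(\ell_i)=\{x_i=\ell_i,\ |\overline{x}_i|\le\varepsilon h_i(\ell_i)\}$, and let $\Omega_\varepsilon$ be the interior of $\bigcup_{i=0}^3\overline{\Omega^{(i)}_\varepsilon}$, with outward unit normal $\boldsymbol\nu_\varepsilon$. Call $\varepsilon\in(0,1)$ admissible if $\varepsilon\ell_0<\delta$ and the three closed cylinders $\overline{\Omega^{(i)}_\varepsilon}$ are pairwise disjoint; all sufficiently small $\varepsilon>0$ are admissible. *Diffusion.* Let $\alpha\in(0,1)$. Let $\mathbb D^{(0)}_\varepsilon(x)=a^{(0)}(x/\varepsilon)$ in $\Omega_\varepsilon^{(0)}$ and $\mathbb D^{(i)}_\varepsilon(x)=a^{(i)}(\overline{x}_i/\varepsilon)$ in $\Omega_\varepsilon^{(i)}$ be symmetric $3\times3$ matrices, uniformly elliptic and bounded in the quadratic-form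 sense, with entries in $C^{1,\alpha}$ of the closures of their domains. For $i\in\{1,2,3\}$ the entry $a^{(i)}_{ii}$ is constant, $a^{(i)}_{ij}=a^{(i)}_{ji}=0$ for $j\ne i$, and $a^{(0)}=a^{(i)}$ on $\Upsilon^{(i)}$. *Velocity.* For $i\in\{1,2,3\}$ the $i$-th component of $\overrightarrow{V_\varepsilon}^{(i)}$ is $v^{(i)}_i(x_i)$ and its $j$-th component, $j\ne i$, is $\varepsilon v^{(i)}_j(x_i,\overline{x}_i/\varepsilon)$. All these functions are of class $C^{1,\alpha}$, for $x_i\in[0,\ell_i]$ and $|\overline{\xi}_i|\le h_i(x_i)$. On $[0,\delta]$ the function $v_i^{(i)}$ equals a constant $\mathrm v_i$, and the $v^{(i)}_j$, $j\neq i$, vanish for $x_i\le\delta$ and for $x_i\ge\ell_i-\delta$. Moreover $v^{(1)}_1<0$, $v^{(3)}_3>0$, $v^{(2)}_2$ is either everywhere negative or everywhere positive, and $\sum_i h_i^2(0)\mathrm v_i=0$. In the node, $\overrightarrow{V_\varepsilon}^{(0)}(x)=(\nabla_\xi p)(x/\varepsilon)$, with components of $\nabla_\xi p$ in $C^{1,\alpha}(\overline\Xi)$,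 where $\Delta p=0$ in $\Xi$, $\partial p/\partial\xi_i=\mathrm v_i$ on $\Upsilon^{(i)}$, $\partial p/\partial\boldsymbol\nu=0$ on $\Gamma^{(0)}$ and $\int_\Xi p\,d\xi=0$. *Claim.* For every $T>0$ there is a constant $C_0=C_0(T)>0$, depending only on $T$ and on the data above, such that for all admissible $\varepsilon$ the following holds. Let $F_i$ $(i=0,\dots,3)$ be continuous and bounded on $\Omega^{(i)}_\varepsilon\times(0,T)$, and let $\Phi_i$ $(i=1,2,3)$ be continuous and bounded on $\Gamma^{(i)}_\varepsilon\times(0,T)$ and vanish, uniformly in $t$, for $x_i$ outside a compact subset of $(\varepsilon\ell_0,\ell_i)$. Let $\psi_\varepsilon$ be a classical solution of $$\begin{aligned} \partial_t\psi_\varepsilon-\varepsilon\,\mathrm{div}(\mathbb D^{(i)}_\varepsilon\nabla\psi_\varepsilon)+\mathrm{div}(\overrightarrow{V_\varepsilon}^{(i)}\psi_\varepsilon)&=F_i &&\text{in }\Omega^{(i)}_\varepsilon\times(0,T),\ i=1,2,3,\\ (-\varepsilon\mathbb D^{(i)}_\varepsilon\nabla\psi_\varepsilon+\psi_\varepsilon\overrightarrow{V_\varepsilon}^{(i)})\cdot\boldsymbol\nu_\varepsilon&=\varepsilon\Phi_i&&\text{on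 }\Gamma^{(i)}_\varepsilon\times(0,T),\ i=1,2,3,\\ \partial_t\psi_\varepsilon-\varepsilon\,\mathrm{div}(\mathbb D^{(0)}_\varepsilon\nabla\psi_\varepsilon)+\overrightarrow{V_\varepsilon}^{(0)}\cdot\nabla\psi_\varepsilon&=F_0&&\text{in }\Omega^{(0)}_\varepsilon\times(0,T),\\ (\mathbb D^{(0)}_\varepsilon\nabla\psi_\varepsilon)\cdot\boldsymbol\nu_\varepsilon&=0&&\text{on }\Gamma^{(0)}_\varepsilon\times(0,T),\\ \psi_\varepsilon&=0&&\text{on }\Upsilon^{(i)}_\varepsilon(\ell_i)\times(0,T),\ i=1,2,3,\\ \psi_\varepsilon|_{t=0}&=0&&\text{on }\Omega_\varepsilon, \end{aligned}$$ that is, $\psi_\varepsilon$ is continuous on $\overline{\Omega_\varepsilon}\times[0,T]$, its gradient $\nabla_x\psi_\varepsilon$ exists and is continuous on $\big(\overline{\Omega_\varepsilon}\setminus\bigcup_i\Upsilon_\varepsilon^{(i)}(\ell_i)\big)\times(0,T)$ (one-sided on the boundary), $\psi_\varepsilon$ is of class $C^{2,1}$ in each $\Omega^{(i)}_\varepsilon\times(0,T)$,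 $i=0,\dots,3$, and the relations above hold pointwise. Then $$\max_{\overline{\Omega_\varepsilon}\times[0,T]}|\psi_\varepsilon|\ \le\ C_0(T)\Big(\sum_{i=0}^3\ \sup_{\Omega^{(i)}_\varepsilon\times(0,T)}|F_i|+\sum_{i=1}^3\ \sup_{\Gamma^{(i)}_\varepsilon\times(0,T)}|\Phi_i|\Big).$$ -/

import Mathlib

namespace ThinJunction

noncomputable section

/-- Euclidean three-space; the coordinates are indexed by `0, 1, 2`. -/
abbrev E3 : Type := EuclideanSpace ℝ (Fin 3)

/-! ### Analytic vocabulary -/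

/-- The class `C^{1,α}` of the closure of an open set `U`: `f` is continuous on the closure,
continuously differentiable in `U`, and its derivative is bounded and `α`-Hölder
continuous in `U`. -/
def IsC1Holder {X : Type*} [NormedAddCommGroup X] [NormedSpace ℝ X]
    (α : ℝ) (U : Set X) (f : X → ℝ) : Prop :=
  ContinuousOn f (closure U) ∧
  (∀ x ∈ U, DifferentiableAt ℝ f x) ∧
  ∃ C : ℝ, (∀ x ∈ U, ‖fderiv ℝ f x‖ ≤ C) ∧
    ∀ x ∈ U, ∀ y ∈ U, ‖fderiv ℝ f x - fderiv ℝ f y‖ ≤ C * ‖x - y‖ ^ α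

/-- The divergence `∑ₖ ∂ₖ Gₖ` of a vector field at `x`. -/
def divergence (G : E3 → E3) (x : E3) : ℝ :=
  ∑ k : Fin 3, fderiv ℝ (fun y => G y k) x (EuclideanSpace.single k 1)

/-- The product of a matrix and a vector. -/
def applyMat (A : Matrix (Fin 3) (Fin 3) ℝ) (v : E3) : E3 :=
  WithLp.toLp 2 (A.mulVec v.ofLp)

/-- `κ₀ |y|² ≤ ∑ A_{mn}(ξ) y_m y_n ≤ κ₁ |y|²` on `U`, with positive constants `κ₀, κ₁`. -/
def UniformlyElliptic (A : E3 → Matrix (Fin 3) (Fin 3) ℝ) (U : Set E3) : Prop :=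
  ∃ κ₀ κ₁ : ℝ, 0 < κ₀ ∧ 0 < κ₁ ∧ ∀ ξ ∈ U, ∀ y : E3,
    κ₀ * ‖y‖ ^ 2 ≤ inner ℝ (applyMat (A ξ) y) y ∧
    inner ℝ (applyMat (A ξ) y) y ≤ κ₁ * ‖y‖ ^ 2

/-- Near `x` the set `S` lies on one side of a surface of class `C³` through `x`, and `ν` is
the outward unit normal to `S` at `x`. -/
def IsOutwardNormal (S : Set E3) (x ν : E3) : Prop :=
  ‖ν‖ = 1 ∧ ∃ g : E3 → ℝ, ContDiffAt ℝ 3 g x ∧ g x = 0 ∧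
    (∃ c : ℝ, 0 < c ∧ gradient g x = c • ν) ∧
    ∃ U ∈ nhds x, S ∩ U = {y | g y < 0} ∩ U

/-- The squared distance of `x` from the `i`-th coordinate axis. -/
def transSq (i : Fin 3) (x : E3) : ℝ := ∑ j ∈ Finset.univ.erase i, x j ^ 2

/-- The point with `i`-th coordinate `x_i` and other coordinates `x_j / ε`. -/
def stretch (ε : ℝ) (i : Fin 3) (x : E3) : E3 :=
  WithLp.toLp 2 fun j => if j = i then x i else x j / ε

/-- `sup |f|` over `S × (0, T)`; used for functions that are bounded there. -/
def supAbs (T : ℝ) (S : Set E3) (f : E3 → ℝ → ℝ) : ℝ :=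
  sSup ((fun p : E3 × ℝ => |f p.1 p.2|) '' (S ×ˢ Set.Ioo 0 T))

/-- `f` is continuous and bounded on `S × (0, T)`. -/
def ContBounded (T : ℝ) (S : Set E3) (f : E3 → ℝ → ℝ) : Prop :=
  ContinuousOn (fun p : E3 × ℝ => f p.1 p.2) (S ×ˢ Set.Ioo 0 T) ∧
  ∃ M : ℝ, ∀ x ∈ S, ∀ t ∈ Set.Ioo 0 T, |f x t| ≤ M

/-! ### The geometry -/

/-- The data that determine the thin junctions. -/
structure Geometry where
  ℓ₀ : ℝ
  ℓ : Fin 3 → ℝ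
  /-- the aperture functions `h_i` on `[0, ℓ_i]` -/
  h : Fin 3 → ℝ → ℝ
  /-- the rescaled node `Ξ` -/
  Ξ : Set E3
  /-- a common width of the neighbourhoods of the end points of `[0, ℓ_i]` in which `h_i`
  (and, later, the velocity) have a special form -/
  δ : ℝ
  ℓ₀_mem : ℓ₀ ∈ Set.Ioo (0 : ℝ) (1 / 3)
  one_le_ℓ : ∀ i, 1 ≤ ℓ i
  δ_pos : 0 < δ
  h_smooth : ∀ i, ContDiffOn ℝ 3 (h i) (Set.Icc 0 (ℓ i))
  h_pos : ∀ i, ∀ s ∈ Set.Icc 0 (ℓ i), 0 < h i s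
  h_left : ∀ i, ∀ s ∈ Set.Icc 0 (ℓ i), s ≤ δ → h i s = h i 0
  h_right : ∀ i, ∀ s ∈ Set.Icc 0 (ℓ i), ℓ i - δ ≤ s → h i s = h i (ℓ i)
  Ξ_open : IsOpen Ξ
  Ξ_connected : IsConnected Ξ
  Ξ_bounded : Bornology.IsBounded Ξ
  zero_mem_Ξ : (0 : E3) ∈ Ξ
  Ξ_lt : ∀ ξ ∈ Ξ, ∀ i, ξ i < ℓ₀
  /-- near the plane `ξ_i = ℓ₀` the node is a right circular cylinder of radius `h_i(0)` -/
  Ξ_collar : ∃ c : ℝ, 0 < c ∧ ∀ i, ∀ ξ : E3, ℓ₀ - c < ξ i → ξ i < ℓ₀ →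
    (ξ ∈ Ξ ↔ transSq i ξ < h i 0 ^ 2)
  /-- the node surface, that is the boundary without the three closed discs, is of class `C³`;
  with the collars this makes the boundary of the whole junction of class `C³` outside the
  three outer bases -/
  Ξ_smooth : ∀ ξ ∈ frontier Ξ, (∀ i, ¬ (ξ i = ℓ₀ ∧ transSq i ξ ≤ h i 0 ^ 2)) →
    ∃ ν, IsOutwardNormal Ξ ξ ν

namespace Geometry

variable (J : Geometry)

/-- The closed disc in the plane `ξ_i = ℓ₀` on the boundary of the rescaled node. -/
def disc (i : Fin 3) : Set E3 := {ξ | ξ i = J.ℓ₀ ∧ transSq i ξ ≤ J.h i 0 ^ 2}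

/-- The surface `∂Ξ` without the three closed discs. -/
def nodeSurface : Set E3 := frontier J.Ξ \ ⋃ i, J.disc i

/-- The node `ε Ξ`. -/
def node (ε : ℝ) : Set E3 := (fun ξ : E3 => ε • ξ) '' J.Ξ

/-- The thin cylinder along the `i`-th axis. -/
def cylinder (ε : ℝ) (i : Fin 3) : Set E3 :=
  {x | ε * J.ℓ₀ < x i ∧ x i < J.ℓ i ∧ transSq i x < ε ^ 2 * J.h i (x i) ^ 2}

/-- The closed cross-section `x_i = s` of the thin cylinder. -/
def crossSection (ε : ℝ) (i : Fin 3) (s : ℝ) : Set E3 :=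
  {x | x i = s ∧ transSq i x ≤ ε ^ 2 * J.h i s ^ 2}

/-- The lateral surface of the thin cylinder. -/
def lateral (ε : ℝ) (i : Fin 3) : Set E3 :=
  frontier (J.cylinder ε i) ∩ {x | ε * J.ℓ₀ < x i ∧ x i < J.ℓ i}

/-- The node boundary: `∂(ε Ξ)` without the three closed discs. -/
def nodeBoundary (ε : ℝ) : Set E3 :=
  frontier (J.node ε) \ ⋃ i, J.crossSection ε i (ε * J.ℓ₀)

/-- The thin junction: the interior of the union of the closures of its four parts. -/
def junction (ε : ℝ) : Set E3 :=
  interior (closure (J.node ε) ∪ ⋃ i, closure (J.cylinder ε i))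

/-- The boundary of the junction without the three closed outer bases. -/
def sideBoundary (ε : ℝ) : Set E3 :=
  frontier (J.junction ε) \ ⋃ i, J.crossSection ε i (J.ℓ i)

/-- The values of the small parameter for which the junction has the shape described: the
bases `x_i = ε ℓ₀` lie where `h_i` equals `h_i(0)`, and different cylinders do not meet.
All sufficiently small `ε > 0` are admissible. -/
structure Admissible (ε : ℝ) : Prop where
  pos : 0 < ε
  lt_one : ε < 1
  base : ε * J.ℓ₀ < J.δ
  disjoint : ∀ i j, i ≠ j → Disjoint (closure (J.cylinder ε i)) (closure (J.cylinder ε j))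

/-- The points `ξ` whose transversal part `ξ̄_i` occurs as `x̄_i / ε` in the cylinder; the
`i`-th coordinate is free. -/
def fastDomain (i : Fin 3) : Set E3 :=
  {ξ | ∃ s ∈ Set.Icc 0 (J.ℓ i), transSq i ξ < J.h i s ^ 2}

/-- The points with `i`-th coordinate `x_i ∈ (0, ℓ_i)` and transversal part `|ξ̄_i| < h_i(x_i)`. -/
def mixedDomain (i : Fin 3) : Set E3 :=
  {η | 0 < η i ∧ η i < J.ℓ i ∧ transSq i η < J.h i (η i) ^ 2}

end Geometry

/-! ### The coefficients -/

/-- The diffusion matrices and the velocity field. -/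
structure Coefficients (J : Geometry) where
  α : ℝ
  α_mem : α ∈ Set.Ioo (0 : ℝ) 1
  /-- the diffusion matrix of the node, a function of `ξ = x / ε` -/
  a₀ : E3 → Matrix (Fin 3) (Fin 3) ℝ
  /-- the diffusion matrices of the cylinders, functions of `x̄_i / ε` -/
  a : Fin 3 → E3 → Matrix (Fin 3) (Fin 3) ℝ
  a₀_regular : ∀ k l, IsC1Holder α J.Ξ (fun ξ => a₀ ξ k l)
  a_regular : ∀ i k l, IsC1Holder α (J.fastDomain i) (fun ξ => a i ξ k l)
  a_transversal : ∀ i (ξ ξ' : E3), (∀ j, j ≠ i → ξ j = ξ' j) → a i ξ = a i ξ'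
  a_longitudinal : ∀ i (ξ ξ' : E3), a i ξ i i = a i ξ' i i
  a_block : ∀ i (ξ : E3) j, j ≠ i → a i ξ i j = 0
  a_match : ∀ i, ∀ ξ ∈ J.disc i, a₀ ξ = a i ξ
  a₀_symm : ∀ ξ ∈ J.Ξ, (a₀ ξ).IsSymm
  a_symm : ∀ i, ∀ ξ ∈ J.fastDomain i, (a i ξ).IsSymm
  a₀_elliptic : UniformlyElliptic a₀ J.Ξ
  a_elliptic : ∀ i, UniformlyElliptic (a i) (J.fastDomain i)
  /-- the longitudinal velocities `v_i^{(i)}(x_i)` in the cylinders -/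
  v : Fin 3 → ℝ → ℝ
  /-- the transversal velocities: for `j ≠ i` the number `w i η j` is `v_j^{(i)}(x_i, ξ̄_i)`,
  where `η` has `i`-th coordinate `x_i` and transversal part `ξ̄_i` -/
  w : Fin 3 → E3 → E3
  /-- the velocity in the node, a function of `ξ = x / ε` -/
  v₀ : E3 → E3
  /-- the potential of the velocity in the node -/
  p : E3 → ℝ
  v_regular : ∀ i, IsC1Holder α (Set.Ioo 0 (J.ℓ i)) (v i)
  w_regular : ∀ i j, j ≠ i → IsC1Holder α (J.mixedDomain i) (fun η => w i η j)
  v₀_regular : ∀ j, IsC1Holder α J.Ξ (fun ξ => v₀ ξ j)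
  v_left : ∀ i, ∀ s ∈ Set.Icc 0 (J.ℓ i), s ≤ J.δ → v i s = v i 0
  w_support : ∀ i, ∀ η ∈ closure (J.mixedDomain i), (η i ≤ J.δ ∨ J.ℓ i - J.δ ≤ η i) →
    ∀ j, j ≠ i → w i η j = 0
  v_first : ∀ s ∈ Set.Icc 0 (J.ℓ 0), v 0 s < 0
  v_second : (∀ s ∈ Set.Icc 0 (J.ℓ 1), v 1 s < 0) ∨ (∀ s ∈ Set.Icc 0 (J.ℓ 1), 0 < v 1 s)
  v_third : ∀ s ∈ Set.Icc 0 (J.ℓ 2), 0 < v 2 s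
  conservation : ∑ i, J.h i 0 ^ 2 * v i 0 = 0
  p_continuous : ContinuousOn p (closure J.Ξ)
  p_harmonic : InnerProductSpace.HarmonicOnNhd p J.Ξ
  v₀_eq_grad : ∀ ξ ∈ J.Ξ, HasGradientAt p (v₀ ξ) ξ
  p_disc : ∀ i, ∀ ξ ∈ J.disc i, v₀ ξ i = v i 0
  p_neumann : ∀ ξ ∈ J.nodeSurface, ∀ ν, IsOutwardNormal J.Ξ ξ ν → inner ℝ (v₀ ξ) ν = 0
  p_mean : ∫ ξ in J.Ξ, p ξ = 0

namespace Coefficients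

variable {J : Geometry} (K : Coefficients J)

/-- The diffusion matrix in the node. -/
def D₀ (ε : ℝ) (x : E3) : Matrix (Fin 3) (Fin 3) ℝ := K.a₀ (ε⁻¹ • x)

/-- The diffusion matrix in the cylinder `i`. -/
def D (ε : ℝ) (i : Fin 3) (x : E3) : Matrix (Fin 3) (Fin 3) ℝ := K.a i (ε⁻¹ • x)

/-- The velocity in the node. -/
def V₀ (ε : ℝ) (x : E3) : E3 := K.v₀ (ε⁻¹ • x)

/-- The velocity in the cylinder `i`. -/
def V (ε : ℝ) (i : Fin 3) (x : E3) : E3 :=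
  WithLp.toLp 2 fun j => if j = i then K.v i (x i) else ε * K.w i (stretch ε i x) j

end Coefficients

/-! ### Classical solutions -/

/-- `ψ ∈ C^{2,1}(S × (0, T))` for an open set `S`. -/
structure IsC21 (T : ℝ) (S : Set E3) (ψ : E3 → ℝ → ℝ) : Prop where
  space : ∀ t ∈ Set.Ioo 0 T, ContDiffOn ℝ 2 (fun y => ψ y t) S
  time : ∀ x ∈ S, ∀ t ∈ Set.Ioo 0 T, DifferentiableAt ℝ (ψ x) t
  time_continuous :
    ContinuousOn (fun q : E3 × ℝ => deriv (ψ q.1) q.2) (S ×ˢ Set.Ioo 0 T)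
  hessian_continuous :
    ContinuousOn (fun q : E3 × ℝ => iteratedFDeriv ℝ 2 (fun y => ψ y q.2) q.1)
      (S ×ˢ Set.Ioo 0 T)

/-- The gradient in `x` of `ψ(·, t)` on the junction together with its side boundary (one-sided
at boundary points). -/
def sideGradient (J : Geometry) (ε : ℝ) (ψ : E3 → ℝ → ℝ) (x : E3) (t : ℝ) : E3 :=
  gradientWithin (fun y => ψ y t) (J.junction ε ∪ J.sideBoundary ε) x

/-- `ψ` is a classical solution of the convection-dominated parabolic problem in the junction,
with right-hand sides `F₀` (node), `F i` (cylinders) and lateral flux data `ε Φ i`. -/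
structure IsClassicalSolution {J : Geometry} (K : Coefficients J) (T ε : ℝ)
    (F₀ : E3 → ℝ → ℝ) (F Φ : Fin 3 → E3 → ℝ → ℝ) (ψ : E3 → ℝ → ℝ) : Prop where
  /-- `ψ` is continuous on the closed space-time domain -/
  continuous : ContinuousOn (fun q : E3 × ℝ => ψ q.1 q.2)
    (closure (J.junction ε) ×ˢ Set.Icc 0 T)
  /-- `ψ` is `C¹` in `x` in the junction (also across the bases `x_i = ε ℓ₀`) and up to its
  side boundary -/
  differentiable : ∀ t ∈ Set.Ioo 0 T,
    DifferentiableOn ℝ (fun y => ψ y t) (J.junction ε ∪ J.sideBoundary ε)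
  gradient_continuous : ContinuousOn (fun q : E3 × ℝ => sideGradient J ε ψ q.1 q.2)
    ((J.junction ε ∪ J.sideBoundary ε) ×ˢ Set.Ioo 0 T)
  regular_node : IsC21 T (J.node ε) ψ
  regular_cylinder : ∀ i, IsC21 T (J.cylinder ε i) ψ
  eq_cylinder : ∀ i, ∀ x ∈ J.cylinder ε i, ∀ t ∈ Set.Ioo 0 T,
    deriv (ψ x) t
      - ε * divergence (fun y => applyMat (K.D ε i y) (gradient (fun z => ψ z t) y)) x
      + divergence (fun y => ψ y t • K.V ε i y) x = F i x t
  bc_lateral : ∀ i, ∀ x ∈ J.lateral ε i, ∀ t ∈ Set.Ioo 0 T,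
    ∀ ν, IsOutwardNormal (J.junction ε) x ν →
      inner ℝ (-(ε • applyMat (K.D ε i x) (sideGradient J ε ψ x t)) + ψ x t • K.V ε i x) ν
        = ε * Φ i x t
  eq_node : ∀ x ∈ J.node ε, ∀ t ∈ Set.Ioo 0 T,
    deriv (ψ x) t
      - ε * divergence (fun y => applyMat (K.D₀ ε y) (gradient (fun z => ψ z t) y)) x
      + inner ℝ (K.V₀ ε x) (gradient (fun z => ψ z t) x) = F₀ x t
  bc_node : ∀ x ∈ J.nodeBoundary ε, ∀ t ∈ Set.Ioo 0 T,
    ∀ ν, IsOutwardNormal (J.junction ε) x ν →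
      inner ℝ (applyMat (K.D₀ ε x) (sideGradient J ε ψ x t)) ν = 0
  dirichlet : ∀ i, ∀ x ∈ J.crossSection ε i (J.ℓ i), ∀ t ∈ Set.Ioo 0 T, ψ x t = 0
  initial : ∀ x ∈ J.junction ε, ψ x 0 = 0

/-- The support of `f` in `x_i` lies, uniformly in `t`, in a compact part of `(ε ℓ₀, ℓ_i)`. -/
def LateralSupport (J : Geometry) (T ε : ℝ) (i : Fin 3) (f : E3 → ℝ → ℝ) : Prop :=
  ∃ b c : ℝ, ε * J.ℓ₀ < b ∧ c < J.ℓ i ∧ ∀ x ∈ J.lateral ε i, ∀ t ∈ Set.Ioo 0 T,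
    x i ∉ Set.Icc b c → f x t = 0

end

end ThinJunction

/-!
The estimate is a comparison of the solution with the barrier `μ exp (λ t + φ(x))`, where the
exponent `φ` is chosen separately in the node and in each cylinder. If `μ` is the maximum of the
quotient of the solution and the barrier, then the barrier touches the solution from above at some
point, and the problem at that point bounds `μ` by the data. Everything has to be uniform in `ε`,
so the exponents have bounded gradients and second derivatives of order `1 / ε`; then the operator
applied to `exp φ` is of order zero (`operator_exp_le`), and a large `λ` makes the barrier a strict
supersolution. The exponential form is used as it makes the lateral condition, in which the
normal velocity has no sign, hold for all admissible `ε` at once.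

In the cylinder `i` the exponent is `M ε (|x̄_i|² / ε² - h_i(x_i)²) - (x_i - ε ℓ₀)`. The first
bracket is constant on the lateral surface, so its gradient is normal there and for large `M` its
conormal derivative dominates the velocity and the flux data (`exists_lateral_bound`). In the node
the exponent is `-M ε Q(x / ε)` with `Q` the cut-off of `h_i(0)² - |ξ̄_i|²` to the collars of the
discs. This `Q` is nonnegative, and zero on the node surface.

The exponents agree on the base `x_i = ε ℓ₀`, where the barrier has a concave kink: its logarithmic
slope along the axis falls from `0` to `-1`. A differentiable solution cannot touch it there
(`base_contact`). This is why continuity of the gradient replaces an equation on the base.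

On the node surface the barrier only satisfies the Neumann condition weakly, and in place of a Hopf
lemma the difference is penalized by `η g + |x - x₀|⁴` with a local defining function `g` of the
surface (`nodeBoundary_contact`).

The estimate from below is the one from above for the solution with the opposite sign. For this
the one-sided gradients have to be odd in the solution, that is, the derivatives up to the boundary
have to be unique (`uniqueDiffWithinAt_sideDomain`).
-/

namespace ThinJunction

noncomputable section

open Filter Topology Set
open scoped MatrixOrder

/-! ### Partial derivatives and the operator in non-divergence form -/

/-- The partial derivative `∂ₖ f` at `x`. -/
def pd (k : Fin 3) (f : E3 → ℝ) (x : E3) : ℝ := fderiv ℝ f x (EuclideanSpace.single k 1)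

/-- The expanded form `∑ₖₗ (∂ₖ Aₖₗ ∂ₗ f + Aₖₗ ∂ₖ ∂ₗ f)` of `div (A ∇f)` at `x`. -/
def divForm (A : E3 → Matrix (Fin 3) (Fin 3) ℝ) (f : E3 → ℝ) (x : E3) : ℝ :=
  ∑ k, ∑ l, (pd k (fun y => A y k l) x * pd l f x + A x k l * pd k (pd l f) x)

theorem gradient_apply (f : E3 → ℝ) (y : E3) (l : Fin 3) : gradient f y l = pd l f y := by
  have h := inner_gradient_left (𝕜 := ℝ) (f := f) (x := y) (y := EuclideanSpace.single l 1)
  rw [EuclideanSpace.inner_single_right] at h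
  simpa [pd] using h

theorem map_eq_sum_single {F : Type*} [NormedAddCommGroup F] [NormedSpace ℝ F] (L : E3 →L[ℝ] F)
    (v : E3) : L v = ∑ k, v k • L (EuclideanSpace.single k 1) := by
  have h : v = ∑ k, v k • EuclideanSpace.single k (1 : ℝ) := by
    ext j
    simp [Finset.sum_apply, Pi.single_apply]
  conv_lhs => rw [h]
  rw [map_sum]
  exact Finset.sum_congr rfl fun k _ => map_smul _ _ _

theorem fderiv_eq_sum_pd (f : E3 → ℝ) (x v : E3) : fderiv ℝ f x v = ∑ k, v k * pd k f x :=
  map_eq_sum_single (fderiv ℝ f x) v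

theorem inner_eq_sum (x y : E3) : inner ℝ x y = ∑ k, x k * y k := by
  simp [PiLp.inner_apply, mul_comm]

theorem applyMat_apply (A : Matrix (Fin 3) (Fin 3) ℝ) (v : E3) (k : Fin 3) :
    applyMat A v k = ∑ l, A k l * v l := by
  simp [applyMat, Matrix.mulVec, dotProduct]

theorem inner_applyMat (A : Matrix (Fin 3) (Fin 3) ℝ) (x y : E3) :
    inner ℝ (applyMat A x) y = ∑ k, ∑ l, A k l * x l * y k := by
  simp [inner_eq_sum, applyMat_apply, Finset.sum_mul]

theorem inner_applyMat_comm {A : Matrix (Fin 3) (Fin 3) ℝ} (hA : A.IsSymm) (x y : E3) :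
    inner ℝ (applyMat A x) y = inner ℝ x (applyMat A y) := by
  rw [real_inner_comm (applyMat A y) x, inner_applyMat, inner_applyMat, Finset.sum_comm]
  refine Finset.sum_congr rfl fun k _ => Finset.sum_congr rfl fun l _ => ?_
  rw [hA.apply]; ring

theorem pd_congr {f g : E3 → ℝ} {x : E3} (h : f =ᶠ[𝓝 x] g) (k : Fin 3) :
    pd k f x = pd k g x := by
  rw [pd, pd, h.fderiv_eq]

theorem differentiableAt_fderiv {f : E3 → ℝ} {x : E3} (hf : ContDiffAt ℝ 2 f x) :
    DifferentiableAt ℝ (fderiv ℝ f) x :=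
  (hf.fderiv_right (m := 1) (by norm_num)).differentiableAt (by norm_num)

theorem differentiableAt_pd {f : E3 → ℝ} {x : E3} (hf : ContDiffAt ℝ 2 f x) (l : Fin 3) :
    DifferentiableAt ℝ (pd l f) x :=
  (differentiableAt_fderiv hf).clm_apply (differentiableAt_const _)

theorem eventually_differentiableAt {f : E3 → ℝ} {x : E3} (hf : ContDiffAt ℝ 2 f x) :
    ∀ᶠ y in 𝓝 x, DifferentiableAt ℝ f y :=
  (hf.eventually (by simp)).mono fun _ h => h.differentiableAt (by norm_num)

theorem pd_pd {f : E3 → ℝ} {x : E3} (hf : ContDiffAt ℝ 2 f x) (k l : Fin 3) :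
    pd k (pd l f) x =
      fderiv ℝ (fderiv ℝ f) x (EuclideanSpace.single k 1) (EuclideanSpace.single l 1) := by
  unfold pd
  rw [fderiv_clm_apply (differentiableAt_fderiv hf) (differentiableAt_const _)]
  simp

theorem pd_add {f g : E3 → ℝ} {x : E3} (hf : DifferentiableAt ℝ f x)
    (hg : DifferentiableAt ℝ g x) (k : Fin 3) :
    pd k (fun y => f y + g y) x = pd k f x + pd k g x := by
  simp [pd, fderiv_fun_add hf hg]

theorem pd_const_mul (c : ℝ) (f : E3 → ℝ) (x : E3) (k : Fin 3) :
    pd k (fun y => c * f y) x = c * pd k f x := by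
  have h' : fderiv ℝ (fun y => c * f y) x = c • fderiv ℝ f x :=
    congrFun (fderiv_const_smul_field (𝕜 := ℝ) (f := f) c) x
  simp [pd, h']

theorem pd_mul {f g : E3 → ℝ} {x : E3} (hf : DifferentiableAt ℝ f x)
    (hg : DifferentiableAt ℝ g x) (k : Fin 3) :
    pd k (fun y => f y * g y) x = f x * pd k g x + g x * pd k f x := by
  simp [pd, fderiv_fun_mul hf hg]

theorem pd_exp {f : E3 → ℝ} {x : E3} (hf : DifferentiableAt ℝ f x) (k : Fin 3) :
    pd k (fun y => Real.exp (f y)) x = Real.exp (f x) * pd k f x := by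
  simp [pd, fderiv_exp hf]

theorem pd_comp_smul (f : E3 → ℝ) (c : ℝ) (x : E3) (k : Fin 3) :
    pd k (fun y => f (c • y)) x = c * pd k f (c • x) := by
  simp [pd, fderiv_comp_smul]

theorem divergence_eq (G : E3 → E3) (x : E3) : divergence G x = ∑ k, pd k (fun y => G y k) x := rfl

/-- The product rule for `div (A ∇f)`. -/
theorem divergence_applyMat_gradient {A : E3 → Matrix (Fin 3) (Fin 3) ℝ} {f : E3 → ℝ} {x : E3}
    (hA : ∀ k l, DifferentiableAt ℝ (fun y => A y k l) x) (hf : ContDiffAt ℝ 2 f x) :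
    divergence (fun y => applyMat (A y) (gradient f y)) x = divForm A f x := by
  rw [divergence_eq, divForm]
  refine Finset.sum_congr rfl fun k _ => ?_
  have h : (fun y => applyMat (A y) (gradient f y) k) = fun y => ∑ l, A y k l * pd l f y := by
    funext y; simp [applyMat_apply, gradient_apply]
  have hd : ∀ l ∈ Finset.univ, DifferentiableAt ℝ (fun y => A y k l * pd l f y) x :=
    fun l _ => (hA k l).mul (differentiableAt_pd hf l)
  rw [h, pd, fderiv_fun_sum hd, _root_.sum_apply]
  refine Finset.sum_congr rfl fun l _ => ?_
  have := pd_mul (hA k l) (differentiableAt_pd hf l) k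
  rw [pd] at this
  rw [this]; ring

theorem divForm_add (A : E3 → Matrix (Fin 3) (Fin 3) ℝ) {f g : E3 → ℝ} {x : E3}
    (hf : ContDiffAt ℝ 2 f x) (hg : ContDiffAt ℝ 2 g x) :
    divForm A (fun y => f y + g y) x = divForm A f x + divForm A g x := by
  have h1 : ∀ l, pd l (fun y => f y + g y) =ᶠ[𝓝 x] fun y => pd l f y + pd l g y := fun l => by
    filter_upwards [eventually_differentiableAt hf, eventually_differentiableAt hg] with y h h'
    exact pd_add h h' l
  simp only [divForm, ← Finset.sum_add_distrib]
  refine Finset.sum_congr rfl fun k _ => Finset.sum_congr rfl fun l _ => ?_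
  rw [(h1 l).eq_of_nhds, pd_congr (h1 l), pd_add (differentiableAt_pd hf l) (differentiableAt_pd hg l)]
  ring

theorem divForm_const_mul (A : E3 → Matrix (Fin 3) (Fin 3) ℝ) (c : ℝ) (f : E3 → ℝ) (x : E3) :
    divForm A (fun y => c * f y) x = c * divForm A f x := by
  have h1 : ∀ l, pd l (fun y => c * f y) = fun y => c * pd l f y := fun l =>
    funext fun y => pd_const_mul c f y l
  simp only [divForm, Finset.mul_sum]
  refine Finset.sum_congr rfl fun k _ => Finset.sum_congr rfl fun l _ => ?_
  rw [h1, pd_const_mul]; ring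

theorem divForm_exp (A : E3 → Matrix (Fin 3) (Fin 3) ℝ) {f : E3 → ℝ} {x : E3}
    (hf : ContDiffAt ℝ 2 f x) :
    divForm A (fun y => Real.exp (f y)) x =
      Real.exp (f x) * (divForm A f x + ∑ k, ∑ l, A x k l * (pd k f x * pd l f x)) := by
  have h1 : ∀ l, pd l (fun y => Real.exp (f y)) =ᶠ[𝓝 x] fun y => Real.exp (f y) * pd l f y :=
    fun l => by
      filter_upwards [eventually_differentiableAt hf] with y h
      exact pd_exp h l
  have hd : DifferentiableAt ℝ f x := hf.differentiableAt (by norm_num)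
  simp only [divForm, ← Finset.sum_add_distrib, Finset.mul_sum]
  refine Finset.sum_congr rfl fun k _ => Finset.sum_congr rfl fun l _ => ?_
  rw [(h1 l).eq_of_nhds, pd_congr (h1 l), pd_mul hd.exp (differentiableAt_pd hf l), pd_exp hd]
  ring

theorem abs_sum_sum_le {g : Fin 3 → Fin 3 → ℝ} {C : ℝ} (h : ∀ k l, |g k l| ≤ C) :
    |∑ k, ∑ l, g k l| ≤ 9 * C := by
  calc |∑ k, ∑ l, g k l| ≤ ∑ k, |∑ l, g k l| := Finset.abs_sum_le_sum_abs _ _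
    _ ≤ ∑ _k : Fin 3, ∑ _l : Fin 3, C := Finset.sum_le_sum fun k _ =>
        (Finset.abs_sum_le_sum_abs _ _).trans (Finset.sum_le_sum fun l _ => h k l)
    _ = 9 * C := by simp; ring

theorem abs_divForm_le {A : E3 → Matrix (Fin 3) (Fin 3) ℝ} {f : E3 → ℝ} {x : E3} {a a' p p' : ℝ}
    (hA : ∀ k l, |A x k l| ≤ a) (hA' : ∀ k l m, |pd m (fun y => A y k l) x| ≤ a')
    (hf : ∀ k, |pd k f x| ≤ p) (hf' : ∀ k l, |pd k (pd l f) x| ≤ p') :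
    |divForm A f x| ≤ 9 * (a' * p + a * p') := by
  refine abs_sum_sum_le fun k l => (abs_add_le _ _).trans ?_
  rw [abs_mul, abs_mul]
  have := abs_nonneg (A x k l)
  have := abs_nonneg (pd k (fun y => A y k l) x)
  gcongr
  · exact (abs_nonneg _).trans (hA' k l k)
  · exact hA' k l k
  · exact hf l
  · exact (abs_nonneg _).trans (hA k l)
  · exact hA k l
  · exact hf' k l

/-! ### The second derivative test -/

theorem deriv_deriv_nonpos_of_isLocalMax {f : ℝ → ℝ} {x : ℝ} (hf : ContinuousAt f x)
    (h : IsLocalMax f x) : deriv (deriv f) x ≤ 0 := by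
  by_contra! hpos
  have hmin := isLocalMin_of_deriv_deriv_pos hpos h.deriv_eq_zero hf
  -- a point that is both a local maximum and a local minimum has a neighbourhood of constancy
  have hc : f =ᶠ[𝓝 x] fun _ => f x := by
    filter_upwards [h, hmin] with y h1 h2 using le_antisymm h1 h2
  have hc' : deriv f =ᶠ[𝓝 x] fun _ => 0 := by simpa using hc.deriv
  rw [hc'.deriv_eq] at hpos
  simp at hpos

theorem fderiv_fderiv_nonpos_of_isLocalMax {f : E3 → ℝ} {x : E3} (hf : ContDiffAt ℝ 2 f x)
    (h : IsLocalMax f x) (v : E3) : fderiv ℝ (fderiv ℝ f) x v v ≤ 0 := by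
  have hline : ∀ s : ℝ, HasDerivAt (fun s : ℝ => x + s • v) v s := fun s => by
    simpa using ((hasDerivAt_id s).smul_const v).const_add x
  have ht : Tendsto (fun s : ℝ => x + s • v) (𝓝 0) (𝓝 x) := by
    simpa using (hline 0).continuousAt.tendsto
  have hx : x + (0 : ℝ) • v = x := by simp
  have h1 : deriv (fun s : ℝ => f (x + s • v)) =ᶠ[𝓝 0] fun s => fderiv ℝ f (x + s • v) v := by
    filter_upwards [ht.eventually (eventually_differentiableAt hf)] with s hs
    exact (hs.hasFDerivAt.comp_hasDerivAt s (hline s)).deriv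
  have h2 : deriv (deriv fun s : ℝ => f (x + s • v)) 0 = fderiv ℝ (fderiv ℝ f) x v v := by
    rw [h1.deriv_eq]
    have hd : HasFDerivAt (fderiv ℝ f) (fderiv ℝ (fderiv ℝ f) x) (x + (0 : ℝ) • v) := by
      rw [hx]; exact (differentiableAt_fderiv hf).hasFDerivAt
    exact ((ContinuousLinearMap.apply ℝ ℝ v).hasFDerivAt.comp_hasDerivAt (0 : ℝ)
      (hd.comp_hasDerivAt (0 : ℝ) (hline 0))).deriv
  rw [← h2]
  refine deriv_deriv_nonpos_of_isLocalMax ?_ ?_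
  · exact ContinuousAt.comp (f := fun s : ℝ => x + s • v) (g := f)
      (by rw [hx]; exact hf.continuousAt) (hline 0).continuousAt
  · have := ht.eventually h
    simpa [IsLocalMax, IsMaxFilter] using this

theorem divForm_nonpos_of_isLocalMax {A : E3 → Matrix (Fin 3) (Fin 3) ℝ} {f : E3 → ℝ} {x : E3}
    (hsymm : (A x).IsSymm) (hpos : ∀ y : E3, 0 ≤ inner ℝ (applyMat (A x) y) y)
    (hf : ContDiffAt ℝ 2 f x) (h : IsLocalMax f x) : divForm A f x ≤ 0 := by
  have hpsd : (A x).PosSemidef := by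
    refine Matrix.PosSemidef.of_dotProduct_mulVec_nonneg ?_ fun y => ?_
    · rw [Matrix.IsHermitian, Matrix.conjTranspose_eq_transpose_of_trivial]; exact hsymm
    · have := hpos (WithLp.toLp 2 y)
      simpa [inner_eq_sum, applyMat, dotProduct, mul_comm] using this
  -- with `A = Bᵀ B`, the trace of `A` times the Hessian is a sum of Hessian values on rows of `B`
  obtain ⟨B, hB⟩ : ∃ B : Matrix (Fin 3) (Fin 3) ℝ, A x = B.transpose * B := by
    obtain ⟨B, hB⟩ := CStarAlgebra.nonneg_iff_eq_star_mul_self.mp hpsd.nonneg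
    refine ⟨B, ?_⟩
    rw [hB, Matrix.star_eq_conjTranspose, Matrix.conjTranspose_eq_transpose_of_trivial]
  have hz : ∀ l, pd l f x = 0 := fun l => by simp [pd, h.fderiv_eq_zero]
  have hH : ∀ v : E3, ∑ k, ∑ l, v k * v l * pd k (pd l f) x ≤ 0 := fun v => by
    refine le_of_eq_of_le ?_ (fderiv_fderiv_nonpos_of_isLocalMax hf h v)
    rw [map_eq_sum_single (fderiv ℝ (fderiv ℝ f) x) v, _root_.sum_apply]
    refine Finset.sum_congr rfl fun k _ => ?_
    rw [_root_.smul_apply, map_eq_sum_single (fderiv ℝ (fderiv ℝ f) x _) v, Finset.smul_sum]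
    refine Finset.sum_congr rfl fun l _ => ?_
    rw [pd_pd hf, smul_eq_mul, smul_eq_mul]; ring
  have : divForm A f x =
      ∑ m, ∑ k, ∑ l, B m k * B m l * pd k (pd l f) x := by
    simp only [divForm, hz, mul_zero, zero_add, hB, Matrix.mul_apply, Matrix.transpose_apply,
      Fin.sum_univ_three]
    ring
  rw [this]
  exact Finset.sum_nonpos fun m _ => by simpa using hH (WithLp.toLp 2 fun k => B m k)

/-! ### Outward normals and boundary contact -/

theorem fderiv_eq_of_gradient_eq {g : E3 → ℝ} {x w : E3} (h : gradient g x = w) (v : E3) :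
    fderiv ℝ g x v = inner ℝ w v := by
  rw [← h, inner_gradient_left]

/-- A direction `d` with `d · ν > 0` points out of the set, so `-d` points into it. -/
theorem IsOutwardNormal.eventually_mem {S : Set E3} {x ν d : E3} (h : IsOutwardNormal S x ν)
    (hd : 0 < inner ℝ ν d) : ∀ᶠ s : ℝ in 𝓝[>] 0, x + s • (-d) ∈ S := by
  obtain ⟨-, g, hg, hgx, ⟨c, hc, hgrad⟩, U, hU, hSU⟩ := h
  have hline : HasDerivAt (fun s : ℝ => x + s • (-d)) (-d) 0 := by
    simpa using ((hasDerivAt_id (0 : ℝ)).smul_const (-d)).const_add x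
  have hx : x + (0 : ℝ) • (-d) = x := by simp
  have hgd : HasFDerivAt g (fderiv ℝ g x) (x + (0 : ℝ) • (-d)) := by
    rw [hx]; exact (hg.differentiableAt (by norm_num)).hasFDerivAt
  have hder : HasDerivAt (fun s : ℝ => g (x + s • (-d))) (fderiv ℝ g x (-d)) 0 :=
    hgd.comp_hasDerivAt (0 : ℝ) hline
  have hneg : fderiv ℝ g x (-d) < 0 := by
    rw [fderiv_eq_of_gradient_eq hgrad, inner_neg_right, real_inner_smul_left]
    have := mul_pos hc hd
    linarith
  have hsl := (hder.hasDerivWithinAt (s := Ioi 0)).limsup_slope_le' (by simp) hneg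
  have ht : Tendsto (fun s : ℝ => x + s • (-d)) (𝓝[>] 0) (𝓝 x) := by
    have := hline.continuousAt.tendsto
    rw [hx] at this
    exact this.mono_left nhdsWithin_le_nhds
  filter_upwards [hsl, ht.eventually hU, self_mem_nhdsWithin] with s hs hsU hs0
  have hgs : g (x + s • (-d)) < 0 := by
    rw [slope_def_field, hx, hgx, sub_zero, sub_zero, div_neg_iff] at hs
    have : (0 : ℝ) < s := hs0
    rcases hs with hs | hs <;> linarith [hs.1, hs.2]
  have : x + s • (-d) ∈ S ∩ U := by rw [hSU]; exact ⟨hgs, hsU⟩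
  exact this.1

/-- If `f` touches `B` from below on `S` at a boundary point, then the derivative of `f`
along an outward direction is at least that of `B`. -/
theorem IsOutwardNormal.fderiv_le {S S' : Set E3} {x ν d : E3} (h : IsOutwardNormal S x ν)
    (hd : 0 < inner ℝ ν d) (hSS' : S ⊆ S') {f B : E3 → ℝ} (hf : DifferentiableWithinAt ℝ f S' x)
    (hB : DifferentiableAt ℝ B x) (hle : ∀ᶠ y in 𝓝 x, y ∈ S → f y ≤ B y) (heq : f x = B x) :
    fderiv ℝ B x d ≤ fderivWithin ℝ f S' x d := by
  have hmax : IsLocalMaxOn (fun y => f y - B y) S x := by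
    filter_upwards [eventually_nhdsWithin_iff.2 hle] with y hy
    linarith
  have hder := (hf.hasFDerivWithinAt.mono hSS').sub hB.hasFDerivAt.hasFDerivWithinAt
  have := hmax.hasFDerivWithinAt_nonpos hder
    (mem_posTangentConeAt_of_frequently_mem (h.eventually_mem hd).frequently)
  simp only [_root_.sub_apply, map_neg] at this
  linarith

/-- If an open set `S` coincides near `x` with the open set `A ⊆ S` up to the boundary of `A`,
then an outward normal to `A` at `x` is one to `S`. -/
theorem IsOutwardNormal.of_subset {A S W : Set E3} {x ν : E3} (h : IsOutwardNormal A x ν)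
    (hAS : A ⊆ S) (hS : IsOpen S) (hW : W ∈ 𝓝 x) (hSW : S ∩ W ⊆ closure A) :
    IsOutwardNormal S x ν := by
  obtain ⟨hν, g, hg, hgx, ⟨c, hc, hgrad⟩, U, hU, hAU⟩ := h
  refine ⟨hν, g, hg, hgx, ⟨c, hc, hgrad⟩, ?_⟩
  have hg2 : ContDiffAt ℝ 2 g x := hg.of_le (by norm_num)
  have hne : fderiv ℝ g x ≠ 0 := fun h0 => by
    have := fderiv_eq_of_gradient_eq hgrad ν
    rw [h0, real_inner_smul_left, real_inner_self_eq_norm_sq, hν] at this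
    simp at this
    exact hc.ne this
  have hne' : ∀ᶠ y in 𝓝 x, fderiv ℝ g y ≠ 0 :=
    (differentiableAt_fderiv hg2).continuousAt.eventually_ne hne
  obtain ⟨V, hV, hVo, hxV⟩ := eventually_nhds_iff.1
    (((eventually_differentiableAt hg2).and hne').and (inter_mem hU hW))
  refine ⟨V, hVo.mem_nhds hxV, ?_⟩
  -- in the closure of `A` near `x` the defining function is nonpositive
  have hcl : ∀ y ∈ closure A, y ∈ V → g y ≤ 0 := fun y hy hyV => by
    have hcont : ContinuousWithinAt g (A ∩ V) y := (hV y hyV).1.1.continuousAt.continuousWithinAt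
    have hyc : y ∈ closure (A ∩ V) := by
      rw [inter_comm]; exact hVo.inter_closure ⟨hyV, hy⟩
    have : MapsTo g (A ∩ V) (Iic 0) := fun z hz => by
      have : z ∈ A ∩ U := ⟨hz.1, (hV z hz.2).2.1⟩
      rw [hAU] at this
      exact (show g z < 0 from this.1).le
    simpa using hcont.mem_closure hyc this
  ext y
  constructor
  · rintro ⟨hyS, hyV⟩
    refine ⟨?_, hyV⟩
    have hmax : ∀ᶠ z in 𝓝 y, g z ≤ 0 := by
      filter_upwards [hS.mem_nhds hyS, hVo.mem_nhds hyV] with z hzS hzV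
      exact hcl z (hSW ⟨hzS, (hV z hzV).2.2⟩) hzV
    refine lt_of_le_of_ne hmax.self_of_nhds fun h0 => (hV y hyV).1.2 ?_
    have : IsLocalMax g y := by
      filter_upwards [hmax] with z hz
      rw [h0]; exact hz
    exact this.fderiv_eq_zero
  · rintro ⟨hy, hyV⟩
    have : y ∈ {y | g y < 0} ∩ U := ⟨hy, (hV y hyV).2.1⟩
    rw [← hAU] at this
    exact ⟨hAS this.1, hyV⟩

theorem IsOutwardNormal.image_smul {S : Set E3} {ξ ν : E3} (h : IsOutwardNormal S ξ ν) {ε : ℝ}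
    (hε : 0 < ε) : IsOutwardNormal ((fun y : E3 => ε • y) '' S) (ε • ξ) ν := by
  obtain ⟨hν, g, hg, hgx, ⟨c, hc, hgrad⟩, U, hU, hSU⟩ := h
  have hξ : ε⁻¹ • ε • ξ = ξ := inv_smul_smul₀ hε.ne' ξ
  have hcont : ContinuousAt (fun y : E3 => ε⁻¹ • y) (ε • ξ) :=
    (continuous_const_smul ε⁻¹).continuousAt
  refine ⟨hν, fun y => g (ε⁻¹ • y), ?_, by simpa [hξ] using hgx, ⟨ε⁻¹ * c, by positivity, ?_⟩,
    (fun y : E3 => ε⁻¹ • y) ⁻¹' U, ?_, ?_⟩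
  · refine ContDiffAt.comp (ε • ξ) (g := g) (f := fun y : E3 => ε⁻¹ • y) ?_ ?_
    · rw [hξ]; exact hg
    · exact (contDiff_const_smul ε⁻¹).contDiffAt
  · ext k
    rw [gradient_apply, pd_comp_smul, hξ, ← gradient_apply, hgrad]
    simp [mul_assoc]
  · refine hcont.preimage_mem_nhds ?_
    rw [hξ]; exact hU
  · have hpre : ∀ y : E3, y ∈ (fun y : E3 => ε • y) '' S ↔ ε⁻¹ • y ∈ S := fun y => by
      constructor
      · rintro ⟨z, hz, rfl⟩
        simpa [inv_smul_smul₀ hε.ne'] using hz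
      · exact fun hy => ⟨_, hy, smul_inv_smul₀ hε.ne' y⟩
    ext y
    have := Set.ext_iff.1 hSU (ε⁻¹ • y)
    simp only [mem_inter_iff, mem_ofPred_eq, mem_preimage, hpre] at this ⊢
    exact this

/-- The derivative of a function of time at a point where it is largest among earlier times. -/
theorem deriv_nonneg_of_le_left {f : ℝ → ℝ} {t a : ℝ} (ha : a < t) (hf : DifferentiableAt ℝ f t)
    (h : ∀ s ∈ Icc a t, f s ≤ f t) : 0 ≤ deriv f t := by
  have hmax : IsLocalMaxOn f (Icc a t) t := by
    filter_upwards [self_mem_nhdsWithin] with s hs using h s hs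
  have hcone : (a - t) ∈ posTangentConeAt (Icc a t) t := by
    refine sub_mem_posTangentConeAt_of_segment_subset ?_
    rw [segment_symm, segment_eq_Icc ha.le]
  have := hmax.hasFDerivWithinAt_nonpos hf.hasFDerivAt.hasFDerivWithinAt hcone
  have h2 : fderiv ℝ f t (a - t) = (a - t) * deriv f t := by
    rw [← smul_eq_mul (a - t), ← fderiv_apply_one_eq_deriv, ← map_smul, smul_eq_mul, mul_one]
  rw [h2] at this
  nlinarith

/-! ### The squared distance from an axis -/

theorem transSq_eq (i : Fin 3) (x : E3) : transSq i x = ∑ k, if k = i then 0 else x k ^ 2 := by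
  rw [transSq, ← Finset.sum_erase (f := fun k => if k = i then 0 else x k ^ 2) Finset.univ
    (if_pos rfl)]
  exact Finset.sum_congr rfl fun j hj => by rw [if_neg (Finset.ne_of_mem_erase hj)]

theorem transSq_nonneg (i : Fin 3) (x : E3) : 0 ≤ transSq i x :=
  Finset.sum_nonneg fun _ _ => sq_nonneg _

theorem continuous_transSq (i : Fin 3) : Continuous (transSq i) := by
  unfold transSq; fun_prop

theorem contDiff_transSq (i : Fin 3) {n : ℕ∞} : ContDiff ℝ n (transSq i) := by
  unfold transSq; fun_prop

theorem transSq_smul (i : Fin 3) (c : ℝ) (x : E3) : transSq i (c • x) = c ^ 2 * transSq i x := by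
  simp only [transSq, PiLp.smul_apply, smul_eq_mul, mul_pow, Finset.mul_sum]

theorem sq_le_transSq {i j : Fin 3} (h : j ≠ i) (x : E3) : x j ^ 2 ≤ transSq i x :=
  Finset.single_le_sum (f := fun k => x k ^ 2) (fun _ _ => sq_nonneg _)
    (Finset.mem_erase.2 ⟨h, Finset.mem_univ _⟩)

theorem transSq_congr {i : Fin 3} {x y : E3} (h : ∀ j, j ≠ i → x j = y j) :
    transSq i x = transSq i y :=
  Finset.sum_congr rfl fun j hj => by rw [h j (Finset.ne_of_mem_erase hj)]

theorem transSq_add_single (i : Fin 3) (x : E3) (s : ℝ) :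
    transSq i (x + s • EuclideanSpace.single i 1) = transSq i x :=
  transSq_congr fun j hj => by simp [hj]

theorem transSq_pair {i j : Fin 3} (h : i ≠ j) (a b : ℝ) :
    transSq i (a • EuclideanSpace.single i 1 + b • EuclideanSpace.single j 1) = b ^ 2 := by
  rw [transSq_eq, Finset.sum_eq_single j]
  · simp [h.symm]
  · intro k _ hk
    simp only [ite_eq_left_iff]
    intro hki
    simp [hk, hki]
  · simp

/-- The point obtained from `x` by contracting the coordinates other than the `i`-th by `1 - s`
and moving the `i`-th coordinate by `s m`. -/
def contract (i : Fin 3) (m : ℝ) (x : E3) (s : ℝ) : E3 :=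
  (1 - s) • x + (s * (x i + m)) • EuclideanSpace.single i 1

theorem contract_apply_self (i : Fin 3) (m : ℝ) (x : E3) (s : ℝ) :
    contract i m x s i = x i + s * m := by
  simp [contract]; ring

theorem transSq_contract (i : Fin 3) (m : ℝ) (x : E3) (s : ℝ) :
    transSq i (contract i m x s) = (1 - s) ^ 2 * transSq i x := by
  rw [contract, transSq_add_single, transSq_smul]

theorem tendsto_contract (i : Fin 3) (m : ℝ) (x : E3) :
    Tendsto (contract i m x) (𝓝[>] 0) (𝓝 x) := by
  have hc : Continuous (contract i m x) := by unfold contract; fun_prop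
  have := hc.tendsto 0
  rw [show contract i m x 0 = x by simp [contract]] at this
  exact this.mono_left nhdsWithin_le_nhds

theorem sq_one_sub_mul_lt {s a b : ℝ} (hs : 0 < s) (hs1 : s < 1) (hab : a ≤ b)
    (hb : 0 < b) : (1 - s) ^ 2 * a < b := by
  have h1 : (1 - s) ^ 2 * a ≤ (1 - s) ^ 2 * b := by gcongr
  have h2 : (1 - s) ^ 2 < 1 := by nlinarith
  nlinarith

/-! ### The pieces of the junction -/

namespace Geometry

variable (J : Geometry)

theorem ℓ₀_pos : 0 < J.ℓ₀ := J.ℓ₀_mem.1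

theorem ℓ₀_lt_ℓ (i : Fin 3) : J.ℓ₀ < J.ℓ i := by
  have := J.ℓ₀_mem.2; have := J.one_le_ℓ i; linarith

theorem ℓ_pos (i : Fin 3) : 0 < J.ℓ i := J.ℓ₀_pos.trans (J.ℓ₀_lt_ℓ i)

theorem zero_mem_Icc (i : Fin 3) : (0 : ℝ) ∈ Icc 0 (J.ℓ i) := ⟨le_rfl, (J.ℓ_pos i).le⟩

theorem continuousOn_h (i : Fin 3) : ContinuousOn (J.h i) (Icc 0 (J.ℓ i)) :=
  (J.h_smooth i).continuousOn

theorem isOpen_tube (i : Fin 3) {a C : ℝ} (ha : 0 ≤ a) :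
    IsOpen {x : E3 | a < x i ∧ x i < J.ℓ i ∧ transSq i x < C * J.h i (x i) ^ 2} := by
  have hs : IsOpen {x : E3 | x i ∈ Ioo a (J.ℓ i)} :=
    isOpen_Ioo.preimage (by fun_prop : Continuous fun x : E3 => x i)
  have hc : ContinuousOn (fun x : E3 => transSq i x - C * J.h i (x i) ^ 2)
      {x : E3 | x i ∈ Ioo a (J.ℓ i)} := by
    refine (continuous_transSq i).continuousOn.sub (continuousOn_const.mul (ContinuousOn.pow ?_ 2))
    exact (J.continuousOn_h i).comp (by fun_prop) fun x hx => ⟨ha.trans hx.1.le, hx.2.le⟩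
  convert hc.isOpen_inter_preimage hs isOpen_Iio (t := Iio 0) using 1
  ext x
  constructor
  · rintro ⟨h1, h2, h3⟩
    exact ⟨⟨h1, h2⟩, sub_neg.2 h3⟩
  · rintro ⟨⟨h1, h2⟩, h3⟩
    exact ⟨h1, h2, sub_neg.1 h3⟩

theorem isClosed_tube (i : Fin 3) {a C : ℝ} (ha : 0 ≤ a) :
    IsClosed {x : E3 | x i ∈ Icc a (J.ℓ i) ∧ transSq i x ≤ C * J.h i (x i) ^ 2} := by
  have hs : IsClosed {x : E3 | x i ∈ Icc a (J.ℓ i)} :=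
    isClosed_Icc.preimage (by fun_prop : Continuous fun x : E3 => x i)
  have hc : ContinuousOn (fun x : E3 => transSq i x - C * J.h i (x i) ^ 2)
      {x : E3 | x i ∈ Icc a (J.ℓ i)} := by
    refine (continuous_transSq i).continuousOn.sub (continuousOn_const.mul (ContinuousOn.pow ?_ 2))
    exact (J.continuousOn_h i).comp (by fun_prop) fun x hx => ⟨ha.trans hx.1, hx.2⟩
  convert hc.preimage_isClosed_of_isClosed hs isClosed_Iic (t := Iic 0) using 1
  ext x
  exact ⟨fun h => ⟨h.1, sub_nonpos.2 h.2⟩, fun h => ⟨h.1, sub_nonpos.1 h.2⟩⟩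

theorem isOpen_cylinder {ε : ℝ} (hε : 0 < ε) (i : Fin 3) : IsOpen (J.cylinder ε i) :=
  J.isOpen_tube i (mul_pos hε J.ℓ₀_pos).le

theorem mem_closure_cylinder {ε : ℝ} (hε : 0 < ε) {i : Fin 3} {x : E3}
    (hx : x ∈ closure (J.cylinder ε i)) :
    x i ∈ Icc (ε * J.ℓ₀) (J.ℓ i) ∧ transSq i x ≤ ε ^ 2 * J.h i (x i) ^ 2 :=
  closure_minimal (s := J.cylinder ε i)
    (t := {x : E3 | x i ∈ Icc (ε * J.ℓ₀) (J.ℓ i) ∧ transSq i x ≤ ε ^ 2 * J.h i (x i) ^ 2})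
    (fun _ hy => ⟨⟨hy.1.le, hy.2.1.le⟩, hy.2.2.le⟩)
    (J.isClosed_tube i (mul_pos hε J.ℓ₀_pos).le) hx

theorem mem_Icc_of_closure_cylinder {ε : ℝ} (hε : 0 < ε) {i : Fin 3} {x : E3}
    (hx : x ∈ closure (J.cylinder ε i)) : x i ∈ Icc 0 (J.ℓ i) :=
  have h := (J.mem_closure_cylinder hε hx).1
  ⟨(mul_pos hε J.ℓ₀_pos).le.trans h.1, h.2⟩

theorem mem_closure_cylinder_of_eventually {ε : ℝ} (hε : 0 < ε) {i : Fin 3} {x : E3} (m : ℝ)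
    (hm : ∀ᶠ s in 𝓝[>] (0 : ℝ),
      x i + s * m ∈ Ioo (ε * J.ℓ₀) (J.ℓ i) ∧ J.h i (x i + s * m) = J.h i (x i))
    (hx : transSq i x ≤ ε ^ 2 * J.h i (x i) ^ 2) : x ∈ closure (J.cylinder ε i) := by
  refine mem_closure_of_tendsto (tendsto_contract i m x) ?_
  filter_upwards [hm, Ioo_mem_nhdsGT (zero_lt_one (α := ℝ))] with s hs hs1
  refine ⟨?_, ?_, ?_⟩
  · rw [contract_apply_self]; exact hs.1.1
  · rw [contract_apply_self]; exact hs.1.2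
  · rw [contract_apply_self, transSq_contract, hs.2]
    refine sq_one_sub_mul_lt hs1.1 hs1.2 hx ?_
    have : 0 < J.h i (x i) := hs.2 ▸ J.h_pos i _
      ⟨(mul_pos hε J.ℓ₀_pos).le.trans hs.1.1.le, hs.1.2.le⟩
    positivity

variable {J}

theorem Admissible.base_lt {ε : ℝ} (hε : J.Admissible ε) (i : Fin 3) : ε * J.ℓ₀ < J.ℓ i := by
  have := J.ℓ₀_lt_ℓ i
  have := J.ℓ₀_pos
  nlinarith [hε.lt_one]

theorem Admissible.base_mem {ε : ℝ} (hε : J.Admissible ε) (i : Fin 3) :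
    ε * J.ℓ₀ ∈ Icc 0 (J.ℓ i) :=
  ⟨(mul_pos hε.pos J.ℓ₀_pos).le, (hε.base_lt i).le⟩

theorem Admissible.h_base {ε : ℝ} (hε : J.Admissible ε) (i : Fin 3) :
    J.h i (ε * J.ℓ₀) = J.h i 0 :=
  J.h_left i _ (hε.base_mem i) hε.base.le

/-- The closed thin cylinder is described by the weak inequalities. -/
theorem Admissible.mem_closure_cylinder_iff {ε : ℝ} (hε : J.Admissible ε) {i : Fin 3} {x : E3} :
    x ∈ closure (J.cylinder ε i) ↔
      x i ∈ Icc (ε * J.ℓ₀) (J.ℓ i) ∧ transSq i x ≤ ε ^ 2 * J.h i (x i) ^ 2 := by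
  refine ⟨J.mem_closure_cylinder hε.pos, fun ⟨⟨h1, h2⟩, h3⟩ => ?_⟩
  have hb := hε.base_lt i
  have h0 := (hε.base_mem i).1
  rcases h1.eq_or_lt with h1' | h1'
  · refine J.mem_closure_cylinder_of_eventually hε.pos 1 ?_ h3
    have hp : 0 < min (J.δ - x i) (J.ℓ i - x i) := by
      rw [← h1']; exact lt_min (sub_pos.2 hε.base) (sub_pos.2 hb)
    filter_upwards [Ioo_mem_nhdsGT hp] with s hs
    have ha := hs.2.trans_le (min_le_left _ _)
    have hb := hs.2.trans_le (min_le_right _ _)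
    have hs0 := hs.1
    refine ⟨⟨by linarith, by linarith⟩, ?_⟩
    rw [J.h_left i (x i + s * 1) ⟨by linarith, by linarith⟩ (by linarith), ← h1', hε.h_base]
  · rcases h2.eq_or_lt with h2' | h2'
    · refine J.mem_closure_cylinder_of_eventually hε.pos (-1) ?_ h3
      have hp : 0 < min J.δ (x i - ε * J.ℓ₀) := lt_min J.δ_pos (sub_pos.2 h1')
      filter_upwards [Ioo_mem_nhdsGT hp] with s hs
      have ha := hs.2.trans_le (min_le_left _ _)
      have hb := hs.2.trans_le (min_le_right _ _)
      have hs0 := hs.1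
      refine ⟨⟨by linarith, by linarith⟩, ?_⟩
      rw [J.h_right i (x i + s * -1) ⟨by linarith, by linarith⟩ (by linarith), h2']
    · refine J.mem_closure_cylinder_of_eventually hε.pos 0 ?_ h3
      simp [h1', h2']

theorem Admissible.cylinder_nonempty {ε : ℝ} (hε : J.Admissible ε) (i : Fin 3) :
    (J.cylinder ε i).Nonempty := by
  have hb := hε.base_lt i
  have h0 := (hε.base_mem i).1
  have hi : (((ε * J.ℓ₀ + J.ℓ i) / 2) • EuclideanSpace.single i (1 : ℝ) : E3) i =
    (ε * J.ℓ₀ + J.ℓ i) / 2 := by simp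
  refine ⟨((ε * J.ℓ₀ + J.ℓ i) / 2) • EuclideanSpace.single i 1, ?_, ?_, ?_⟩
  · rw [hi]; linarith
  · rw [hi]; linarith
  · have ht : transSq i (((ε * J.ℓ₀ + J.ℓ i) / 2) • EuclideanSpace.single i (1 : ℝ)) = 0 := by
      have := transSq_add_single i 0 ((ε * J.ℓ₀ + J.ℓ i) / 2)
      rw [zero_add] at this
      rw [this]; simp [transSq]
    rw [hi, ht]
    have := J.h_pos i ((ε * J.ℓ₀ + J.ℓ i) / 2) ⟨by linarith, by linarith⟩
    have := hε.pos
    positivity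

theorem mem_node_iff {ε : ℝ} (hε : 0 < ε) {x : E3} : x ∈ J.node ε ↔ ε⁻¹ • x ∈ J.Ξ := by
  constructor
  · rintro ⟨z, hz, rfl⟩
    simpa [inv_smul_smul₀ hε.ne'] using hz
  · exact fun hy => ⟨_, hy, smul_inv_smul₀ hε.ne' x⟩

theorem node_eq_preimage {ε : ℝ} (hε : 0 < ε) :
    J.node ε = (Homeomorph.smulOfNeZero ε⁻¹ (inv_ne_zero hε.ne') : E3 ≃ₜ E3) ⁻¹' J.Ξ :=
  ext fun _ => mem_node_iff hε

theorem isOpen_node {ε : ℝ} (hε : 0 < ε) : IsOpen (J.node ε) := by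
  rw [node_eq_preimage hε]; exact J.Ξ_open.preimage (Homeomorph.continuous _)

theorem mem_closure_node_iff {ε : ℝ} (hε : 0 < ε) {x : E3} :
    x ∈ closure (J.node ε) ↔ ε⁻¹ • x ∈ closure J.Ξ := by
  rw [node_eq_preimage hε, ← Homeomorph.preimage_closure]; rfl

theorem mem_frontier_node_iff {ε : ℝ} (hε : 0 < ε) {x : E3} :
    x ∈ frontier (J.node ε) ↔ ε⁻¹ • x ∈ frontier J.Ξ := by
  rw [node_eq_preimage hε, ← Homeomorph.preimage_frontier]; rfl

theorem le_of_mem_closure_Ξ {ξ : E3} (h : ξ ∈ closure J.Ξ) (i : Fin 3) : ξ i ≤ J.ℓ₀ :=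
  closure_minimal (t := {ξ : E3 | ξ i ≤ J.ℓ₀}) (fun y hy => (J.Ξ_lt y hy i).le)
    (isClosed_le (by fun_prop) continuous_const) h

theorem le_of_mem_closure_node {ε : ℝ} (hε : 0 < ε) {x : E3} (h : x ∈ closure (J.node ε))
    (i : Fin 3) : x i ≤ ε * J.ℓ₀ := by
  have := le_of_mem_closure_Ξ ((mem_closure_node_iff hε).1 h) i
  rw [PiLp.smul_apply, smul_eq_mul, inv_mul_le_iff₀ hε] at this
  exact this

/-! ### The collars of the node -/

/-- Near the planes `ξ_i = ℓ₀` the node is a circular cylinder, and the collars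
`ξ_i > ℓ₀ - c` of the node are disjoint for different `i`. -/
structure IsCollar (J : Geometry) (c : ℝ) : Prop where
  pos : 0 < c
  mem_iff : ∀ i, ∀ ξ : E3, J.ℓ₀ - c < ξ i → ξ i < J.ℓ₀ → (ξ ∈ J.Ξ ↔ transSq i ξ < J.h i 0 ^ 2)
  h_lt : ∀ i, J.h i 0 < J.ℓ₀ - c

/-- Two closed cylinders with `h_i(0) ≥ ℓ₀` would meet, so disjointness of the cylinders
separates the discs and makes disjoint collars possible. -/
theorem Admissible.exists_isCollar {ε : ℝ} (hε : J.Admissible ε) : ∃ c, J.IsCollar c := by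
  obtain ⟨c, hc, hmem⟩ := J.Ξ_collar
  have hℓ := J.ℓ₀_pos
  have hpair : ∀ i j, i ≠ j → J.ℓ₀ ≤ J.h i 0 → J.ℓ₀ ≤ J.h j 0 := by
    intro i j hij hi
    by_contra! hj
    obtain ⟨a, ha, ha'⟩ := exists_between
      (max_lt (max_lt (sub_lt_self J.ℓ₀ hc) hj) hℓ : max (max (J.ℓ₀ - c) (J.h j 0)) 0 < J.ℓ₀)
    simp only [max_lt_iff] at ha
    set ξ : E3 := a • EuclideanSpace.single i 1 + a • EuclideanSpace.single j 1 with hξ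
    have hξi : ξ i = a := by simp [hξ, hij]
    have hξj : ξ j = a := by simp [hξ, hij.symm]
    have hin : ξ ∈ J.Ξ := by
      rw [hmem i ξ (by rw [hξi]; exact ha.1.1) (by rw [hξi]; exact ha'), hξ, transSq_pair hij]
      have := ha.2
      gcongr
      exact ha'.trans_le hi
    rw [hmem j ξ (by rw [hξj]; exact ha.1.1) (by rw [hξj]; exact ha'), hξ, add_comm,
      transSq_pair hij.symm] at hin
    have := J.h_pos j 0 (J.zero_mem_Icc j)
    have := ha.1.2
    have : J.h j 0 ^ 2 < a ^ 2 := by gcongr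
    linarith
  have hlt : ∀ i, J.h i 0 < J.ℓ₀ := by
    intro i
    by_contra! hi
    obtain ⟨j, hij⟩ : ∃ j, i ≠ j := (exists_ne i).imp fun _ h => h.symm
    have hj := hpair i j hij hi
    set x : E3 := (ε * J.ℓ₀) • EuclideanSpace.single i 1 +
      (ε * J.ℓ₀) • EuclideanSpace.single j 1 with hx
    have hxi : x i = ε * J.ℓ₀ := by simp [hx, hij]
    have hxj : x j = ε * J.ℓ₀ := by simp [hx, hij.symm]
    refine disjoint_left.1 (hε.disjoint i j hij)
      (hε.mem_closure_cylinder_iff (x := x).2 ⟨?_, ?_⟩) (hε.mem_closure_cylinder_iff.2 ⟨?_, ?_⟩)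
    · rw [hxi]; exact ⟨le_rfl, (hε.base_lt i).le⟩
    · rw [hxi, hε.h_base, hx, transSq_pair hij, mul_pow]; gcongr
    · rw [hxj]; exact ⟨le_rfl, (hε.base_lt j).le⟩
    · rw [hxj, hε.h_base, hx, add_comm, transSq_pair hij.symm, mul_pow]; gcongr
  obtain ⟨m, hm⟩ := Finite.exists_max fun i => J.h i 0
  have hm0 := hlt m
  refine ⟨min c ((J.ℓ₀ - J.h m 0) / 2), lt_min hc (by linarith), fun i ξ h1 h2 => hmem i ξ ?_ h2,
    fun i => ?_⟩
  · have := min_le_left c ((J.ℓ₀ - J.h m 0) / 2); linarith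
  · have := min_le_right c ((J.ℓ₀ - J.h m 0) / 2); have := hm i; linarith

theorem IsCollar.transSq_le {c : ℝ} (hc : J.IsCollar c) {ξ : E3} (hξ : ξ ∈ closure J.Ξ)
    {i : Fin 3} (h : J.ℓ₀ - c < ξ i) : transSq i ξ ≤ J.h i 0 ^ 2 := by
  have ho : IsOpen {ξ : E3 | J.ℓ₀ - c < ξ i} := isOpen_lt continuous_const (by fun_prop)
  have hcl : ξ ∈ closure ({ξ : E3 | J.ℓ₀ - c < ξ i} ∩ J.Ξ) := ho.inter_closure ⟨h, hξ⟩
  exact closure_minimal (s := {ξ : E3 | J.ℓ₀ - c < ξ i} ∩ J.Ξ)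
    (t := {ξ : E3 | transSq i ξ ≤ J.h i 0 ^ 2})
    (fun y hy => ((hc.mem_iff i y hy.1 (J.Ξ_lt y hy.2 i)).1 hy.2 : transSq i y < _).le)
    (isClosed_le (continuous_transSq i) continuous_const) hcl

theorem IsCollar.mem_closure_Ξ {c : ℝ} (hc : J.IsCollar c) {ξ : E3} {i : Fin 3}
    (h1 : J.ℓ₀ - c < ξ i) (h2 : ξ i < J.ℓ₀) (h3 : transSq i ξ ≤ J.h i 0 ^ 2) :
    ξ ∈ closure J.Ξ := by
  refine mem_closure_of_tendsto (tendsto_contract i 0 ξ) ?_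
  filter_upwards [Ioo_mem_nhdsGT (zero_lt_one (α := ℝ))] with s hs
  have hi : contract i 0 ξ s i = ξ i := by rw [contract_apply_self]; ring
  rw [hc.mem_iff i _ (by rwa [hi]) (by rwa [hi]), transSq_contract]
  have := J.h_pos i 0 (J.zero_mem_Icc i)
  exact sq_one_sub_mul_lt hs.1 hs.2 h3 (by positivity)

theorem IsCollar.abs_lt {c : ℝ} (hc : J.IsCollar c) {ξ : E3} {i j : Fin 3} (hij : j ≠ i)
    (h3 : transSq i ξ ≤ J.h i 0 ^ 2) : ξ j < J.ℓ₀ - c := by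
  have h1 := (sq_le_transSq hij ξ).trans h3
  have := J.h_pos i 0 (J.zero_mem_Icc i)
  exact (abs_le_of_sq_le_sq' h1 this.le).2.trans_lt (hc.h_lt i)

/-! ### The junction -/

theorem Admissible.node_subset {ε : ℝ} (hε : J.Admissible ε) : J.node ε ⊆ J.junction ε :=
  interior_maximal (subset_closure.trans subset_union_left) (isOpen_node hε.pos)

theorem Admissible.cylinder_subset {ε : ℝ} (hε : J.Admissible ε) (i : Fin 3) :
    J.cylinder ε i ⊆ J.junction ε :=
  interior_maximal (subset_closure.trans
    ((subset_iUnion (fun i => closure (J.cylinder ε i)) i).trans subset_union_right))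
    (J.isOpen_cylinder hε.pos i)

theorem isClosed_pieces (ε : ℝ) :
    IsClosed (closure (J.node ε) ∪ ⋃ i, closure (J.cylinder ε i)) :=
  isClosed_closure.union (isClosed_iUnion_of_finite fun _ => isClosed_closure)

theorem closure_junction_subset (ε : ℝ) :
    closure (J.junction ε) ⊆ closure (J.node ε) ∪ ⋃ i, closure (J.cylinder ε i) :=
  closure_minimal interior_subset (isClosed_pieces ε)

/-- The junction together with its side boundary: the closed junction without its outer bases. -/
def sideDomain (J : Geometry) (ε : ℝ) : Set E3 := J.junction ε ∪ J.sideBoundary ε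

theorem mem_sideDomain {ε : ℝ} {x : E3} (hx : x ∈ closure (J.junction ε))
    (h : ∀ i, x ∉ J.crossSection ε i (J.ℓ i)) : x ∈ J.sideDomain ε := by
  by_cases hj : x ∈ J.junction ε
  · exact Or.inl hj
  · refine Or.inr ⟨⟨hx, fun hi => hj (interior_subset hi)⟩, by simpa using h⟩

theorem Admissible.mem_sideDomain_of_node {ε : ℝ} (hε : J.Admissible ε) {x : E3}
    (hx : x ∈ closure (J.node ε)) : x ∈ J.sideDomain ε := by
  refine mem_sideDomain (closure_mono hε.node_subset hx) fun i hi => ?_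
  have := le_of_mem_closure_node hε.pos hx i
  rw [hi.1] at this
  exact this.not_gt (hε.base_lt i)

theorem Admissible.mem_sideDomain_of_cylinder {ε : ℝ} (hε : J.Admissible ε) {x : E3} {i : Fin 3}
    (hx : x ∈ closure (J.cylinder ε i)) (hi : x i < J.ℓ i) : x ∈ J.sideDomain ε := by
  refine mem_sideDomain (closure_mono (hε.cylinder_subset i) hx) fun j hj => ?_
  by_cases hij : i = j
  · subst hij
    exact hi.ne hj.1
  · refine disjoint_left.1 (hε.disjoint i j hij) hx (hε.mem_closure_cylinder_iff.2 ⟨?_, ?_⟩)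
    · rw [hj.1]; exact ⟨(hε.base_lt j).le, le_rfl⟩
    · rw [hj.1]; exact hj.2

theorem Admissible.transSq_eq_of_lateral {ε : ℝ} (hε : J.Admissible ε) {x : E3} {i : Fin 3}
    (hx : x ∈ J.lateral ε i) : transSq i x = ε ^ 2 * J.h i (x i) ^ 2 := by
  refine le_antisymm (J.mem_closure_cylinder hε.pos hx.1.1).2 ?_
  by_contra! h
  refine hx.1.2 ?_
  rw [(J.isOpen_cylinder hε.pos i).interior_eq]
  exact ⟨hx.2.1, hx.2.2, h⟩

theorem Admissible.isOutwardNormal_of_lateral {ε : ℝ} (hε : J.Admissible ε) {x ν : E3}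
    {i : Fin 3} (hx : x ∈ J.lateral ε i) (h : IsOutwardNormal (J.cylinder ε i) x ν) :
    IsOutwardNormal (J.junction ε) x ν := by
  refine h.of_subset (W := {y | ε * J.ℓ₀ < y i} ∩ ⋂ j, ⋂ (_ : i ≠ j), (closure (J.cylinder ε j))ᶜ)
    (hε.cylinder_subset i) isOpen_interior ?_ ?_
  · refine inter_mem ((isOpen_lt continuous_const (by fun_prop)).mem_nhds hx.2.1) ?_
    refine iInter_mem.2 fun j => iInter_mem.2 fun hij => isClosed_closure.isOpen_compl.mem_nhds ?_
    exact disjoint_left.1 (hε.disjoint i j hij) hx.1.1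
  · rintro y ⟨hy, hy1, hy2⟩
    rcases interior_subset hy with h | h
    · exact absurd (le_of_mem_closure_node hε.pos h i) (not_le.2 hy1)
    · obtain ⟨j, hj⟩ := mem_iUnion.1 h
      by_cases hij : i = j
      · rwa [hij]
      · simp only [mem_iInter] at hy2
        exact absurd hj (hy2 j hij)

theorem Admissible.mem_crossSection_of_node_of_cylinder {ε : ℝ} (hε : J.Admissible ε) {x : E3}
    (hx : x ∈ closure (J.node ε)) {i : Fin 3} (hi : x ∈ closure (J.cylinder ε i)) :
    x ∈ J.crossSection ε i (ε * J.ℓ₀) := by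
  have h := J.mem_closure_cylinder hε.pos hi
  have hxi : x i = ε * J.ℓ₀ := le_antisymm (le_of_mem_closure_node hε.pos hx i) h.1.1
  exact ⟨hxi, hxi ▸ h.2⟩

theorem Admissible.isOutwardNormal_of_nodeBoundary {ε : ℝ} (hε : J.Admissible ε) {x ν : E3}
    (hx : x ∈ J.nodeBoundary ε) (h : IsOutwardNormal (J.node ε) x ν) :
    IsOutwardNormal (J.junction ε) x ν := by
  refine h.of_subset (W := ⋂ j, (closure (J.cylinder ε j))ᶜ) hε.node_subset isOpen_interior ?_ ?_
  · refine iInter_mem.2 fun j => isClosed_closure.isOpen_compl.mem_nhds fun hj => hx.2 ?_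
    exact mem_iUnion.2 ⟨j, hε.mem_crossSection_of_node_of_cylinder hx.1.1 hj⟩
  · rintro y ⟨hy, hy2⟩
    rcases interior_subset hy with h | h
    · exact h
    · obtain ⟨j, hj⟩ := mem_iUnion.1 h
      exact absurd hj (mem_iInter.1 hy2 j)

theorem Admissible.inv_smul_mem_nodeSurface {ε : ℝ} (hε : J.Admissible ε) {x : E3}
    (hx : x ∈ J.nodeBoundary ε) : ε⁻¹ • x ∈ J.nodeSurface := by
  refine ⟨(mem_frontier_node_iff hε.pos).1 hx.1, fun h => hx.2 ?_⟩
  obtain ⟨i, hi1, hi2⟩ := mem_iUnion.1 h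
  rw [PiLp.smul_apply, smul_eq_mul, inv_mul_eq_iff_eq_mul₀ hε.pos.ne'] at hi1
  refine mem_iUnion.2 ⟨i, hi1, ?_⟩
  rw [transSq_smul, inv_pow, inv_mul_le_iff₀ (by have := hε.pos; positivity)] at hi2
  rwa [hε.h_base]

theorem Admissible.exists_normal_of_nodeBoundary {ε : ℝ} (hε : J.Admissible ε) {x : E3}
    (hx : x ∈ J.nodeBoundary ε) : ∃ ν, IsOutwardNormal (J.node ε) x ν := by
  have h := hε.inv_smul_mem_nodeSurface hx
  obtain ⟨ν, hν⟩ := J.Ξ_smooth _ h.1 fun i hi => h.2 (mem_iUnion.2 ⟨i, hi⟩)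
  refine ⟨ν, ?_⟩
  have := hν.image_smul hε.pos
  rwa [smul_inv_smul₀ hε.pos.ne'] at this

end Geometry

/-! ### Bounds for the coefficients -/

theorem exists_bound_of_finite {ι X : Type*} [Finite ι] {f : ι → X → ℝ} {S : Set X}
    (h : ∀ i, ∃ C, ∀ x ∈ S, |f i x| ≤ C) : ∃ C, 0 < C ∧ ∀ i, ∀ x ∈ S, |f i x| ≤ C := by
  have := Fintype.ofFinite ι
  choose C hC using h
  refine ⟨∑ i, |C i| + 1, by positivity, fun i x hx => (hC i x hx).trans ?_⟩
  have := Finset.single_le_sum (f := fun i => |C i|) (fun _ _ => abs_nonneg _) (Finset.mem_univ i)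
  have := le_abs_self (C i)
  linarith

theorem exists_bound_of_isBounded {X : Type*} [PseudoMetricSpace X] [ProperSpace X] {f : X → ℝ}
    {S : Set X} (hS : Bornology.IsBounded S) (hf : ContinuousOn f (closure S)) :
    ∃ C, ∀ x ∈ closure S, |f x| ≤ C := by
  simpa using hS.isCompact_closure.exists_bound_of_continuousOn hf

theorem norm_single_one (k : Fin 3) : ‖(EuclideanSpace.single k (1 : ℝ) : E3)‖ = 1 := by simp

theorem abs_pd_le {f : E3 → ℝ} {x : E3} {C : ℝ} (h : ‖fderiv ℝ f x‖ ≤ C) (k : Fin 3) :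
    |pd k f x| ≤ C := by
  have := (fderiv ℝ f x).le_opNorm (EuclideanSpace.single k 1)
  rw [norm_single_one, mul_one] at this
  exact this.trans h

theorem abs_apply_le_norm (x : E3) (k : Fin 3) : |x k| ≤ ‖x‖ := PiLp.norm_apply_le x k

/-- Symmetry and ellipticity pass to the closure and bound the entries. -/
theorem UniformlyElliptic.on_closure {A : E3 → Matrix (Fin 3) (Fin 3) ℝ} {U : Set E3}
    (h : UniformlyElliptic A U) (hc : ∀ k l, ContinuousOn (fun ξ => A ξ k l) (closure U))
    (hs : ∀ ξ ∈ U, (A ξ).IsSymm) :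
    ∃ κ a : ℝ, 0 < κ ∧ 0 < a ∧ ∀ ξ ∈ closure U, (A ξ).IsSymm ∧
      (∀ y : E3, κ * ‖y‖ ^ 2 ≤ inner ℝ (applyMat (A ξ) y) y) ∧ ∀ k l, |A ξ k l| ≤ a := by
  obtain ⟨κ₀, κ₁, h0, h1, hell⟩ := h
  have hq : ∀ y z : E3, ContinuousOn (fun ξ => inner ℝ (applyMat (A ξ) y) z) (closure U) := by
    intro y z
    simp only [inner_applyMat]
    exact continuousOn_finsetSum _ fun k _ => continuousOn_finsetSum _ fun l _ =>
      ((hc k l).mul continuousOn_const).mul continuousOn_const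
  have hsym : ∀ ξ ∈ closure U, (A ξ).IsSymm := fun ξ hξ => by
    refine Matrix.IsSymm.ext fun k l => ?_
    exact le_antisymm
      (le_on_closure (fun x hx => ((hs x hx).apply k l).le) (hc l k) (hc k l) hξ)
      (le_on_closure (fun x hx => ((hs x hx).apply k l).ge) (hc k l) (hc l k) hξ)
  have hlow : ∀ ξ ∈ closure U, ∀ y : E3, κ₀ * ‖y‖ ^ 2 ≤ inner ℝ (applyMat (A ξ) y) y :=
    fun ξ hξ y => le_on_closure (fun x hx => (hell x hx y).1) continuousOn_const (hq y y) hξ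
  have hupp : ∀ ξ ∈ closure U, ∀ y : E3, inner ℝ (applyMat (A ξ) y) y ≤ κ₁ * ‖y‖ ^ 2 :=
    fun ξ hξ y => le_on_closure (fun x hx => (hell x hx y).2) (hq y y) continuousOn_const hξ
  refine ⟨κ₀, 2 * κ₁, h0, by positivity, fun ξ hξ => ⟨hsym ξ hξ, hlow ξ hξ, fun k l => ?_⟩⟩
  -- polarization
  set q : E3 → ℝ := fun y => inner ℝ (applyMat (A ξ) y) y with hqd
  have hq0 : ∀ y, 0 ≤ q y := fun y => (by positivity : 0 ≤ κ₀ * ‖y‖ ^ 2).trans (hlow ξ hξ y)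
  set e := (EuclideanSpace.single k 1 : E3)
  set f := (EuclideanSpace.single l 1 : E3)
  have he : ‖e‖ = 1 := norm_single_one k
  have hf : ‖f‖ = 1 := norm_single_one l
  have hef : inner ℝ (applyMat (A ξ) f) e = A ξ k l := by
    rw [inner_applyMat, Finset.sum_eq_single k _ (by simp), Finset.sum_eq_single l _ (by simp)]
    · simp [e, f]
    · intro m _ hm; simp [f, hm]
    · intro m _ hm; simp [e, hm]
  have hadd : ∀ y z : E3, applyMat (A ξ) (y + z) = applyMat (A ξ) y + applyMat (A ξ) z := by
    intro y z; ext m; simp [applyMat_apply, mul_add, Finset.sum_add_distrib]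
  have hpol : q (e + f) = q e + q f + 2 * A ξ k l := by
    simp only [hqd, hadd, inner_add_left, inner_add_right]
    rw [inner_applyMat_comm (hsym ξ hξ) e f, real_inner_comm (applyMat (A ξ) f) e, hef]; ring
  have hn : ‖e + f‖ ≤ 2 := (norm_add_le e f).trans (by rw [he, hf]; norm_num)
  have hup : q (e + f) ≤ κ₁ * 4 := (hupp ξ hξ _).trans (by
    have : ‖e + f‖ ^ 2 ≤ 2 ^ 2 := by gcongr
    nlinarith)
  have h2 := hupp ξ hξ e
  have h3 := hupp ξ hξ f
  rw [he] at h2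
  rw [hf] at h3
  rw [abs_le]
  constructor
  · linarith [hq0 (e + f), show q e ≤ κ₁ * 1 ^ 2 from h2, show q f ≤ κ₁ * 1 ^ 2 from h3]
  · linarith [hq0 e, hq0 f]

theorem inner_gradient_eq_sum (v : E3) (f : E3 → ℝ) (x : E3) :
    inner ℝ v (gradient f x) = ∑ k, v k * pd k f x := by
  simp only [inner_eq_sum, gradient_apply]

theorem abs_sum_mul_pd_le {v : E3} {f : E3 → ℝ} {x : E3} {b p : ℝ} (hv : ∀ k, |v k| ≤ b)
    (hf : ∀ k, |pd k f x| ≤ p) : |∑ k, v k * pd k f x| ≤ 3 * (b * p) := by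
  calc |∑ k, v k * pd k f x| ≤ ∑ k, |v k * pd k f x| := Finset.abs_sum_le_sum_abs _ _
    _ ≤ ∑ _k : Fin 3, b * p := Finset.sum_le_sum fun k _ => by
        rw [abs_mul]
        exact mul_le_mul (hv k) (hf k) (abs_nonneg _) ((abs_nonneg _).trans (hv k))
    _ = 3 * (b * p) := by simp

/-- For coefficients and exponents that oscillate on the scale `ε`, the diffusion operator
`ε div (A ∇ ·)` and a drift act on `exp f` as operators of order zero, uniformly in `ε`. -/
theorem operator_exp_le {A : E3 → Matrix (Fin 3) (Fin 3) ℝ} {f : E3 → ℝ} {x v : E3} {ε a b p : ℝ}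
    (hε : 0 < ε) (hε1 : ε < 1) (hf : ContDiffAt ℝ 2 f x) (hA : ∀ k l, |A x k l| ≤ a)
    (hA' : ∀ k l m, |pd m (fun y => A y k l) x| ≤ a / ε) (hv : ∀ k, |v k| ≤ b)
    (hp : ∀ k, |pd k f x| ≤ p) (hp' : ∀ k l, |pd k (pd l f) x| ≤ p / ε) :
    ε * divForm A (fun y => Real.exp (f y)) x - ∑ k, v k * pd k (fun y => Real.exp (f y)) x ≤
      (9 * (2 * (a * p) + a * (p * p)) + 3 * (b * p)) * Real.exp (f x) := by
  have hd : DifferentiableAt ℝ f x := hf.differentiableAt (by norm_num)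
  have ha0 : 0 ≤ a := (abs_nonneg _).trans (hA 0 0)
  have h1 : ε * divForm A f x ≤ 9 * (2 * (a * p)) := by
    have h := (le_abs_self _).trans (abs_divForm_le hA hA' hp hp')
    calc ε * divForm A f x ≤ ε * (9 * (a / ε * p + a * (p / ε))) := by gcongr
      _ = 9 * (2 * (a * p)) := by field_simp; ring
  have h2 : ε * ∑ k, ∑ l, A x k l * (pd k f x * pd l f x) ≤ 9 * (a * (p * p)) := by
    have h : |∑ k, ∑ l, A x k l * (pd k f x * pd l f x)| ≤ 9 * (a * (p * p)) := by
      refine abs_sum_sum_le fun k l => ?_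
      rw [abs_mul, abs_mul]
      have := (abs_nonneg _).trans (hp 0)
      gcongr
      exacts [hA k l, hp k, hp l]
    have h0 := (abs_nonneg _).trans h
    have := le_abs_self (∑ k, ∑ l, A x k l * (pd k f x * pd l f x))
    nlinarith
  have h3 : -∑ k, v k * pd k f x ≤ 3 * (b * p) :=
    (neg_le_abs _).trans (abs_sum_mul_pd_le hv hp)
  have h4 : ∑ k, v k * pd k (fun y => Real.exp (f y)) x =
      Real.exp (f x) * ∑ k, v k * pd k f x := by
    rw [Finset.mul_sum]
    exact Finset.sum_congr rfl fun k _ => by rw [pd_exp hd]; ring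
  rw [divForm_exp A hf, h4]
  have := Real.exp_pos (f x)
  nlinarith

/-! ### The exponent of the barrier in the node -/

theorem contDiff_pd {f : E3 → ℝ} (hf : ContDiff ℝ (⊤ : ℕ∞) f) (k : Fin 3) :
    ContDiff ℝ (⊤ : ℕ∞) (pd k f) :=
  (hf.fderiv_right (m := (⊤ : ℕ∞)) (by simp)).clm_apply contDiff_const

namespace Geometry

variable {J : Geometry}

/-- A function on the node that is positive in the collars, vanishes on the node surface, and
equals `h_i(0)² - |ξ̄_i|²` near the `i`-th disc. -/
def nodeProfile (J : Geometry) (c : ℝ) (ξ : E3) : ℝ :=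
  ∑ i, Real.smoothTransition ((ξ i - (J.ℓ₀ - c)) / (c / 2)) * (J.h i 0 ^ 2 - transSq i ξ)

/-- The logarithm of the barrier in the node, up to a function of time. -/
def nodeExponent (J : Geometry) (c M ε : ℝ) (x : E3) : ℝ :=
  -(M * ε) * J.nodeProfile c (ε⁻¹ • x)

theorem contDiff_nodeProfile (c : ℝ) : ContDiff ℝ (⊤ : ℕ∞) (J.nodeProfile c) := by
  unfold nodeProfile
  refine ContDiff.sum fun i _ => ContDiff.mul ?_ (contDiff_const.sub (contDiff_transSq i))
  exact Real.smoothTransition.contDiff.comp (by fun_prop)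

theorem contDiff_nodeExponent (c M ε : ℝ) : ContDiff ℝ (⊤ : ℕ∞) (J.nodeExponent c M ε) := by
  unfold nodeExponent
  exact contDiff_const.mul ((contDiff_nodeProfile c).comp (contDiff_const_smul _))

theorem contDiffAt_nodeExponent (c M ε : ℝ) (x : E3) :
    ContDiffAt ℝ 2 (J.nodeExponent c M ε) x :=
  (contDiff_infty.1 (contDiff_nodeExponent c M ε) 2).contDiffAt

theorem IsCollar.nodeProfile_nonneg {c : ℝ} (hc : J.IsCollar c) {ξ : E3} (hξ : ξ ∈ closure J.Ξ) :
    0 ≤ J.nodeProfile c ξ := by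
  refine Finset.sum_nonneg fun i _ => ?_
  rcases le_or_gt (ξ i) (J.ℓ₀ - c) with h | h
  · rw [Real.smoothTransition.zero_of_nonpos, zero_mul]
    exact div_nonpos_of_nonpos_of_nonneg (by linarith) (by linarith [hc.pos])
  · exact mul_nonneg (Real.smoothTransition.nonneg _) (sub_nonneg.2 (hc.transSq_le hξ h))

theorem IsCollar.nodeProfile_eq_zero {c : ℝ} (hc : J.IsCollar c) {ξ : E3}
    (hξ : ξ ∈ J.nodeSurface) : J.nodeProfile c ξ = 0 := by
  have hcl : ξ ∈ closure J.Ξ := hξ.1.1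
  refine Finset.sum_eq_zero fun i _ => ?_
  rcases le_or_gt (ξ i) (J.ℓ₀ - c) with h | h
  · rw [Real.smoothTransition.zero_of_nonpos, zero_mul]
    exact div_nonpos_of_nonpos_of_nonneg (by linarith) (by linarith [hc.pos])
  · have hle := hc.transSq_le hcl h
    have hlt : ξ i < J.ℓ₀ := lt_of_le_of_ne (le_of_mem_closure_Ξ hcl i) fun he =>
      hξ.2 (mem_iUnion.2 ⟨i, he, hle⟩)
    have hn : ξ ∉ J.Ξ := fun hin => hξ.1.2 (by rwa [J.Ξ_open.interior_eq])
    rw [hc.mem_iff i ξ h hlt, not_lt] at hn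
    rw [le_antisymm hle hn, sub_self, mul_zero]

theorem IsCollar.nodeProfile_eq {c : ℝ} (hc : J.IsCollar c) {ξ : E3} {i : Fin 3}
    (h1 : J.ℓ₀ - c / 2 ≤ ξ i) (h2 : transSq i ξ ≤ J.h i 0 ^ 2) :
    J.nodeProfile c ξ = J.h i 0 ^ 2 - transSq i ξ := by
  have hc0 := hc.pos
  rw [nodeProfile, Finset.sum_eq_single i]
  · rw [Real.smoothTransition.one_of_one_le, one_mul]
    rw [one_le_div (by linarith)]; linarith
  · intro j _ hj
    rw [Real.smoothTransition.zero_of_nonpos, zero_mul]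
    exact div_nonpos_of_nonpos_of_nonneg (by linarith [hc.abs_lt hj h2]) (by linarith)
  · simp

theorem pd_nodeExponent (c M : ℝ) {ε : ℝ} (hε : 0 < ε) (k : Fin 3) (x : E3) :
    pd k (J.nodeExponent c M ε) x = -M * pd k (J.nodeProfile c) (ε⁻¹ • x) := by
  unfold nodeExponent
  rw [pd_const_mul, pd_comp_smul]; field_simp

theorem pd_pd_nodeExponent (c M : ℝ) {ε : ℝ} (hε : 0 < ε) (k l : Fin 3) (x : E3) :
    pd k (pd l (J.nodeExponent c M ε)) x =
      -M * pd k (pd l (J.nodeProfile c)) (ε⁻¹ • x) / ε := by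
  rw [funext (pd_nodeExponent c M hε l), pd_const_mul, pd_comp_smul (pd l (J.nodeProfile c))]
  field_simp

theorem exists_bound_nodeProfile (J : Geometry) (c : ℝ) : ∃ P, 0 < P ∧ ∀ ξ ∈ closure J.Ξ,
    |J.nodeProfile c ξ| ≤ P ∧ (∀ k, |pd k (J.nodeProfile c) ξ| ≤ P) ∧
      ∀ k l, |pd k (pd l (J.nodeProfile c)) ξ| ≤ P := by
  have hQ : ContDiff ℝ (⊤ : ℕ∞) (J.nodeProfile c) := contDiff_nodeProfile c
  obtain ⟨P₀, h0⟩ := exists_bound_of_isBounded J.Ξ_bounded hQ.continuous.continuousOn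
  obtain ⟨P₁, -, h1⟩ := exists_bound_of_finite fun k =>
    exists_bound_of_isBounded J.Ξ_bounded (contDiff_pd hQ k).continuous.continuousOn
  obtain ⟨P₂, -, h2⟩ := exists_bound_of_finite fun kl : Fin 3 × Fin 3 =>
    exists_bound_of_isBounded J.Ξ_bounded
      (contDiff_pd (contDiff_pd hQ kl.2) kl.1).continuous.continuousOn
  refine ⟨max (max P₀ P₁) (max P₂ 1), by positivity, fun ξ hξ => ⟨?_, fun k => ?_, fun k l => ?_⟩⟩
  · exact (h0 ξ hξ).trans (by simp)
  · exact (h1 k ξ hξ).trans (by simp)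
  · exact (h2 (k, l) ξ hξ).trans (by simp)

end Geometry

namespace Coefficients

variable {J : Geometry} (K : Coefficients J)

theorem differentiableAt_D₀ {ε : ℝ} (hε : 0 < ε) {x : E3} (hx : x ∈ J.node ε) (k l : Fin 3) :
    DifferentiableAt ℝ (fun y => K.D₀ ε y k l) x := by
  have h := (K.a₀_regular k l).2.1 _ ((Geometry.mem_node_iff hε).1 hx)
  exact DifferentiableAt.comp x (f := fun y : E3 => ε⁻¹ • y) h
    (differentiableAt_id.const_smul ε⁻¹)

/-- Bounds for the coefficients in the node, uniform in `ε`. -/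
theorem exists_bound_node : ∃ κ a b : ℝ, 0 < κ ∧ 0 < a ∧ 0 < b ∧ ∀ ε, 0 < ε →
    (∀ x ∈ closure (J.node ε), (K.D₀ ε x).IsSymm ∧
      (∀ y : E3, κ * ‖y‖ ^ 2 ≤ inner ℝ (applyMat (K.D₀ ε x) y) y) ∧ ∀ k l, |K.D₀ ε x k l| ≤ a) ∧
    ∀ x ∈ J.node ε, (∀ k l m, |pd m (fun y => K.D₀ ε y k l) x| ≤ a / ε) ∧
      ∀ k, |K.V₀ ε x k| ≤ b := by
  obtain ⟨κ, a, hκ, ha, h⟩ := K.a₀_elliptic.on_closure (fun k l => (K.a₀_regular k l).1) K.a₀_symm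
  obtain ⟨a', ha', h'⟩ := exists_bound_of_finite (ι := Fin 3 × Fin 3 × Fin 3) (S := J.Ξ)
    (f := fun i => pd i.2.2 (fun ξ => K.a₀ ξ i.1 i.2.1)) fun i => by
      obtain ⟨C, hC, -⟩ := (K.a₀_regular i.1 i.2.1).2.2
      exact ⟨C, fun ξ hξ => abs_pd_le (hC ξ hξ) _⟩
  obtain ⟨b, hb, hv⟩ := exists_bound_of_finite (f := fun k ξ => K.v₀ ξ k) (S := J.Ξ) fun k =>
    (exists_bound_of_isBounded J.Ξ_bounded (K.v₀_regular k).1).imp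
      fun C hC x hx => hC x (subset_closure hx)
  refine ⟨κ, max a a', b, hκ, by positivity, hb, fun ε hε => ⟨fun x hx => ?_, fun x hx => ?_⟩⟩
  · obtain ⟨h1, h2, h3⟩ := h _ ((Geometry.mem_closure_node_iff hε).1 hx)
    exact ⟨h1, h2, fun k l => (h3 k l).trans (le_max_left _ _)⟩
  · have hx' := (Geometry.mem_node_iff hε).1 hx
    refine ⟨fun k l m => ?_, fun k => hv k _ hx'⟩
    have := pd_comp_smul (fun ξ => K.a₀ ξ k l) ε⁻¹ x m
    rw [show (fun y => K.D₀ ε y k l) = fun y => K.a₀ (ε⁻¹ • y) k l from rfl, this, abs_mul,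
      abs_of_pos (inv_pos.2 hε), div_eq_inv_mul]
    gcongr
    exact (h' (k, l, m) _ hx').trans (le_max_right _ _)

/-- The exponential of the node exponent is a zero-order perturbation for the operator of the
node, uniformly in `ε`. -/
theorem exists_operator_bound_node (c : ℝ) {M : ℝ} (hM : 0 < M) : ∃ Λ : ℝ, ∀ ε, 0 < ε → ε < 1 →
    ∀ x ∈ J.node ε,
      ε * divForm (K.D₀ ε) (fun y => Real.exp (J.nodeExponent c M ε y)) x
        - ∑ k, K.V₀ ε x k * pd k (fun y => Real.exp (J.nodeExponent c M ε y)) x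
        ≤ Λ * Real.exp (J.nodeExponent c M ε x) := by
  obtain ⟨κ, a, b, -, -, -, hK⟩ := K.exists_bound_node
  obtain ⟨P, hP, hQ⟩ := J.exists_bound_nodeProfile c
  refine ⟨_, fun ε hε hε1 x hx => operator_exp_le (p := M * P) hε hε1
    (Geometry.contDiffAt_nodeExponent c M ε x)
    ((hK ε hε).1 x (subset_closure hx)).2.2
    ((hK ε hε).2 x hx).1 ((hK ε hε).2 x hx).2 (fun k => ?_) fun k l => ?_⟩
  · obtain ⟨-, h, -⟩ := hQ _ ((Geometry.mem_closure_node_iff hε).1 (subset_closure hx))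
    rw [Geometry.pd_nodeExponent c M hε, abs_mul, abs_neg, abs_of_pos hM]
    gcongr
    exact h k
  · obtain ⟨-, -, h⟩ := hQ _ ((Geometry.mem_closure_node_iff hε).1 (subset_closure hx))
    rw [Geometry.pd_pd_nodeExponent c M hε, abs_div, abs_mul, abs_neg, abs_of_pos hM,
      abs_of_pos hε]
    gcongr
    exact h k l

end Coefficients

/-! ### The exponent of the barrier in the cylinders -/

theorem pd_coord (i k : Fin 3) (x : E3) : pd k (fun y => y i) x = if k = i then 1 else 0 := by
  have h : HasFDerivAt (fun y : E3 => y i) (EuclideanSpace.proj i : E3 →L[ℝ] ℝ) x :=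
    (EuclideanSpace.proj i : E3 →L[ℝ] ℝ).hasFDerivAt
  rw [pd, h.fderiv]
  simp [eq_comm]

theorem differentiableAt_coord (i : Fin 3) (x : E3) : DifferentiableAt ℝ (fun y : E3 => y i) x :=
  (EuclideanSpace.proj i : E3 →L[ℝ] ℝ).differentiableAt

theorem pd_comp_coord {f : ℝ → ℝ} {x : E3} {i : Fin 3} (hf : DifferentiableAt ℝ f (x i))
    (k : Fin 3) : pd k (fun y => f (y i)) x = if k = i then deriv f (x i) else 0 := by
  have h : HasFDerivAt (fun y : E3 => y i) (EuclideanSpace.proj i : E3 →L[ℝ] ℝ) x :=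
    (EuclideanSpace.proj i : E3 →L[ℝ] ℝ).hasFDerivAt
  have h2 := hf.hasDerivAt.comp_hasFDerivAt x h
  rw [pd, show fderiv ℝ (fun y : E3 => f (y i)) x = _ from h2.fderiv]
  simp [eq_comm]

theorem pd_transSq (i k : Fin 3) (x : E3) :
    pd k (transSq i) x = if k = i then 0 else 2 * x k := by
  have hd : ∀ j ∈ Finset.univ.erase i, DifferentiableAt ℝ (fun y : E3 => y j ^ 2) x :=
    fun j _ => (differentiableAt_coord j x).pow 2
  have h : pd k (transSq i) x = ∑ j ∈ Finset.univ.erase i, pd k (fun y => y j ^ 2) x := by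
    unfold pd
    rw [show transSq i = fun y : E3 => ∑ j ∈ Finset.univ.erase i, y j ^ 2 from rfl,
      fderiv_fun_sum hd, _root_.sum_apply]
  have h2 : ∀ j, pd k (fun y : E3 => y j ^ 2) x = if k = j then 2 * x j else 0 := fun j => by
    rw [pd_comp_coord (f := fun s => s ^ 2) (by fun_prop)]
    simp
  simp only [h, h2]
  by_cases hk : k = i
  · subst hk; simp
  · simp [hk]

/-- Bounds for a `C³` function on a compact interval and its first two derivatives. -/
theorem exists_bound_deriv {f : ℝ → ℝ} {b : ℝ} (hb : 0 < b) (hf : ContDiffOn ℝ 3 f (Icc 0 b)) :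
    ∃ C, (∀ s ∈ Icc 0 b, |f s| ≤ C) ∧
      ∀ s ∈ Ioo 0 b, |deriv f s| ≤ C ∧ |deriv (deriv f) s| ≤ C := by
  have hu := uniqueDiffOn_Icc hb
  have h1 : ContDiffOn ℝ 2 (derivWithin f (Icc 0 b)) (Icc 0 b) :=
    hf.derivWithin hu (by norm_num)
  have h2 : ContDiffOn ℝ 1 (derivWithin (derivWithin f (Icc 0 b)) (Icc 0 b)) (Icc 0 b) :=
    h1.derivWithin hu (by norm_num)
  obtain ⟨C₀, hC₀⟩ := isCompact_Icc.exists_bound_of_continuousOn hf.continuousOn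
  obtain ⟨C₁, hC₁⟩ := isCompact_Icc.exists_bound_of_continuousOn h1.continuousOn
  obtain ⟨C₂, hC₂⟩ := isCompact_Icc.exists_bound_of_continuousOn h2.continuousOn
  have he : ∀ (g : ℝ → ℝ), ∀ s ∈ Ioo 0 b, derivWithin g (Icc 0 b) s = deriv g s :=
    fun g s hs => derivWithin_of_mem_nhds (Icc_mem_nhds hs.1 hs.2)
  refine ⟨max C₀ (max C₁ C₂), fun s hs => (hC₀ s hs).trans (le_max_left _ _), fun s hs => ⟨?_, ?_⟩⟩
  · rw [← he f s hs]
    exact (hC₁ s ⟨hs.1.le, hs.2.le⟩).trans (by simp)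
  · have : deriv f =ᶠ[𝓝 s] derivWithin f (Icc 0 b) := by
      filter_upwards [Ioo_mem_nhds hs.1 hs.2] with r hr using (he f r hr).symm
    rw [this.deriv_eq, ← he _ s hs]
    exact (hC₂ s ⟨hs.1.le, hs.2.le⟩).trans (by simp)

namespace Geometry

variable {J : Geometry}

/-- The squared aperture function. -/
def hSq (J : Geometry) (i : Fin 3) (s : ℝ) : ℝ := J.h i s ^ 2

/-- The defining function `|x̄_i|² / ε² - h_i(x_i)²` of the lateral surface. -/
def lateralLevel (J : Geometry) (ε : ℝ) (i : Fin 3) (x : E3) : ℝ :=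
  (ε ^ 2)⁻¹ * transSq i x + -J.hSq i (x i)

/-- The logarithm of the barrier in the cylinder, up to a function of time: a multiple of a
function that is constant on the lateral surface, and a linear term with slope `-1` along the
axis. -/
def cylinderExponent (J : Geometry) (M ε : ℝ) (i : Fin 3) (x : E3) : ℝ :=
  M * ε * J.lateralLevel ε i x + -(x i + -(ε * J.ℓ₀))

theorem contDiffOn_hSq (i : Fin 3) : ContDiffOn ℝ 3 (J.hSq i) (Icc 0 (J.ℓ i)) :=
  (J.h_smooth i).pow 2

theorem contDiffAt_hSq {i : Fin 3} {s : ℝ} (hs : s ∈ Ioo 0 (J.ℓ i)) : ContDiffAt ℝ 3 (J.hSq i) s :=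
  (contDiffOn_hSq i).contDiffAt (Icc_mem_nhds hs.1 hs.2)

theorem differentiableAt_hSq {i : Fin 3} {s : ℝ} (hs : s ∈ Ioo 0 (J.ℓ i)) :
    DifferentiableAt ℝ (J.hSq i) s :=
  (contDiffAt_hSq hs).differentiableAt (by norm_num)

theorem differentiableAt_deriv_hSq {i : Fin 3} {s : ℝ} (hs : s ∈ Ioo 0 (J.ℓ i)) :
    DifferentiableAt ℝ (deriv (J.hSq i)) s := by
  have h : DifferentiableAt ℝ (fun s => fderiv ℝ (J.hSq i) s 1) s :=
    (((contDiffAt_hSq hs).fderiv_right (m := 2) (by norm_num)).differentiableAt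
      (by norm_num)).clm_apply (differentiableAt_const _)
  exact h

theorem contDiffAt_lateralLevel (ε : ℝ) {i : Fin 3} {x : E3} (hx : x i ∈ Ioo 0 (J.ℓ i)) :
    ContDiffAt ℝ 3 (J.lateralLevel ε i) x := by
  refine (contDiffAt_const.mul ?_).add ?_
  · exact (contDiff_infty.1 (contDiff_transSq i) 3).contDiffAt
  · refine ContDiffAt.neg ?_
    exact ContDiffAt.comp x (f := fun y : E3 => y i) (contDiffAt_hSq hx)
      ((EuclideanSpace.proj i : E3 →L[ℝ] ℝ).contDiff.contDiffAt)

theorem contDiffAt_cylinderExponent (M ε : ℝ) {i : Fin 3} {x : E3} (hx : x i ∈ Ioo 0 (J.ℓ i)) :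
    ContDiffAt ℝ 3 (J.cylinderExponent M ε i) x :=
  (contDiffAt_const.mul (contDiffAt_lateralLevel ε hx)).add
    ((((EuclideanSpace.proj i : E3 →L[ℝ] ℝ).contDiff.contDiffAt).add contDiffAt_const).neg)

theorem pd_lateralLevel (ε : ℝ) {i : Fin 3} {x : E3} (hx : x i ∈ Ioo 0 (J.ℓ i)) (k : Fin 3) :
    pd k (J.lateralLevel ε i) x =
      if k = i then -deriv (J.hSq i) (x i) else (ε ^ 2)⁻¹ * (2 * x k) := by
  have h1 : DifferentiableAt ℝ (fun y => (ε ^ 2)⁻¹ * transSq i y) x :=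
    (((contDiff_transSq i (n := 1)).differentiable (by norm_num)) x).const_mul _
  have h2 : DifferentiableAt ℝ (fun y : E3 => J.hSq i (y i)) x :=
    DifferentiableAt.comp x (differentiableAt_hSq hx) (differentiableAt_coord i x)
  have h2' : DifferentiableAt ℝ (fun y : E3 => -J.hSq i (y i)) x := h2.neg
  unfold lateralLevel
  rw [pd_add h1 h2', pd_const_mul, pd_transSq]
  have h3 : pd k (fun y => -J.hSq i (y i)) x = -pd k (fun y => J.hSq i (y i)) x := by
    have := pd_const_mul (-1) (fun y => J.hSq i (y i)) x k
    simpa using this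
  rw [h3, pd_comp_coord (differentiableAt_hSq hx)]
  by_cases hk : k = i <;> simp [hk]

theorem pd_cylinderExponent (M : ℝ) {ε : ℝ} {i : Fin 3} {x : E3}
    (hx : x i ∈ Ioo 0 (J.ℓ i)) (k : Fin 3) :
    pd k (J.cylinderExponent M ε i) x =
      M * ε * pd k (J.lateralLevel ε i) x + if k = i then -1 else 0 := by
  have h1 : DifferentiableAt ℝ (J.lateralLevel ε i) x :=
    (contDiffAt_lateralLevel ε hx).differentiableAt (by norm_num)
  have h2 : DifferentiableAt ℝ (fun y : E3 => y i + -(ε * J.ℓ₀)) x :=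
    (differentiableAt_coord i x).add_const _
  have h2' : DifferentiableAt ℝ (fun y : E3 => -(y i + -(ε * J.ℓ₀))) x := h2.neg
  unfold cylinderExponent
  rw [pd_add (h1.const_mul _) h2', pd_const_mul]
  have h3 : pd k (fun y : E3 => -(y i + -(ε * J.ℓ₀))) x = if k = i then -1 else 0 := by
    have := pd_const_mul (-1) (fun y : E3 => y i + -(ε * J.ℓ₀)) x k
    have h4 : pd k (fun y : E3 => y i + -(ε * J.ℓ₀)) x = if k = i then 1 else 0 := by
      rw [← pd_coord i k x, pd, pd, fderiv_add_const]
    rw [h4] at this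
    simp only [neg_mul, one_mul] at this
    rw [this]
    split_ifs <;> simp
  rw [h3]

theorem pd_pd_cylinderExponent (M : ℝ) {ε : ℝ} (hε : 0 < ε) {i : Fin 3} {x : E3}
    (hx : x i ∈ Ioo 0 (J.ℓ i)) (k l : Fin 3) :
    pd k (pd l (J.cylinderExponent M ε i)) x =
      if k = l then if k = i then -(M * ε * deriv (deriv (J.hSq i)) (x i)) else 2 * M / ε else 0 := by
  have hev : ∀ᶠ y : E3 in 𝓝 x, y i ∈ Ioo 0 (J.ℓ i) :=
    (isOpen_Ioo.preimage (by fun_prop : Continuous fun x : E3 => x i)).mem_nhds hx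
  have h1 : pd l (J.cylinderExponent M ε i) =ᶠ[𝓝 x] fun y =>
      M * ε * (if l = i then -deriv (J.hSq i) (y i) else (ε ^ 2)⁻¹ * (2 * y l)) +
        if l = i then -1 else 0 := by
    filter_upwards [hev] with y hy
    rw [pd_cylinderExponent M hy, pd_lateralLevel ε hy]
  rw [pd_congr h1]
  by_cases hl : l = i
  · subst hl
    simp only [if_true]
    have h2 : pd k (fun y : E3 => M * ε * -deriv (J.hSq l) (y l) + -1) x =
        -(M * ε) * pd k (fun y : E3 => deriv (J.hSq l) (y l)) x := by
      rw [← pd_const_mul, pd, pd, fderiv_add_const]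
      simp
    rw [h2, pd_comp_coord (differentiableAt_deriv_hSq hx)]
    by_cases hk : k = l <;> simp [hk]
  · simp only [hl, if_false, add_zero]
    have h2 : (fun y : E3 => M * ε * ((ε ^ 2)⁻¹ * (2 * y l))) = fun y : E3 => 2 * M / ε * y l := by
      funext y; field_simp
    rw [h2, pd_const_mul, pd_coord]
    by_cases hk : k = l
    · simp [hk, hl]
    · simp [hk]

theorem exists_bound_h (J : Geometry) : ∃ H m : ℝ, 0 < H ∧ 0 < m ∧ ∀ i,
    (∀ s ∈ Icc 0 (J.ℓ i), m ≤ J.h i s ∧ J.h i s ≤ H ∧ J.hSq i s ≤ H) ∧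
      ∀ s ∈ Ioo 0 (J.ℓ i), |deriv (J.hSq i) s| ≤ H ∧ |deriv (deriv (J.hSq i)) s| ≤ H := by
  have h1 : ∀ i, ∃ m, 0 < m ∧ ∀ s ∈ Icc 0 (J.ℓ i), m ≤ J.h i s := fun i => by
    obtain ⟨s, hs, hmin⟩ := isCompact_Icc.exists_isMinOn ⟨0, J.zero_mem_Icc i⟩ (J.continuousOn_h i)
    exact ⟨J.h i s, J.h_pos i s hs, fun r hr => hmin hr⟩
  choose m hm hm' using h1
  choose C hC hC' using fun i => exists_bound_deriv (J.ℓ_pos i) (contDiffOn_hSq (J := J) i)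
  choose B hB using fun i => isCompact_Icc.exists_bound_of_continuousOn (J.continuousOn_h i)
  obtain ⟨i₀, hi₀⟩ := Finite.exists_min m
  obtain ⟨i₁, hi₁⟩ := Finite.exists_max C
  obtain ⟨i₂, hi₂⟩ := Finite.exists_max B
  refine ⟨max (max (C i₁) (B i₂)) 1, m i₀, by positivity, hm i₀, fun i => ⟨fun s hs => ⟨?_, ?_, ?_⟩,
    fun s hs => ⟨?_, ?_⟩⟩⟩
  · exact (hi₀ i).trans (hm' i s hs)
  · exact ((le_abs_self _).trans (hB i s hs)).trans ((hi₂ i).trans (by simp))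
  · exact ((le_abs_self _).trans (hC i s hs)).trans ((hi₁ i).trans (by simp))
  · exact (hC' i s hs).1.trans ((hi₁ i).trans (by simp))
  · exact (hC' i s hs).2.trans ((hi₁ i).trans (by simp))

/-! ### The fast and the mixed variables in the cylinders -/

theorem inv_smul_mem_fastDomain {ε : ℝ} (hε : J.Admissible ε) {i : Fin 3} {x : E3}
    (hx : x ∈ J.cylinder ε i) : ε⁻¹ • x ∈ J.fastDomain i := by
  refine ⟨x i, J.mem_Icc_of_closure_cylinder hε.pos (subset_closure hx), ?_⟩
  have := hε.pos
  rw [transSq_smul, inv_pow, inv_mul_lt_iff₀ (by positivity)]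
  exact hx.2.2

theorem inv_smul_mem_closure_fastDomain {ε : ℝ} (hε : J.Admissible ε) {i : Fin 3} {x : E3}
    (hx : x ∈ closure (J.cylinder ε i)) : ε⁻¹ • x ∈ closure (J.fastDomain i) :=
  map_mem_closure (continuous_const_smul ε⁻¹) hx fun _ hy => inv_smul_mem_fastDomain hε hy

/-- The linear map `x ↦ stretch ε i x`. -/
def stretchL (ε : ℝ) (i : Fin 3) : E3 →L[ℝ] E3 :=
  ε⁻¹ • ContinuousLinearMap.id ℝ E3 +
    (1 - ε⁻¹) • (EuclideanSpace.proj i : E3 →L[ℝ] ℝ).smulRight (EuclideanSpace.single i (1 : ℝ))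

theorem stretchL_apply (ε : ℝ) (i : Fin 3) (x : E3) : stretchL ε i x = stretch ε i x := by
  ext j
  by_cases hj : j = i
  · subst hj
    simp [stretchL, stretch]; ring
  · simp [stretchL, stretch, hj, div_eq_inv_mul]

theorem stretch_mem_mixedDomain {ε : ℝ} (hε : J.Admissible ε) {i : Fin 3} {x : E3}
    (hx : x ∈ J.cylinder ε i) : stretch ε i x ∈ J.mixedDomain i := by
  have hi : stretch ε i x i = x i := by simp [stretch]
  have ht : transSq i (stretch ε i x) = (ε ^ 2)⁻¹ * transSq i x := by
    have : transSq i (stretch ε i x) = transSq i (ε⁻¹ • x) :=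
      transSq_congr fun j hj => by simp [stretch, hj, div_eq_inv_mul]
    rw [this, transSq_smul, inv_pow]
  have := hε.pos
  refine ⟨?_, ?_, ?_⟩
  · rw [hi]; exact (hε.base_mem i).1.trans_lt hx.1
  · rw [hi]; exact hx.2.1
  · rw [hi, ht, inv_mul_lt_iff₀ (by positivity)]
    exact hx.2.2

theorem stretch_mem_closure_mixedDomain {ε : ℝ} (hε : J.Admissible ε) {i : Fin 3} {x : E3}
    (hx : x ∈ closure (J.cylinder ε i)) : stretch ε i x ∈ closure (J.mixedDomain i) := by
  rw [← stretchL_apply]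
  exact map_mem_closure (stretchL ε i).continuous hx fun y hy => by
    rw [stretchL_apply]; exact stretch_mem_mixedDomain hε hy

theorem isBounded_mixedDomain (J : Geometry) (i : Fin 3) :
    Bornology.IsBounded (J.mixedDomain i) := by
  obtain ⟨H, m, hH, -, hh⟩ := J.exists_bound_h
  refine (Metric.isBounded_closedBall (x := (0 : E3)) (r := J.ℓ i + H)).subset fun x hx => ?_
  rw [mem_closedBall_zero_iff, EuclideanSpace.norm_eq, Real.sqrt_le_left
    (by have := J.ℓ_pos i; positivity)]
  have h1 := ((hh i).1 (x i) ⟨hx.1.le, hx.2.1.le⟩).2.1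
  have h0 := J.h_pos i (x i) ⟨hx.1.le, hx.2.1.le⟩
  have h2 : ∑ k, ‖x k‖ ^ 2 = x i ^ 2 + transSq i x := by
    simp only [Real.norm_eq_abs, sq_abs]
    exact (Finset.add_sum_erase Finset.univ (fun k => x k ^ 2) (Finset.mem_univ i)).symm
  rw [h2]
  have h3 := hx.2.2
  have h4 := hx.1
  have h5 := hx.2.1
  nlinarith

theorem abs_coord_le_of_cylinder {ε : ℝ} (hε : J.Admissible ε) {i : Fin 3} {x : E3}
    (hx : x ∈ closure (J.cylinder ε i)) {j : Fin 3} (hj : j ≠ i) {H : ℝ}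
    (hH : J.h i (x i) ≤ H) : |x j| ≤ ε * H := by
  have h := (J.mem_closure_cylinder hε.pos hx).2
  have h0 := J.h_pos i _ (J.mem_Icc_of_closure_cylinder hε.pos hx)
  have hp := hε.pos
  have h2 : x j ^ 2 ≤ (ε * J.h i (x i)) ^ 2 := by
    rw [mul_pow]; exact (sq_le_transSq hj x).trans h
  exact (abs_le_of_sq_le_sq h2 (by positivity)).trans (by gcongr)

end Geometry

namespace Coefficients

variable {J : Geometry} (K : Coefficients J)

/-! ### Bounds for the coefficients in the cylinders -/

theorem differentiableAt_D {ε : ℝ} (hε : J.Admissible ε) {i : Fin 3} {x : E3}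
    (hx : x ∈ J.cylinder ε i) (k l : Fin 3) :
    DifferentiableAt ℝ (fun y => K.D ε i y k l) x := by
  have h := (K.a_regular i k l).2.1 _ (Geometry.inv_smul_mem_fastDomain hε hx)
  exact DifferentiableAt.comp x (f := fun y : E3 => ε⁻¹ • y) h
    (differentiableAt_id.const_smul ε⁻¹)

theorem exists_bound_D (i : Fin 3) : ∃ κ a : ℝ, 0 < κ ∧ 0 < a ∧ ∀ ε, J.Admissible ε →
    (∀ x ∈ closure (J.cylinder ε i), (K.D ε i x).IsSymm ∧
      (∀ y : E3, κ * ‖y‖ ^ 2 ≤ inner ℝ (applyMat (K.D ε i x) y) y) ∧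
      ∀ k l, |K.D ε i x k l| ≤ a) ∧
    ∀ x ∈ J.cylinder ε i, ∀ k l m, |pd m (fun y => K.D ε i y k l) x| ≤ a / ε := by
  obtain ⟨κ, a, hκ, ha, h⟩ :=
    (K.a_elliptic i).on_closure (fun k l => (K.a_regular i k l).1) (K.a_symm i)
  obtain ⟨a', ha', h'⟩ := exists_bound_of_finite (ι := Fin 3 × Fin 3 × Fin 3)
    (S := J.fastDomain i) (f := fun j => pd j.2.2 (fun ξ => K.a i ξ j.1 j.2.1)) fun j => by
      obtain ⟨C, hC, -⟩ := (K.a_regular i j.1 j.2.1).2.2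
      exact ⟨C, fun ξ hξ => abs_pd_le (hC ξ hξ) _⟩
  refine ⟨κ, max a a', hκ, by positivity, fun ε hε => ⟨fun x hx => ?_, fun x hx k l m => ?_⟩⟩
  · obtain ⟨h1, h2, h3⟩ := h _ (Geometry.inv_smul_mem_closure_fastDomain hε hx)
    exact ⟨h1, h2, fun k l => (h3 k l).trans (le_max_left _ _)⟩
  · have hx' := Geometry.inv_smul_mem_fastDomain hε hx
    have := pd_comp_smul (fun ξ => K.a i ξ k l) ε⁻¹ x m
    have hp := hε.pos
    rw [show (fun y => K.D ε i y k l) = fun y => K.a i (ε⁻¹ • y) k l from rfl, this, abs_mul,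
      abs_of_pos (inv_pos.2 hp), div_eq_inv_mul]
    gcongr
    exact (h' (k, l, m) _ hx').trans (le_max_right _ _)

theorem V_apply_self (ε : ℝ) (i : Fin 3) (x : E3) : K.V ε i x i = K.v i (x i) := by
  simp [V]

theorem V_apply_of_ne (ε : ℝ) {i k : Fin 3} (h : k ≠ i) (x : E3) :
    K.V ε i x k = ε * K.w i (Geometry.stretchL ε i x) k := by
  simp [V, h, Geometry.stretchL_apply]

theorem stretchL_single {ε : ℝ} {i k : Fin 3} (h : k ≠ i) :
    Geometry.stretchL ε i (EuclideanSpace.single k 1) = ε⁻¹ • EuclideanSpace.single k (1 : ℝ) := by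
  simp [Geometry.stretchL, h.symm]

theorem hasFDerivAt_w {ε : ℝ} (hε : J.Admissible ε) {i k : Fin 3} (h : k ≠ i) {x : E3}
    (hx : x ∈ J.cylinder ε i) :
    HasFDerivAt (fun y => K.w i (Geometry.stretchL ε i y) k)
      ((fderiv ℝ (fun η => K.w i η k) (stretch ε i x)).comp (Geometry.stretchL ε i)) x := by
  have hd := (K.w_regular i k h).2.1 _ (Geometry.stretch_mem_mixedDomain hε hx)
  rw [← Geometry.stretchL_apply] at hd ⊢
  exact hd.hasFDerivAt.comp x (Geometry.stretchL ε i).hasFDerivAt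

theorem differentiableAt_V {ε : ℝ} (hε : J.Admissible ε) {i : Fin 3} {x : E3}
    (hx : x ∈ J.cylinder ε i) (k : Fin 3) : DifferentiableAt ℝ (fun y => K.V ε i y k) x := by
  by_cases h : k = i
  · subst h
    simp only [V_apply_self]
    have hd := (K.v_regular k).2.1 (x k) ⟨(hε.base_mem k).1.trans_lt hx.1, hx.2.1⟩
    exact DifferentiableAt.comp x hd (differentiableAt_coord k x)
  · simp only [K.V_apply_of_ne ε h]
    exact (K.hasFDerivAt_w hε h hx).differentiableAt.const_mul ε

/-- The velocity in the cylinder and its divergence are bounded uniformly in `ε`: the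
transversal components carry the factor `ε`, which compensates the fast variable. -/
theorem exists_bound_V (i : Fin 3) : ∃ b : ℝ, 0 < b ∧ ∀ ε, J.Admissible ε →
    (∀ x ∈ closure (J.cylinder ε i), |K.V ε i x i| ≤ b ∧ ∀ k, k ≠ i → |K.V ε i x k| ≤ ε * b) ∧
    ∀ x ∈ J.cylinder ε i, ∀ k, |pd k (fun y => K.V ε i y k) x| ≤ b := by
  obtain ⟨b₁, h1⟩ := exists_bound_of_isBounded (Metric.isBounded_Ioo 0 (J.ℓ i)) (K.v_regular i).1
  obtain ⟨b₂, hb₂, h2⟩ := exists_bound_of_finite (ι := {k : Fin 3 // k ≠ i})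
    (S := closure (J.mixedDomain i)) (f := fun k η => K.w i η k) fun k =>
      exists_bound_of_isBounded (J.isBounded_mixedDomain i) (K.w_regular i k k.2).1
  obtain ⟨b₃, h3, -⟩ := (K.v_regular i).2.2
  obtain ⟨b₄, hb₄, h4⟩ := exists_bound_of_finite (ι := {k : Fin 3 // k ≠ i})
    (S := J.mixedDomain i) (f := fun k => pd k (fun η => K.w i η k)) fun k => by
      obtain ⟨C, hC, -⟩ := (K.w_regular i k k.2).2.2
      exact ⟨C, fun ξ hξ => abs_pd_le (hC ξ hξ) _⟩
  rw [closure_Ioo (J.ℓ_pos i).ne] at h1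
  refine ⟨max (max b₁ b₂) (max b₃ b₄), by positivity, fun ε hε => ⟨fun x hx => ⟨?_, fun k hk => ?_⟩,
    fun x hx k => ?_⟩⟩
  · rw [V_apply_self]
    exact (h1 _ (J.mem_Icc_of_closure_cylinder hε.pos hx)).trans (by simp)
  · rw [K.V_apply_of_ne ε hk, abs_mul, abs_of_pos hε.pos, Geometry.stretchL_apply]
    have := hε.pos
    gcongr
    exact (h2 ⟨k, hk⟩ _ (Geometry.stretch_mem_closure_mixedDomain hε hx)).trans (by simp)
  · have hxi : x i ∈ Ioo 0 (J.ℓ i) := ⟨(hε.base_mem i).1.trans_lt hx.1, hx.2.1⟩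
    by_cases hk : k = i
    · subst hk
      simp only [V_apply_self]
      rw [pd_comp_coord ((K.v_regular k).2.1 _ hxi), if_pos rfl, ← Real.norm_eq_abs,
        norm_deriv_eq_norm_fderiv]
      exact (h3 _ hxi).trans (by simp)
    · simp only [K.V_apply_of_ne ε hk]
      rw [pd_const_mul, pd, (K.hasFDerivAt_w hε hk hx).fderiv, ContinuousLinearMap.comp_apply,
        stretchL_single hk, map_smul, smul_eq_mul, mul_inv_cancel_left₀ hε.pos.ne']
      exact (h4 ⟨k, hk⟩ _ (Geometry.stretch_mem_mixedDomain hε hx)).trans (by simp)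

theorem divergence_smul_V {ε : ℝ} (hε : J.Admissible ε) {i : Fin 3} {x : E3}
    (hx : x ∈ J.cylinder ε i) {f : E3 → ℝ} (hf : DifferentiableAt ℝ f x) :
    divergence (fun y => f y • K.V ε i y) x =
      f x * (∑ k, pd k (fun y => K.V ε i y k) x) + ∑ k, K.V ε i x k * pd k f x := by
  rw [divergence_eq, Finset.mul_sum, ← Finset.sum_add_distrib]
  refine Finset.sum_congr rfl fun k _ => ?_
  exact pd_mul hf (K.differentiableAt_V hε hx k) k

/-- The exponential of the cylinder exponent is a zero-order perturbation for the operator of the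
cylinder, uniformly in `ε`. -/
theorem exists_operator_bound_cylinder (i : Fin 3) {M : ℝ} (hM : 0 < M) : ∃ Λ : ℝ, ∀ ε,
    J.Admissible ε → ∀ x ∈ J.cylinder ε i,
      ε * divForm (K.D ε i) (fun y => Real.exp (J.cylinderExponent M ε i y)) x
        - ∑ k, K.V ε i x k * pd k (fun y => Real.exp (J.cylinderExponent M ε i y)) x
        - (∑ k, pd k (fun y => K.V ε i y k) x) * Real.exp (J.cylinderExponent M ε i x)
        ≤ Λ * Real.exp (J.cylinderExponent M ε i x) := by
  obtain ⟨κ, a, -, ha, hD⟩ := K.exists_bound_D i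
  obtain ⟨b, hb, hV⟩ := K.exists_bound_V i
  obtain ⟨H, m, hH, -, hh⟩ := J.exists_bound_h
  have hmain : ∀ ε, J.Admissible ε → ∀ x ∈ J.cylinder ε i, _ := fun ε hε x hx =>
    operator_exp_le (A := K.D ε i) (v := K.V ε i x) (b := b) (a := a) (p := 2 * M * (H + 1) + 1)
      (f := J.cylinderExponent M ε i) (x := x) hε.pos hε.lt_one
      ((Geometry.contDiffAt_cylinderExponent M ε
        ⟨(hε.base_mem i).1.trans_lt hx.1, hx.2.1⟩).of_le (by norm_num))
      ((hD ε hε).1 x (subset_closure hx)).2.2 ((hD ε hε).2 x hx)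
      (fun k => by
        by_cases hk : k = i
        · rw [hk]; exact ((hV ε hε).1 x (subset_closure hx)).1
        · refine (((hV ε hε).1 x (subset_closure hx)).2 k hk).trans ?_
          nlinarith [hε.lt_one])
      (fun k => by
        have hxi : x i ∈ Ioo 0 (J.ℓ i) := ⟨(hε.base_mem i).1.trans_lt hx.1, hx.2.1⟩
        have hp := hε.pos
        have hp1 := hε.lt_one
        rw [Geometry.pd_cylinderExponent M hxi, Geometry.pd_lateralLevel ε hxi]
        by_cases hk : k = i
        · simp only [hk, if_true]
          refine (abs_add_le _ _).trans ?_
          rw [abs_mul, abs_neg, abs_neg, abs_one, abs_of_pos (mul_pos hM hp)]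
          have h1 := ((hh i).2 _ hxi).1
          have h2 : M * ε * |deriv (J.hSq i) (x i)| ≤ M * 1 * H := by gcongr
          nlinarith
        · simp only [hk, if_false, add_zero]
          have h1 := Geometry.abs_coord_le_of_cylinder hε (subset_closure hx) hk
            ((hh i).1 _ ⟨hxi.1.le, hxi.2.le⟩).2.1
          have h2 : M * ε * ((ε ^ 2)⁻¹ * (2 * x k)) = 2 * M * (x k / ε) := by field_simp
          have h3 : |x k / ε| ≤ H := by
            rw [abs_div, abs_of_pos hp, div_le_iff₀ hp]; linarith
          rw [h2, abs_mul, abs_of_pos (by positivity : 0 < 2 * M)]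
          nlinarith)
      (fun k l => by
        have hxi : x i ∈ Ioo 0 (J.ℓ i) := ⟨(hε.base_mem i).1.trans_lt hx.1, hx.2.1⟩
        have hp := hε.pos
        have hp1 := hε.lt_one
        rw [Geometry.pd_pd_cylinderExponent M hp hxi]
        split_ifs with h1 h2
        · rw [abs_neg, abs_mul, abs_of_pos (mul_pos hM hp), le_div_iff₀ hp]
          have h3 := ((hh i).2 _ hxi).2
          have h4 : M * ε * |deriv (deriv (J.hSq i)) (x i)| * ε ≤ M * 1 * H * 1 := by gcongr
          nlinarith
        · rw [abs_div, abs_of_pos hp, abs_of_pos (by positivity : 0 < 2 * M)]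
          gcongr
          nlinarith
        · rw [abs_zero]; positivity)
  refine ⟨9 * (2 * (a * (2 * M * (H + 1) + 1)) + a * ((2 * M * (H + 1) + 1) *
    (2 * M * (H + 1) + 1))) + 3 * (b * (2 * M * (H + 1) + 1)) + 3 * b, fun ε hε x hx => ?_⟩
  have h1 := hmain ε hε x hx
  have h2 : -∑ k, pd k (fun y => K.V ε i y k) x ≤ 3 * b := by
    refine (neg_le_abs _).trans ((Finset.abs_sum_le_sum_abs _ _).trans ?_)
    refine (Finset.sum_le_sum fun k _ => (hV ε hε).2 x hx k).trans ?_
    simp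
  have := Real.exp_pos (J.cylinderExponent M ε i x)
  nlinarith

/-- On the lateral surface the gradient of the exponent is a large multiple of the normal, up to
a bounded vector; for large `M` its conormal derivative dominates the normal velocity. -/
theorem exists_lateral_bound (i : Fin 3) : ∃ M₀ : ℝ, 0 < M₀ ∧ ∀ M, M₀ ≤ M → ∀ ε,
    J.Admissible ε → ∀ x ∈ J.lateral ε i, ∃ ν, IsOutwardNormal (J.cylinder ε i) x ν ∧
      inner ℝ (K.V ε i x) ν + ε ≤
        ε * fderiv ℝ (J.cylinderExponent M ε i) x (applyMat (K.D ε i x) ν) := by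
  obtain ⟨κ, a, hκ, ha, hD⟩ := K.exists_bound_D i
  obtain ⟨b, hb, hV⟩ := K.exists_bound_V i
  obtain ⟨H, m, hH, hm, hh⟩ := J.exists_bound_h
  refine ⟨(b * H + 4 * (b * H)) / (2 * m) / (2 * m * κ) + (1 + 3 * a) / (2 * m * κ),
    by positivity, fun M hM ε hε x hx => ?_⟩
  have hp := hε.pos
  have hcl : x ∈ closure (J.cylinder ε i) := hx.1.1
  have hxi : x i ∈ Ioo 0 (J.ℓ i) := ⟨(hε.base_mem i).1.trans_lt hx.2.1, hx.2.2⟩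
  have hxi' : x i ∈ Icc 0 (J.ℓ i) := ⟨hxi.1.le, hxi.2.le⟩
  have hT := hε.transSq_eq_of_lateral hx
  have hmh := ((hh i).1 _ hxi').1
  set G := gradient (J.lateralLevel ε i) x with hG
  have hGk : ∀ k, G k = if k = i then -deriv (J.hSq i) (x i) else (ε ^ 2)⁻¹ * (2 * x k) :=
    fun k => by rw [hG, gradient_apply, Geometry.pd_lateralLevel ε hxi]
  -- the transversal part of the gradient has length `2 h / ε`
  have hGn : 2 * m ≤ ε * ‖G‖ := by
    have h1 : ‖G‖ ^ 2 = ∑ k, G k ^ 2 := by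
      rw [EuclideanSpace.norm_sq_eq]; simp
    have h2 : ∑ k ∈ Finset.univ.erase i, G k ^ 2 ≤ ∑ k, G k ^ 2 :=
      Finset.sum_le_sum_of_subset_of_nonneg (Finset.erase_subset _ _) fun _ _ _ => sq_nonneg _
    have h3 : ∑ k ∈ Finset.univ.erase i, G k ^ 2 = 4 * (ε ^ 2)⁻¹ ^ 2 * transSq i x := by
      rw [transSq, Finset.mul_sum]
      refine Finset.sum_congr rfl fun k hk => ?_
      rw [hGk, if_neg (Finset.ne_of_mem_erase hk)]; ring
    rw [h3, hT, ← h1] at h2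
    have h4 : (2 * m) ^ 2 ≤ (ε * ‖G‖) ^ 2 := by
      have h5 : 4 * (ε ^ 2)⁻¹ ^ 2 * (ε ^ 2 * J.h i (x i) ^ 2) * ε ^ 2 = 4 * J.h i (x i) ^ 2 := by
        field_simp
      calc (2 * m) ^ 2 = 4 * m ^ 2 := by ring
        _ ≤ 4 * J.h i (x i) ^ 2 := by gcongr
        _ ≤ ‖G‖ ^ 2 * ε ^ 2 := by rw [← h5]; gcongr
        _ = (ε * ‖G‖) ^ 2 := by ring
    exact le_of_sq_le_sq h4 (by positivity)
  have hG0 : 0 < ‖G‖ := by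
    by_contra! h
    nlinarith [norm_nonneg G]
  set ν := ‖G‖⁻¹ • G with hν
  have hGν : G = ‖G‖ • ν := by rw [hν, smul_inv_smul₀ hG0.ne']
  have hν1 : ‖ν‖ = 1 := by
    rw [hν, norm_smul, norm_inv, norm_norm, inv_mul_cancel₀ hG0.ne']
  refine ⟨ν, ⟨hν1, J.lateralLevel ε i, Geometry.contDiffAt_lateralLevel ε hxi, ?_,
    ⟨‖G‖, hG0, hGν⟩, {y | ε * J.ℓ₀ < y i} ∩ {y | y i < J.ℓ i}, ?_, ?_⟩, ?_⟩
  · rw [Geometry.lateralLevel, hT, Geometry.hSq]; field_simp; ring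
  · exact inter_mem ((isOpen_lt continuous_const (by fun_prop)).mem_nhds hx.2.1)
      ((isOpen_lt (by fun_prop) continuous_const).mem_nhds hx.2.2)
  · ext y
    have h1 : J.lateralLevel ε i y < 0 ↔ transSq i y < ε ^ 2 * J.h i (y i) ^ 2 := by
      rw [Geometry.lateralLevel, ← inv_mul_lt_iff₀ (by positivity), Geometry.hSq]
      constructor <;> intro h <;> linarith
    constructor
    · rintro ⟨hy, hy'⟩
      exact ⟨h1.2 hy.2.2, hy'⟩
    · rintro ⟨hy, hy1, hy2⟩
      exact ⟨⟨hy1, hy2, h1.1 hy⟩, hy1, hy2⟩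
  · obtain ⟨-, hell, hent⟩ := (hD ε hε).1 x hcl
    set d := applyMat (K.D ε i x) ν with hd
    have hφ : fderiv ℝ (J.cylinderExponent M ε i) x d = M * ε * inner ℝ G d - d i := by
      rw [fderiv_eq_sum_pd]
      simp only [Geometry.pd_cylinderExponent M hxi, ← gradient_apply, ← hG, mul_add,
        Finset.sum_add_distrib, inner_eq_sum, Finset.mul_sum]
      have : ∑ k, d k * (if k = i then (-1 : ℝ) else 0) = -d i := by simp
      rw [this, sub_eq_add_neg]
      congr 1
      exact Finset.sum_congr rfl fun k _ => by ring
    have h1 : κ ≤ inner ℝ ν d := by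
      have := hell ν
      rw [hν1, one_pow, mul_one, real_inner_comm] at this
      exact this
    have h2 : d i ≤ 3 * a := by
      rw [hd, applyMat_apply]
      have : ∀ l, K.D ε i x i l * ν l ≤ a := fun l => by
        refine (le_abs_self _).trans ?_
        rw [abs_mul]
        have := (abs_apply_le_norm ν l).trans hν1.le
        have := hent i l
        calc |K.D ε i x i l| * |ν l| ≤ a * 1 := by gcongr
          _ = a := mul_one a
      refine (Finset.sum_le_sum fun l _ => this l).trans ?_
      simp
    have h3 : inner ℝ (K.V ε i x) ν * ‖G‖ ≤ b * H + 4 * (b * H) := by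
      have h5 : inner ℝ (K.V ε i x) ν * ‖G‖ = ∑ k, K.V ε i x k * G k := by
        rw [← inner_eq_sum, mul_comm, ← real_inner_smul_right, ← hGν]
      obtain ⟨hV1, hV2⟩ := (hV ε hε).1 x hcl
      rw [h5, ← Finset.add_sum_erase _ _ (Finset.mem_univ i)]
      refine add_le_add ?_ ?_
      · refine (le_abs_self _).trans ?_
        rw [hGk, if_pos rfl, abs_mul, abs_neg]
        have := ((hh i).2 _ hxi).1
        gcongr
      · have : ∀ k ∈ Finset.univ.erase i, K.V ε i x k * G k ≤ 2 * (b * H) := fun k hk => by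
          have hk' := Finset.ne_of_mem_erase hk
          refine (le_abs_self _).trans ?_
          have h6 := Geometry.abs_coord_le_of_cylinder hε hcl hk' ((hh i).1 _ hxi').2.1
          rw [hGk, if_neg hk', abs_mul, abs_mul, abs_mul, abs_of_pos (by positivity : 0 < (ε ^ 2)⁻¹),
            abs_two]
          calc |K.V ε i x k| * ((ε ^ 2)⁻¹ * (2 * |x k|))
              ≤ ε * b * ((ε ^ 2)⁻¹ * (2 * (ε * H))) := by
                have := hV2 k hk'
                gcongr
            _ = 2 * (b * H) := by field_simp
        refine (Finset.sum_le_sum this).trans ?_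
        rw [Finset.sum_const, Finset.card_erase_of_mem (Finset.mem_univ i)]
        simp
        linarith
    have h4 : inner ℝ (K.V ε i x) ν ≤ ε * ((b * H + 4 * (b * H)) / (2 * m)) := by
      have h5 : 0 < b * H + 4 * (b * H) := by positivity
      rw [← mul_div_assoc, le_div_iff₀ (by positivity)]
      rcases le_or_gt (inner ℝ (K.V ε i x) ν) 0 with h | h
      · nlinarith
      · nlinarith
    have h5 : (b * H + 4 * (b * H)) / (2 * m) + (1 + 3 * a) ≤ M * (2 * m * κ) := by
      rw [← add_div, div_le_iff₀ (by positivity)] at hM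
      exact hM
    have hM0 : 0 < M := lt_of_lt_of_le (by positivity) hM
    have h6 : M * (2 * m * κ) ≤ M * ε * inner ℝ G d := by
      have h7 : inner ℝ G d = ‖G‖ * inner ℝ ν d := by rw [← real_inner_smul_left, ← hGν]
      calc M * (2 * m * κ) ≤ M * (ε * ‖G‖ * inner ℝ ν d) := by gcongr
        _ = M * ε * inner ℝ G d := by rw [h7]; ring
    rw [hφ]
    nlinarith

end Coefficients

/-! ### The exponents at the bases and at the node surface -/

namespace Geometry

variable {J : Geometry} {ε : ℝ}

/-- On both sides of the base of a cylinder the exponents agree; along the axis the exponent of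
the node is constant there. -/
theorem Admissible.nodeExponent_base (hε : J.Admissible ε) {c : ℝ} (hc : J.IsCollar c) (M : ℝ) {i : Fin 3}
    {x : E3} (hx : x ∈ J.crossSection ε i (ε * J.ℓ₀)) {s : ℝ} (hs : s ≤ ε * c / 2) :
    J.nodeExponent c M ε (x + s • -EuclideanSpace.single i 1) = J.cylinderExponent M ε i x := by
  have hp := hε.pos
  have ht : transSq i (ε⁻¹ • (x + s • -EuclideanSpace.single i (1 : ℝ))) =
      (ε ^ 2)⁻¹ * transSq i x := by
    rw [transSq_smul, smul_neg, ← neg_smul, transSq_add_single, inv_pow]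
  have hx2 := hx.2
  rw [hε.h_base] at hx2
  rw [nodeExponent, hc.nodeProfile_eq (i := i), ht, cylinderExponent,
    lateralLevel, hSq, hx.1, hε.h_base]
  · ring
  · have : (ε⁻¹ • (x + s • -EuclideanSpace.single i (1 : ℝ)) : E3) i = ε⁻¹ * (x i - s) := by
      simp; ring
    rw [this, hx.1, le_inv_mul_iff₀ hp]
    linarith
  · rw [ht, inv_mul_le_iff₀ (by positivity)]
    exact hx2

theorem Admissible.cylinderExponent_base (hε : J.Admissible ε) (M : ℝ) {i : Fin 3}
    {x : E3} (hx : x ∈ J.crossSection ε i (ε * J.ℓ₀)) {s : ℝ} (hs0 : 0 < s)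
    (hs : s < min (J.δ - ε * J.ℓ₀) (J.ℓ i - ε * J.ℓ₀)) :
    x + s • EuclideanSpace.single i 1 ∈ closure (J.cylinder ε i) ∧
      (x + s • EuclideanSpace.single i (1 : ℝ)) i < J.ℓ i ∧
      J.cylinderExponent M ε i (x + s • EuclideanSpace.single i 1) =
        J.cylinderExponent M ε i x + -s := by
  have h1 := hs.trans_le (min_le_left _ _)
  have h2 := hs.trans_le (min_le_right _ _)
  have h0 := (hε.base_mem i).1
  have hi : (x + s • EuclideanSpace.single i (1 : ℝ)) i = ε * J.ℓ₀ + s := by simp [hx.1]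
  have hh : J.h i (ε * J.ℓ₀ + s) = J.h i 0 :=
    J.h_left i _ ⟨by linarith, by linarith⟩ (by linarith)
  refine ⟨hε.mem_closure_cylinder_iff.2 ⟨?_, ?_⟩, ?_, ?_⟩
  · rw [hi]; constructor <;> linarith
  · rw [hi, transSq_add_single, hh, ← hε.h_base]; exact hx.2
  · rw [hi]; linarith
  · rw [cylinderExponent, cylinderExponent, lateralLevel,
      lateralLevel, transSq_add_single, hi, hx.1, hSq, hSq, hh,
      hε.h_base]
    ring

theorem Admissible.nodeExponent_eq_zero (hε : J.Admissible ε) {c : ℝ} (hc : J.IsCollar c) (M : ℝ) {x : E3}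
    (hx : x ∈ J.nodeBoundary ε) : J.nodeExponent c M ε x = 0 := by
  rw [nodeExponent, hc.nodeProfile_eq_zero (hε.inv_smul_mem_nodeSurface hx), mul_zero]

theorem IsCollar.nodeExponent_nonpos {c M : ℝ} (hc : J.IsCollar c) (hε : 0 < ε) (hM : 0 < M) {x : E3}
    (hx : x ∈ closure (J.node ε)) : J.nodeExponent c M ε x ≤ 0 := by
  have := hc.nodeProfile_nonneg ((mem_closure_node_iff hε).1 hx)
  rw [nodeExponent, neg_mul]
  have := mul_nonneg (mul_pos hM hε).le this
  linarith

end Geometry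

/-! ### Contact with the barrier at an interior point -/

theorem contact_of_isLocalMax {A : E3 → Matrix (Fin 3) (Fin 3) ℝ} {f B : E3 → ℝ} {x : E3}
    (hsymm : (A x).IsSymm) (hpos : ∀ y : E3, 0 ≤ inner ℝ (applyMat (A x) y) y)
    (hf : ContDiffAt ℝ 2 f x) (hB : ContDiffAt ℝ 2 B x) (h : IsLocalMax (fun y => f y - B y) x) :
    divForm A f x ≤ divForm A B x ∧ ∀ k, pd k f x = pd k B x := by
  have hfd : DifferentiableAt ℝ f x := hf.differentiableAt (by norm_num)
  have hBd : DifferentiableAt ℝ B x := hB.differentiableAt (by norm_num)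
  have he : (fun y => f y - B y) = fun y => f y + -1 * B y := by funext y; ring
  rw [he] at h
  constructor
  · have := divForm_nonpos_of_isLocalMax hsymm hpos (hf.add (contDiffAt_const.mul hB)) h
    rw [divForm_add A hf (contDiffAt_const.mul hB), divForm_const_mul] at this
    linarith
  · intro k
    have h0 : pd k (fun y => f y + -1 * B y) x = 0 := by rw [pd, h.fderiv_eq_zero]; rfl
    rw [pd_add hfd (hBd.const_mul _), pd_const_mul] at h0
    linarith

theorem deriv_ge_of_contact {u : ℝ → ℝ} {lam C t : ℝ} (ht : 0 < t) (hu : DifferentiableAt ℝ u t)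
    (h : ∀ s ∈ Icc 0 t, u s - C * Real.exp (lam * s) ≤ u t - C * Real.exp (lam * t)) :
    lam * (C * Real.exp (lam * t)) ≤ deriv u t := by
  have hexp : HasDerivAt (fun s => C * Real.exp (lam * s)) (C * (Real.exp (lam * t) * lam)) t := by
    have := ((hasDerivAt_id t).const_mul lam).exp.const_mul C
    simpa using this
  have hd := hu.hasDerivAt.sub hexp
  have := deriv_nonneg_of_le_left ht hd.differentiableAt h
  rw [hd.deriv] at this
  linarith

theorem IsC21.contDiffAt {T : ℝ} {S : Set E3} {ψ : E3 → ℝ → ℝ} (h : IsC21 T S ψ) (hS : IsOpen S)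
    {x : E3} (hx : x ∈ S) {t : ℝ} (ht : t ∈ Ioo 0 T) : ContDiffAt ℝ 2 (fun y => ψ y t) x :=
  (h.space t ht).contDiffAt (hS.mem_nhds hx)

/-- A derivative along a ray, compared with that of a majorant touching at the vertex. -/
theorem fderivWithin_le_of_ray {S : Set E3} {f B : E3 → ℝ} {x v : E3} {a : ℝ} (ha : 0 < a)
    (hf : DifferentiableWithinAt ℝ f S x) (hB : DifferentiableAt ℝ B x)
    (h : ∀ s ∈ Ioo 0 a, x + s • v ∈ S ∧ f (x + s • v) ≤ B (x + s • v)) (heq : f x = B x) :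
    fderivWithin ℝ f S x v ≤ fderiv ℝ B x v := by
  set R := S ∩ {y | f y ≤ B y} with hR
  have hmax : IsLocalMaxOn (fun y => f y - B y) R x := by
    filter_upwards [self_mem_nhdsWithin] with y hy
    have : f y ≤ B y := hy.2
    linarith
  have hcone : v ∈ posTangentConeAt R x := by
    refine mem_posTangentConeAt_of_frequently_mem (Eventually.frequently ?_)
    filter_upwards [Ioo_mem_nhdsGT ha] with s hs using h s hs
  have := hmax.hasFDerivWithinAt_nonpos
    ((hf.hasFDerivWithinAt.mono inter_subset_left).sub hB.hasFDerivAt.hasFDerivWithinAt) hcone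
  rw [_root_.sub_apply] at this
  linarith

namespace IsClassicalSolution

variable {J : Geometry} {K : Coefficients J} {T ε : ℝ} {F₀ : E3 → ℝ → ℝ}
  {F Φ : Fin 3 → E3 → ℝ → ℝ} {ψ : E3 → ℝ → ℝ}

theorem node_contact (h : IsClassicalSolution K T ε F₀ F Φ ψ) (hε : J.Admissible ε)
    {c M Λ lam μ t : ℝ} {x : E3} (hx : x ∈ J.node ε) (ht : t ∈ Ioo 0 T) (hμ : 0 < μ)
    (hΛ : ε * divForm (K.D₀ ε) (fun y => Real.exp (J.nodeExponent c M ε y)) x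
        - ∑ k, K.V₀ ε x k * pd k (fun y => Real.exp (J.nodeExponent c M ε y)) x
        ≤ Λ * Real.exp (J.nodeExponent c M ε x))
    (hlam : Λ + 1 ≤ lam) {r : E3 → ℝ} (hr : ContDiffAt ℝ 2 r x)
    (hspace : IsLocalMax (fun y => ψ y t -
      (μ * Real.exp (lam * t) * Real.exp (J.nodeExponent c M ε y) + r y)) x)
    (htime : ∀ s ∈ Icc 0 t,
      ψ x s - μ * Real.exp (lam * s) * Real.exp (J.nodeExponent c M ε x) ≤
        ψ x t - μ * Real.exp (lam * t) * Real.exp (J.nodeExponent c M ε x)) :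
    μ * Real.exp (lam * t) * Real.exp (J.nodeExponent c M ε x)
      - ε * divForm (K.D₀ ε) r x + ∑ k, K.V₀ ε x k * pd k r x ≤ F₀ x t := by
  obtain ⟨κ, _, _, hκ, -, -, hK⟩ := K.exists_bound_node
  obtain ⟨hsymm, hell, -⟩ := (hK ε hε.pos).1 x (subset_closure hx)
  have hψ := h.regular_node.contDiffAt (Geometry.isOpen_node hε.pos) hx ht
  have hφ : ContDiffAt ℝ 2 (fun y => Real.exp (J.nodeExponent c M ε y)) x :=
    (Geometry.contDiffAt_nodeExponent c M ε x).exp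
  have hcφ : ContDiffAt ℝ 2 (fun y => μ * Real.exp (lam * t) *
    Real.exp (J.nodeExponent c M ε y)) x := contDiffAt_const.mul hφ
  obtain ⟨hdiv, hpd⟩ := contact_of_isLocalMax hsymm
    (fun y => (by positivity : 0 ≤ κ * ‖y‖ ^ 2).trans (hell y)) hψ (hcφ.add hr) hspace
  rw [divForm_add _ hcφ hr, divForm_const_mul] at hdiv
  have htd := deriv_ge_of_contact (u := ψ x) (lam := lam)
    (C := μ * Real.exp (J.nodeExponent c M ε x)) ht.1 (h.regular_node.time x hx t ht)
    (fun s hs => by have := htime s hs; linarith)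
  have heq := h.eq_node x hx t ht
  rw [divergence_applyMat_gradient (fun k l => K.differentiableAt_D₀ hε.pos hx k l) hψ,
    inner_gradient_eq_sum] at heq
  have hsum : ∑ k, K.V₀ ε x k * pd k (fun y => ψ y t) x =
      μ * Real.exp (lam * t) *
        (∑ k, K.V₀ ε x k * pd k (fun y => Real.exp (J.nodeExponent c M ε y)) x)
        + ∑ k, K.V₀ ε x k * pd k r x := by
    rw [Finset.mul_sum, ← Finset.sum_add_distrib]
    refine Finset.sum_congr rfl fun k _ => ?_
    rw [hpd k, pd_add (hcφ.differentiableAt (by norm_num)) (hr.differentiableAt (by norm_num)),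
      pd_const_mul]
    ring
  have hc : 0 < μ * Real.exp (lam * t) := by positivity
  have h1 := mul_le_mul_of_nonneg_left hΛ hc.le
  have h2 := mul_le_mul_of_nonneg_left hdiv hε.pos.le
  have h3 : (Λ + 1) * (μ * Real.exp (lam * t) * Real.exp (J.nodeExponent c M ε x)) ≤
      lam * (μ * Real.exp (lam * t) * Real.exp (J.nodeExponent c M ε x)) := by gcongr
  rw [hsum] at heq
  nlinarith

theorem cylinder_contact (h : IsClassicalSolution K T ε F₀ F Φ ψ) (hε : J.Admissible ε)
    {M Λ lam μ t : ℝ} {i : Fin 3} {x : E3} (hx : x ∈ J.cylinder ε i) (ht : t ∈ Ioo 0 T)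
    (hμ : 0 < μ)
    (hΛ : ε * divForm (K.D ε i) (fun y => Real.exp (J.cylinderExponent M ε i y)) x
        - ∑ k, K.V ε i x k * pd k (fun y => Real.exp (J.cylinderExponent M ε i y)) x
        - (∑ k, pd k (fun y => K.V ε i y k) x) * Real.exp (J.cylinderExponent M ε i x)
        ≤ Λ * Real.exp (J.cylinderExponent M ε i x))
    (hlam : Λ + 1 ≤ lam)
    (hspace : IsLocalMax (fun y => ψ y t -
      μ * Real.exp (lam * t) * Real.exp (J.cylinderExponent M ε i y)) x)
    (htime : ∀ s ∈ Icc 0 t,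
      ψ x s ≤ μ * Real.exp (lam * s) * Real.exp (J.cylinderExponent M ε i x))
    (hcon : ψ x t = μ * Real.exp (lam * t) * Real.exp (J.cylinderExponent M ε i x)) :
    μ * Real.exp (lam * t) * Real.exp (J.cylinderExponent M ε i x) ≤ F i x t := by
  obtain ⟨κ, _, hκ, -, hK⟩ := K.exists_bound_D i
  obtain ⟨hsymm, hell, -⟩ := (hK ε hε).1 x (subset_closure hx)
  have hxi : x i ∈ Ioo 0 (J.ℓ i) := ⟨(hε.base_mem i).1.trans_lt hx.1, hx.2.1⟩
  have hψ := (h.regular_cylinder i).contDiffAt (J.isOpen_cylinder hε.pos i) hx ht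
  have hφ : ContDiffAt ℝ 2 (fun y => Real.exp (J.cylinderExponent M ε i y)) x :=
    ((Geometry.contDiffAt_cylinderExponent M ε hxi).of_le (by norm_num)).exp
  have hcφ : ContDiffAt ℝ 2 (fun y => μ * Real.exp (lam * t) *
    Real.exp (J.cylinderExponent M ε i y)) x := contDiffAt_const.mul hφ
  obtain ⟨hdiv, hpd⟩ := contact_of_isLocalMax hsymm
    (fun y => (by positivity : 0 ≤ κ * ‖y‖ ^ 2).trans (hell y)) hψ hcφ hspace
  rw [divForm_const_mul] at hdiv
  have htd := deriv_ge_of_contact (u := ψ x) (lam := lam)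
    (C := μ * Real.exp (J.cylinderExponent M ε i x)) ht.1
    ((h.regular_cylinder i).time x hx t ht)
    (fun s hs => by have := htime s hs; linarith)
  have heq := h.eq_cylinder i x hx t ht
  rw [divergence_applyMat_gradient (fun k l => K.differentiableAt_D hε hx k l) hψ,
    K.divergence_smul_V hε hx (hψ.differentiableAt (by norm_num)), hcon] at heq
  have hsum : ∑ k, K.V ε i x k * pd k (fun y => ψ y t) x =
      μ * Real.exp (lam * t) *
        ∑ k, K.V ε i x k * pd k (fun y => Real.exp (J.cylinderExponent M ε i y)) x := by
    rw [Finset.mul_sum]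
    refine Finset.sum_congr rfl fun k _ => ?_
    rw [hpd k, pd_const_mul]; ring
  have hc : 0 < μ * Real.exp (lam * t) := by positivity
  have h1 := mul_le_mul_of_nonneg_left hΛ hc.le
  have h2 := mul_le_mul_of_nonneg_left hdiv hε.pos.le
  have h3 : (Λ + 1) * (μ * Real.exp (lam * t) * Real.exp (J.cylinderExponent M ε i x)) ≤
      lam * (μ * Real.exp (lam * t) * Real.exp (J.cylinderExponent M ε i x)) := by gcongr
  rw [hsum] at heq
  nlinarith

/-! ### Contact at the boundary and at the bases of the cylinders -/

theorem inner_sideGradient {A : Matrix (Fin 3) (Fin 3) ℝ} (hA : A.IsSymm) (x ν : E3) (t : ℝ) :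
    inner ℝ (applyMat A (sideGradient J ε ψ x t)) ν =
      fderivWithin ℝ (fun y => ψ y t) (J.sideDomain ε) x (applyMat A ν) := by
  rw [inner_applyMat_comm hA, sideGradient, inner_gradientWithin_left]
  rfl

theorem lateral_contact (h : IsClassicalSolution K T ε F₀ F Φ ψ) (hε : J.Admissible ε)
    {M C t : ℝ} {i : Fin 3} {x ν : E3} (hx : x ∈ J.lateral ε i) (ht : t ∈ Ioo 0 T)
    (hC : 0 < C) (hν : IsOutwardNormal (J.cylinder ε i) x ν)
    (hM : inner ℝ (K.V ε i x) ν + ε ≤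
        ε * fderiv ℝ (J.cylinderExponent M ε i) x (applyMat (K.D ε i x) ν))
    (hle : ∀ y ∈ closure (J.cylinder ε i), ψ y t ≤ C * Real.exp (J.cylinderExponent M ε i y))
    (hcon : ψ x t = C * Real.exp (J.cylinderExponent M ε i x)) :
    C * Real.exp (J.cylinderExponent M ε i x) ≤ -Φ i x t := by
  obtain ⟨κ, _, hκ, -, hK⟩ := K.exists_bound_D i
  obtain ⟨hsymm, hell, -⟩ := (hK ε hε).1 x hx.1.1
  have hxi : x i ∈ Ioo 0 (J.ℓ i) := ⟨(hε.base_mem i).1.trans_lt hx.2.1, hx.2.2⟩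
  set d := applyMat (K.D ε i x) ν with hd
  have hνd : 0 < inner ℝ ν d := by
    have := hell ν
    rw [hν.1, one_pow, mul_one, real_inner_comm] at this
    exact hκ.trans_le this
  have hside := hε.mem_sideDomain_of_cylinder hx.1.1 hx.2.2
  have hφd : DifferentiableAt ℝ (J.cylinderExponent M ε i) x :=
    (Geometry.contDiffAt_cylinderExponent M ε hxi).differentiableAt (by norm_num)
  have hder := hν.fderiv_le hνd ((hε.cylinder_subset i).trans subset_union_left)
    (h.differentiable t ht x hside) (hφd.exp.const_mul C)
    (Eventually.of_forall fun y hy => hle y (subset_closure hy)) hcon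
  have hB : fderiv ℝ (fun y => C * Real.exp (J.cylinderExponent M ε i y)) x d =
      C * Real.exp (J.cylinderExponent M ε i x) * fderiv ℝ (J.cylinderExponent M ε i) x d := by
    rw [fderiv_const_mul hφd.exp, fderiv_exp hφd]
    simp [mul_assoc]
  have hbc := h.bc_lateral i x hx t ht ν (hε.isOutwardNormal_of_lateral hx hν)
  rw [inner_add_left, inner_neg_left, real_inner_smul_left, real_inner_smul_left,
    inner_sideGradient hsymm, hcon] at hbc
  rw [hB] at hder
  have hE : 0 < C * Real.exp (J.cylinderExponent M ε i x) := by positivity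
  set E := C * Real.exp (J.cylinderExponent M ε i x)
  have hp := hε.pos
  have h1 := mul_le_mul_of_nonneg_left hder hp.le
  have h2 := mul_le_mul_of_nonneg_left hM hE.le
  have h3 : ε * E ≤ ε * -Φ i x t := by
    change ε * (E * _) ≤ ε * (fderivWithin ℝ (fun y => ψ y t) (J.sideDomain ε) x d) at h1
    nlinarith
  exact le_of_mul_le_mul_left h3 hp

/-- At the base of a cylinder the barrier has a concave kink along the axis, so a differentiable
function cannot touch it from below. -/
theorem base_contact (h : IsClassicalSolution K T ε F₀ F Φ ψ) (hε : J.Admissible ε)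
    {c M C t : ℝ} (hc : J.IsCollar c) {i : Fin 3} {x : E3}
    (hx : x ∈ J.crossSection ε i (ε * J.ℓ₀)) (hside : x ∈ J.sideDomain ε) (ht : t ∈ Ioo 0 T)
    (hC : 0 < C)
    (hnode : ∀ y ∈ closure (J.node ε), ψ y t ≤ C * Real.exp (J.nodeExponent c M ε y))
    (hle : ∀ y ∈ closure (J.cylinder ε i), ψ y t ≤ C * Real.exp (J.cylinderExponent M ε i y))
    (hcon : ψ x t = C * Real.exp (J.cylinderExponent M ε i x)) : False := by
  have hp := hε.pos
  have hc0 := hc.pos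
  have hdiff := h.differentiable t ht x hside
  have hx2 := hx.2
  rw [hε.h_base] at hx2
  have hleft := fderivWithin_le_of_ray (v := -EuclideanSpace.single i (1 : ℝ))
    (B := fun _ => ψ x t) (a := ε * c / 2) (by positivity) hdiff (differentiableAt_const _)
    (fun s hs => by
      have hmem : x + s • -EuclideanSpace.single i (1 : ℝ) ∈ closure (J.node ε) := by
        rw [Geometry.mem_closure_node_iff hp]
        have hi : (ε⁻¹ • (x + s • -EuclideanSpace.single i (1 : ℝ)) : E3) i = J.ℓ₀ - ε⁻¹ * s := by
          simp only [smul_neg, PiLp.smul_apply, PiLp.add_apply, PiLp.neg_apply, hx.1,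
            PiLp.single_apply, if_true, smul_eq_mul]
          field_simp
          ring
        have hs2 : ε⁻¹ * s < c := by
          rw [inv_mul_lt_iff₀ hp]; have := hs.2; nlinarith
        have hs1 : 0 < ε⁻¹ * s := mul_pos (inv_pos.2 hp) hs.1
        refine hc.mem_closure_Ξ (i := i) (by rw [hi]; linarith) (by rw [hi]; linarith) ?_
        rw [transSq_smul, smul_neg, ← neg_smul, transSq_add_single, inv_pow,
          inv_mul_le_iff₀ (by positivity)]
        exact hx2
      refine ⟨hε.mem_sideDomain_of_node hmem, (hnode _ hmem).trans_eq ?_⟩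
      rw [hε.nodeExponent_base hc M hx hs.2.le, hcon]) rfl
  have hBd : HasFDerivAt (fun y : E3 => ψ x t * Real.exp (-(y i - x i)))
      (ψ x t • (Real.exp (-(x i - x i)) • -(EuclideanSpace.proj i : E3 →L[ℝ] ℝ))) x := by
    have : HasFDerivAt (fun y : E3 => -(y i - x i)) (-(EuclideanSpace.proj i : E3 →L[ℝ] ℝ)) x :=
      ((EuclideanSpace.proj i : E3 →L[ℝ] ℝ).hasFDerivAt.sub_const (x i)).neg
    exact this.exp.const_mul (ψ x t)
  have hright := fderivWithin_le_of_ray (v := EuclideanSpace.single i (1 : ℝ))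
    (B := fun y => ψ x t * Real.exp (-(y i - x i)))
    (a := min (J.δ - ε * J.ℓ₀) (J.ℓ i - ε * J.ℓ₀))
    (lt_min (sub_pos.2 hε.base) (sub_pos.2 (hε.base_lt i))) hdiff hBd.differentiableAt
    (fun s hs => by
      obtain ⟨h1, h2, h3⟩ := hε.cylinderExponent_base M hx hs.1 hs.2
      refine ⟨hε.mem_sideDomain_of_cylinder h1 h2, (hle _ h1).trans_eq ?_⟩
      rw [h3, Real.exp_add, hcon]
      simp [mul_assoc]) (by simp)
  rw [hBd.fderiv] at hright
  rw [map_neg] at hleft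
  simp only [fderiv_fun_const, Pi.zero_apply, _root_.zero_apply] at hleft
  simp at hright
  have : 0 < ψ x t := by rw [hcon]; positivity
  linarith

end IsClassicalSolution

/-! ### Contact at the surface of the node -/

/-- The fourth power of the distance from `x₀`. -/
def quartic (x₀ y : E3) : ℝ := ‖y - x₀‖ ^ 2 * ‖y - x₀‖ ^ 2

theorem contDiff_quartic (x₀ : E3) : ContDiff ℝ (⊤ : ℕ∞) (quartic x₀) := by
  have h : ContDiff ℝ (⊤ : ℕ∞) fun y : E3 => ‖y - x₀‖ ^ 2 :=
    (contDiff_id.sub contDiff_const).norm_sq ℝ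
  exact h.mul h

theorem pd_quartic_self (x₀ : E3) :
    (∀ k, pd k (quartic x₀) x₀ = 0) ∧ ∀ k l, pd k (pd l (quartic x₀)) x₀ = 0 := by
  set q : E3 → ℝ := fun y => ‖y - x₀‖ ^ 2 with hq
  have h : ContDiff ℝ (⊤ : ℕ∞) q := (contDiff_id.sub contDiff_const).norm_sq ℝ
  have hd : Differentiable ℝ q := h.differentiable (by simp)
  have h0 : q x₀ = 0 := by simp [hq]
  have hpd0 : ∀ k, pd k q x₀ = 0 := fun k => by
    have : IsLocalMin q x₀ := Eventually.of_forall fun y => by rw [h0]; positivity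
    rw [pd, this.fderiv_eq_zero]; rfl
  have h1 : ∀ l, pd l (quartic x₀) = fun y => q y * pd l q y + q y * pd l q y := fun l =>
    funext fun y => pd_mul (hd y) (hd y) l
  refine ⟨fun k => by rw [h1]; simp [h0], fun k l => ?_⟩
  have hl : DifferentiableAt ℝ (pd l q) x₀ := (contDiff_pd h l).differentiable (by simp) x₀
  have hm : DifferentiableAt ℝ (fun y => q y * pd l q y) x₀ := (hd x₀).mul hl
  rw [h1, pd_add hm hm, pd_mul (hd x₀) hl, h0, hpd0, hpd0]
  simp

theorem eventually_abs_lt {f : E3 → ℝ} {x : E3} (hf : ContinuousAt f x) {C : ℝ} (h : |f x| < C) :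
    ∀ᶠ y in 𝓝 x, |f y| < C :=
  hf.abs.eventually_lt_const h

/-- Near a zero of a `C³` function, its values and first two derivatives are bounded. -/
theorem eventually_bound_of_contDiffAt {g : E3 → ℝ} {x : E3} (hg : ContDiffAt ℝ 3 g x)
    (hgx : g x = 0) : ∃ P, 0 < P ∧ ∀ᶠ y in 𝓝 x, |g y| < 1 ∧ ContDiffAt ℝ 2 g y ∧
      (∀ k, |pd k g y| < P) ∧ ∀ k l, |pd k (pd l g) y| < P := by
  have h2 : ContDiffAt ℝ 2 (fderiv ℝ g) x := hg.fderiv_right (by norm_num)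
  have h2p : ∀ l, ContDiffAt ℝ 2 (pd l g) x := fun l => h2.clm_apply contDiffAt_const
  have h1p : ∀ k l, ContinuousAt (pd k (pd l g)) x := fun k l =>
    (differentiableAt_pd (h2p l) k).continuousAt
  set P := 1 + ∑ k, |pd k g x| + ∑ kl : Fin 3 × Fin 3, |pd kl.1 (pd kl.2 g) x| with hP
  have hb1 : ∀ k, |pd k g x| < P := fun k => by
    have := Finset.single_le_sum (f := fun k => |pd k g x|) (fun _ _ => abs_nonneg _)
      (Finset.mem_univ k)
    have h3 : 0 ≤ ∑ kl : Fin 3 × Fin 3, |pd kl.1 (pd kl.2 g) x| := by positivity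
    linarith
  have hb2 : ∀ k l, |pd k (pd l g) x| < P := fun k l => by
    have := Finset.single_le_sum (f := fun kl : Fin 3 × Fin 3 => |pd kl.1 (pd kl.2 g) x|)
      (fun _ _ => abs_nonneg _) (Finset.mem_univ (k, l))
    have h3 : 0 ≤ ∑ k, |pd k g x| := by positivity
    simp only at this
    linarith
  refine ⟨P, by positivity, ?_⟩
  have e1 : ∀ᶠ y in 𝓝 x, |g y| < 1 := eventually_abs_lt hg.continuousAt (by simp [hgx])
  have e2 : ∀ᶠ y in 𝓝 x, ContDiffAt ℝ 2 g y := by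
    filter_upwards [hg.eventually (by simp)] with y hy using hy.of_le (by norm_num)
  have e3 : ∀ᶠ y in 𝓝 x, ∀ k, |pd k g y| < P :=
    eventually_all.2 fun k => eventually_abs_lt (h2p k).continuousAt (hb1 k)
  have e4 : ∀ᶠ y in 𝓝 x, ∀ k l, |pd k (pd l g) y| < P :=
    eventually_all.2 fun k => eventually_all.2 fun l => eventually_abs_lt (h1p k l) (hb2 k l)
  filter_upwards [e1, e2, e3, e4] with y h1 h2 h3 h4 using ⟨h1, h2, h3, h4⟩

theorem eventually_bound_quartic (x₀ : E3) {σ : ℝ} (hσ : 0 < σ) : ∀ᶠ y in 𝓝 x₀,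
    (∀ k, |pd k (quartic x₀) y| < σ) ∧ ∀ k l, |pd k (pd l (quartic x₀)) y| < σ := by
  obtain ⟨h1, h2⟩ := pd_quartic_self x₀
  have hc := contDiff_quartic x₀
  refine (eventually_all.2 fun k => ?_).and (eventually_all.2 fun k => eventually_all.2 fun l => ?_)
  · exact eventually_abs_lt (contDiff_pd hc k).continuous.continuousAt (by rw [h1]; simpa)
  · exact eventually_abs_lt (contDiff_pd (contDiff_pd hc l) k).continuous.continuousAt
      (by rw [h2]; simpa)

namespace IsClassicalSolution

variable {J : Geometry} {K : Coefficients J} {T ε : ℝ} {F₀ : E3 → ℝ → ℝ}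
  {F Φ : Fin 3 → E3 → ℝ → ℝ} {ψ : E3 → ℝ → ℝ}

theorem initial_closure (h : IsClassicalSolution K T ε F₀ F Φ ψ) (hT : 0 < T) {x : E3}
    (hx : x ∈ closure (J.junction ε)) : ψ x 0 = 0 := by
  have hc : ContinuousOn (fun y => ψ y 0) (closure (J.junction ε)) :=
    h.continuous.comp (f := fun y : E3 => (y, (0 : ℝ))) (by fun_prop)
      fun y hy => ⟨hy, le_rfl, hT.le⟩
  exact le_antisymm
    (le_on_closure (fun y hy => (h.initial y hy).le) hc continuousOn_const hx)
    (le_on_closure (fun y hy => (h.initial y hy).ge) continuousOn_const hc hx)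

/-- Contact at the node surface. The barrier attains its maximum over the node at each point of
that surface, so its conormal derivative has the right sign, but it may vanish. Therefore the
difference is penalized by `η g + |x - x₀|⁴`, where `g` is a local defining function. As `g` is
zero on the surface, the penalized difference can attain its maximum on the surface only at `x₀`,
and there the Neumann condition excludes it; at an interior maximum the equation applies, and the
contribution of the penalty is arbitrarily small. -/
theorem nodeBoundary_contact (h : IsClassicalSolution K T ε F₀ F Φ ψ) (hε : J.Admissible ε)
    {c M Λ lam μ T' t₀ γ S : ℝ} (hc : J.IsCollar c) (hM : 0 < M) {x₀ : E3}
    (hx₀ : x₀ ∈ J.nodeBoundary ε) (ht₀ : t₀ ∈ Icc 0 T') (hT' : T' < T) (hμ : 0 < μ)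
    (hΛ : ∀ x ∈ J.node ε,
      ε * divForm (K.D₀ ε) (fun y => Real.exp (J.nodeExponent c M ε y)) x
        - ∑ k, K.V₀ ε x k * pd k (fun y => Real.exp (J.nodeExponent c M ε y)) x
        ≤ Λ * Real.exp (J.nodeExponent c M ε x))
    (hlam : Λ + 1 ≤ lam) (hlam0 : 0 ≤ lam) (hγ0 : 0 < γ)
    (hγ : ∀ x ∈ closure (J.node ε), γ ≤ Real.exp (J.nodeExponent c M ε x))
    (hF : ∀ x ∈ J.node ε, ∀ t ∈ Ioo 0 T, F₀ x t ≤ S)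
    (hle : ∀ y ∈ closure (J.node ε), ∀ t ∈ Icc 0 T',
      ψ y t ≤ μ * Real.exp (lam * t) * Real.exp (J.nodeExponent c M ε y))
    (hcon : ψ x₀ t₀ = μ * Real.exp (lam * t₀) * Real.exp (J.nodeExponent c M ε x₀)) :
    μ * γ ≤ S := by
  by_contra! hS
  have hp := hε.pos
  have hT : 0 < T := (ht₀.1.trans ht₀.2).trans_lt hT'
  have hG : ∀ y ∈ closure (J.node ε), ∀ t, 0 ≤ t →
      μ * γ ≤ μ * Real.exp (lam * t) * Real.exp (J.nodeExponent c M ε y) := fun y hy t ht => by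
    have h1 : 1 ≤ Real.exp (lam * t) := Real.one_le_exp (mul_nonneg hlam0 ht)
    calc μ * γ = μ * 1 * γ := by ring
      _ ≤ _ := by gcongr; exact hγ y hy
  obtain ⟨κ, a, b, hκ, ha, hb, hK⟩ := K.exists_bound_node
  obtain ⟨hKc, hKi⟩ := hK ε hp
  have hcl₀ : x₀ ∈ closure (J.node ε) := hx₀.1.1
  obtain ⟨ν, hν⟩ := hε.exists_normal_of_nodeBoundary hx₀
  obtain ⟨hν1, g, hg, hgx, ⟨c', hc', hgrad⟩, U, hU, hnU⟩ := id hν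
  obtain ⟨P, hP, hgP⟩ := eventually_bound_of_contDiffAt hg hgx
  -- the allowance for the derivatives of each of the two penalty terms
  set σ := (μ * γ - S) / (4 * (18 * a + 3 * b)) with hσd
  have hσ : 0 < σ := div_pos (sub_pos.2 hS) (by positivity)
  obtain ⟨ρ₁, hρ₁, hball⟩ := Metric.eventually_nhds_iff.1
    ((hgP.and (eventually_bound_quartic x₀ hσ)).and hU)
  set ρ := ρ₁ / 2 with hρd
  have hρ : 0 < ρ := by positivity
  have hB : ∀ y ∈ Metric.closedBall x₀ ρ, ((|g y| < 1 ∧ ContDiffAt ℝ 2 g y ∧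
      (∀ k, |pd k g y| < P) ∧ ∀ k l, |pd k (pd l g) y| < P) ∧
      (∀ k, |pd k (quartic x₀) y| < σ) ∧ ∀ k l, |pd k (pd l (quartic x₀)) y| < σ) ∧ y ∈ U :=
    fun y hy => hball ((Metric.mem_closedBall.1 hy).trans_lt (by rw [hρd]; linarith))
  obtain ⟨η, hη0, hη⟩ := exists_between
    (lt_min (lt_min (div_pos hσ hP) (by positivity : 0 < ρ ^ 2 * ρ ^ 2))
      (by positivity : 0 < μ * γ))
  simp only [lt_min_iff] at hη
  set r : E3 → ℝ := fun y => η * g y + quartic x₀ y with hr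
  set B : Set E3 := closure (J.node ε) ∩ Metric.closedBall x₀ ρ with hBd
  set w : E3 × ℝ → ℝ := fun q =>
    ψ q.1 q.2 - (μ * Real.exp (lam * q.2) * Real.exp (J.nodeExponent c M ε q.1) + r q.1) with hw
  have hnode : Bornology.IsBounded (J.node ε) := by
    have := J.Ξ_bounded.smul₀ ε
    exact this
  have hcompact : IsCompact (B ×ˢ Icc (0 : ℝ) T') :=
    (hnode.isCompact_closure.inter_right Metric.isClosed_closedBall).prod isCompact_Icc
  have hsub : closure (J.node ε) ⊆ closure (J.junction ε) := closure_mono hε.node_subset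
  have hrc : ContinuousOn r B := fun y hy =>
    (((hB y hy.2).1.1.2.1.continuousAt.const_mul η).add
      (contDiff_quartic x₀).continuous.continuousAt).continuousWithinAt
  have hwc : ContinuousOn w (B ×ˢ Icc (0 : ℝ) T') := by
    refine (h.continuous.mono fun q hq => ⟨hsub hq.1.1, hq.2.1, hq.2.2.trans hT'.le⟩).sub
      (ContinuousOn.add ?_ (hrc.comp continuousOn_fst fun q hq => hq.1))
    have := (Geometry.contDiff_nodeExponent (J := J) c M ε).continuous
    fun_prop
  have hx₀B : x₀ ∈ B := ⟨hcl₀, Metric.mem_closedBall_self hρ.le⟩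
  have hr₀ : r x₀ = 0 := by simp [hr, hgx, quartic]
  obtain ⟨⟨x₁, t₁⟩, ⟨hx₁, ht₁⟩, hmax⟩ :=
    hcompact.exists_isMaxOn ⟨(x₀, t₀), hx₀B, ht₀⟩ hwc
  have hmax' : ∀ y ∈ B, ∀ t ∈ Icc 0 T', w (y, t) ≤ w (x₁, t₁) := fun y hy t ht =>
    hmax (show (y, t) ∈ B ×ˢ Icc (0 : ℝ) T' from ⟨hy, ht⟩)
  have hpos : 0 ≤ w (x₁, t₁) := by
    refine le_trans (le_of_eq ?_) (hmax' x₀ hx₀B t₀ ht₀)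
    simp only [hw, hcon, hr₀]; ring
  have hq1 : quartic x₀ x₁ = ‖x₁ - x₀‖ ^ 2 * ‖x₁ - x₀‖ ^ 2 := rfl
  obtain ⟨⟨⟨hg1, hg2, hg3, hg4⟩, hq3, hq4⟩, hx₁U⟩ := hB x₁ hx₁.2
  have hgη : -(η * g x₁) < η := by
    have := (abs_lt.1 hg1).1
    nlinarith
  have hq0 : 0 ≤ quartic x₀ x₁ := by rw [hq1]; positivity
  have ht₁0 : 0 < t₁ := by
    refine lt_of_le_of_ne ht₁.1 fun h0 => ?_
    have h1 : ψ x₁ t₁ = 0 := by rw [← h0]; exact h.initial_closure hT (hsub hx₁.1)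
    have h2 := hG x₁ hx₁.1 t₁ ht₁.1
    simp only [hw, h1, hr] at hpos
    linarith
  have ht₁T : t₁ ∈ Ioo 0 T := ⟨ht₁0, ht₁.2.trans_lt hT'⟩
  have hlt : dist x₁ x₀ < ρ := by
    refine lt_of_le_of_ne hx₁.2 fun he => ?_
    have h1 := hle x₁ hx₁.1 t₁ ht₁
    rw [dist_eq_norm] at he
    rw [he] at hq1
    simp only [hw, hr, hq1] at hpos
    linarith
  by_cases hn : x₁ ∈ J.node ε
  · have hspace : IsLocalMax (fun y => ψ y t₁ -
        (μ * Real.exp (lam * t₁) * Real.exp (J.nodeExponent c M ε y) + r y)) x₁ := by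
      filter_upwards [(Geometry.isOpen_node hp).mem_nhds hn, Metric.isOpen_ball.mem_nhds hlt]
        with y hy hy'
      exact hmax' y ⟨subset_closure hy, Metric.ball_subset_closedBall hy'⟩ t₁ ht₁
    have hqd : ContDiffAt ℝ 2 (quartic x₀) x₁ :=
      (contDiff_infty.1 (contDiff_quartic x₀) 2).contDiffAt
    have hgd : ContDiffAt ℝ 2 (fun y => η * g y) x₁ := contDiffAt_const.mul hg2
    have hfin := h.node_contact hε hn ht₁T hμ (hΛ x₁ hn) hlam (hgd.add hqd) hspace
      fun s hs => by
        have := hmax' x₁ hx₁ s ⟨hs.1, hs.2.trans ht₁.2⟩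
        simp only [hw] at this
        linarith
    -- the penalty contributes less than the gap
    have hηP : η * P ≤ σ := by
      have := (lt_div_iff₀ hP).1 hη.1.1; exact this.le
    have hr1 : ∀ k, |pd k r x₁| ≤ 2 * σ := fun k => by
      rw [hr, pd_add (hgd.differentiableAt (by norm_num)) (hqd.differentiableAt (by norm_num)),
        pd_const_mul]
      refine (abs_add_le _ _).trans ?_
      rw [abs_mul, abs_of_pos hη0]
      have h1 := mul_le_mul_of_nonneg_left (hg3 k).le hη0.le
      linarith [hq3 k]
    have hr2 : ∀ k l, |pd k (pd l r) x₁| ≤ 2 * σ := fun k l => by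
      have h1 : pd l r =ᶠ[𝓝 x₁] fun y => η * pd l g y + pd l (quartic x₀) y := by
        filter_upwards [eventually_differentiableAt hg2, eventually_differentiableAt hqd]
          with y hy hy'
        rw [hr, pd_add (hy.const_mul η) hy', pd_const_mul]
      rw [pd_congr h1, pd_add ((differentiableAt_pd hg2 l).const_mul η) (differentiableAt_pd hqd l),
        pd_const_mul]
      refine (abs_add_le _ _).trans ?_
      rw [abs_mul, abs_of_pos hη0]
      have h1 := mul_le_mul_of_nonneg_left (hg4 k l).le hη0.le
      linarith [hq4 k l]
    have h1 := abs_divForm_le (hKc x₁ hx₁.1).2.2 (hKi x₁ hn).1 hr1 hr2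
    have h2 := abs_sum_mul_pd_le (hKi x₁ hn).2 hr1
    have h3 : ε * divForm (K.D₀ ε) r x₁ ≤ 18 * a * (2 * σ) := by
      calc ε * divForm (K.D₀ ε) r x₁ ≤ ε * (9 * (a / ε * (2 * σ) + a * (2 * σ))) := by
            gcongr; exact (le_abs_self _).trans h1
        _ = 9 * (a * (2 * σ)) + ε * (9 * (a * (2 * σ))) := by field_simp
        _ ≤ 9 * (a * (2 * σ)) + 1 * (9 * (a * (2 * σ))) := by
            have := hε.lt_one; gcongr
        _ = 18 * a * (2 * σ) := by ring
    have h4 := (abs_le.1 h2).1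
    have h5 := hG x₁ hx₁.1 t₁ ht₁.1
    have h6 := hF x₁ hn t₁ ht₁T
    have h7 : (18 * a + 3 * b) * (2 * σ) = (μ * γ - S) / 2 := by
      rw [hσd]; field_simp; norm_num
    change μ * Real.exp (lam * t₁) * Real.exp (J.nodeExponent c M ε x₁)
      - ε * divForm (K.D₀ ε) r x₁ + ∑ k, K.V₀ ε x₁ k * pd k r x₁ ≤ F₀ x₁ t₁ at hfin
    nlinarith
  · -- outside the node the defining function is nonnegative, which forces `x₁ = x₀`
    have hg0 : 0 ≤ g x₁ := by
      by_contra! hneg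
      have : x₁ ∈ {y | g y < 0} ∩ U := ⟨hneg, hx₁U⟩
      rw [← hnU] at this
      exact hn this.1
    have h1 := hle x₁ hx₁.1 t₁ ht₁
    have hq00 : quartic x₀ x₁ ≤ 0 := by
      simp only [hw, hr] at hpos
      have := mul_nonneg hη0.le hg0
      linarith
    have hx : x₁ = x₀ := by
      rw [hq1, ← pow_add] at hq00
      have : ‖x₁ - x₀‖ ^ (2 + 2) = 0 := le_antisymm hq00 (by positivity)
      exact sub_eq_zero.1 (norm_eq_zero.1 (pow_eq_zero_iff (by norm_num) |>.1 this))
    rw [hx] at hpos h1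
    have hφ0 := hε.nodeExponent_eq_zero hc M hx₀
    have hcon₁ : ψ x₀ t₁ = μ * Real.exp (lam * t₁) := by
      simp only [hw, hr₀] at hpos
      rw [hφ0, Real.exp_zero] at hpos h1
      linarith
    obtain ⟨hsymm, hell, -⟩ := hKc x₀ hcl₀
    set d := applyMat (K.D₀ ε x₀) ν with hd
    have hνd : 0 < inner ℝ ν d := by
      have := hell ν
      rw [hν1, one_pow, mul_one, real_inner_comm] at this
      exact hκ.trans_le this
    have hside := hε.mem_sideDomain_of_node hcl₀
    have hgd : DifferentiableAt ℝ g x₀ := hg.differentiableAt (by norm_num)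
    have hqd : DifferentiableAt ℝ (quartic x₀) x₀ :=
      (contDiff_quartic x₀).differentiable (by simp) x₀
    have hrd : DifferentiableAt ℝ r x₀ := (hgd.const_mul η).add hqd
    have hder := hν.fderiv_le (B := fun y => r y + μ * Real.exp (lam * t₁)) hνd
      (hε.node_subset.trans subset_union_left) (h.differentiable t₁ ht₁T x₀ hside)
      (hrd.add_const _) (by
        filter_upwards [Metric.closedBall_mem_nhds x₀ hρ] with y hy hyn
        have h2 := hmax' y ⟨subset_closure hyn, hy⟩ t₁ ht₁
        rw [hx] at h2
        simp only [hw, hφ0, hcon₁, hr₀, Real.exp_zero] at h2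
        have h3 := hc.nodeExponent_nonpos hp hM (subset_closure hyn)
        have h4 : μ * Real.exp (lam * t₁) * Real.exp (J.nodeExponent c M ε y) ≤
            μ * Real.exp (lam * t₁) * 1 := by
          gcongr; exact Real.exp_le_one_iff.2 h3
        linarith) (by simp [hr₀, hcon₁])
    have hbc := h.bc_node x₀ hx₀ t₁ ht₁T ν (hε.isOutwardNormal_of_nodeBoundary hx₀ hν)
    rw [inner_sideGradient hsymm] at hbc
    have hfr : fderiv ℝ (fun y => r y + μ * Real.exp (lam * t₁)) x₀ d = η * (c' * inner ℝ ν d) := by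
      rw [fderiv_add_const, fderiv_eq_sum_pd]
      have : ∀ k, pd k r x₀ = η * pd k g x₀ := fun k => by
        rw [hr, pd_add (hgd.const_mul η) hqd, pd_const_mul, (pd_quartic_self x₀).1, add_zero]
      simp only [this]
      rw [← real_inner_smul_left, ← fderiv_eq_of_gradient_eq hgrad, fderiv_eq_sum_pd,
        Finset.mul_sum]
      exact Finset.sum_congr rfl fun k _ => by ring
    rw [hfr] at hder
    have hpos2 : 0 < η * (c' * inner ℝ ν d) := by positivity
    exact absurd (hpos2.trans_le hder) (by rw [← hd] at hbc; exact hbc.le.not_gt)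

end IsClassicalSolution

/-! ### The one-sided estimate -/

/-- The closed pieces of the junction: the node (`none`) and the three cylinders. -/
def piece (J : Geometry) (ε : ℝ) : Option (Fin 3) → Set E3
  | none => closure (J.node ε)
  | some i => closure (J.cylinder ε i)

/-- The exponents of the barrier on the closed pieces. -/
def exponent (J : Geometry) (c M ε : ℝ) : Option (Fin 3) → E3 → ℝ
  | none => J.nodeExponent c M ε
  | some i => J.cylinderExponent M ε i

namespace Geometry

variable {J : Geometry} {ε : ℝ}

theorem Admissible.piece_nonempty (hε : J.Admissible ε) (o : Option (Fin 3)) :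
    (piece J ε o).Nonempty := by
  cases o with
  | none => exact ⟨0, subset_closure ((mem_node_iff hε.pos).2 (by simpa using J.zero_mem_Ξ))⟩
  | some i => exact (hε.cylinder_nonempty i).closure

theorem Admissible.isCompact_piece (hε : J.Admissible ε) (o : Option (Fin 3)) :
    IsCompact (piece J ε o) := by
  cases o with
  | none =>
    have h : Bornology.IsBounded (J.node ε) := J.Ξ_bounded.smul₀ ε
    exact h.isCompact_closure
  | some i =>
    -- all coordinates are bounded on the closed cylinder
    obtain ⟨H, m, hH, -, hh⟩ := J.exists_bound_h
    have h : closure (J.cylinder ε i) ⊆ Metric.closedBall 0 (3 * (J.ℓ i + H)) := fun x hx => by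
      have hI := J.mem_Icc_of_closure_cylinder hε.pos hx
      have hℓ := J.ℓ_pos i
      have hk : ∀ k, ‖x k‖ ≤ J.ℓ i + H := fun k => by
        by_cases hk : k = i
        · rw [hk, Real.norm_eq_abs, abs_of_nonneg hI.1]; linarith [hI.2]
        · have := abs_coord_le_of_cylinder hε hx hk ((hh i).1 _ hI).2.1
          rw [Real.norm_eq_abs]
          nlinarith [hε.lt_one]
      rw [mem_closedBall_zero_iff, EuclideanSpace.norm_eq, Real.sqrt_le_left (by positivity)]
      have : ∑ k, ‖x k‖ ^ 2 ≤ ∑ _k : Fin 3, (J.ℓ i + H) ^ 2 :=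
        Finset.sum_le_sum fun k _ => by have := hk k; gcongr
      simp only [Finset.sum_const, Finset.card_univ, Fintype.card_fin, nsmul_eq_mul] at this
      push_cast at this
      nlinarith
    exact (isCompact_closedBall _ _).of_isClosed_subset isClosed_closure h

theorem Admissible.piece_subset (hε : J.Admissible ε) (o : Option (Fin 3)) :
    piece J ε o ⊆ closure (J.junction ε) := by
  cases o with
  | none => exact closure_mono hε.node_subset
  | some i => exact closure_mono (hε.cylinder_subset i)

theorem exists_mem_piece {x : E3} (hx : x ∈ closure (J.junction ε)) : ∃ o, x ∈ piece J ε o := by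
  rcases closure_junction_subset ε hx with h | h
  · exact ⟨none, h⟩
  · obtain ⟨i, hi⟩ := mem_iUnion.1 h
    exact ⟨some i, hi⟩

theorem Admissible.continuousOn_exponent (hε : J.Admissible ε) (c M : ℝ) (o : Option (Fin 3)) :
    ContinuousOn (exponent J c M ε o) (piece J ε o) := by
  cases o with
  | none => exact (contDiff_nodeExponent c M ε).continuous.continuousOn
  | some i =>
    have h : ContinuousOn (fun x : E3 => J.hSq i (x i)) (closure (J.cylinder ε i)) :=
      (contDiffOn_hSq i).continuousOn.comp (by fun_prop)
        fun x hx => J.mem_Icc_of_closure_cylinder hε.pos hx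
    have h2 := continuous_transSq i
    show ContinuousOn (fun x : E3 => M * ε * ((ε ^ 2)⁻¹ * transSq i x + -J.hSq i (x i)) +
      -(x i + -(ε * J.ℓ₀))) (closure (J.cylinder ε i))
    fun_prop

/-- The exponents are nonpositive and bounded below uniformly in `ε`. -/
theorem exists_bound_exponent (J : Geometry) {c M : ℝ} (hc : J.IsCollar c) (hM : 0 < M) :
    ∃ B, ∀ ε, J.Admissible ε → ∀ o, ∀ x ∈ piece J ε o,
      -B ≤ exponent J c M ε o x ∧ exponent J c M ε o x ≤ 0 := by
  obtain ⟨P, hP, hQ⟩ := J.exists_bound_nodeProfile c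
  obtain ⟨H, m, hH, -, hh⟩ := J.exists_bound_h
  refine ⟨M * P + M * H + ∑ i, J.ℓ i, fun ε hε o x hx => ?_⟩
  have hp := hε.pos
  have hp1 := hε.lt_one
  have hℓ : ∀ i, J.ℓ i ≤ ∑ i, J.ℓ i := fun i =>
    Finset.single_le_sum (f := J.ℓ) (fun i _ => (J.ℓ_pos i).le) (Finset.mem_univ i)
  cases o with
  | none =>
    refine ⟨?_, hc.nodeExponent_nonpos hp hM hx⟩
    have h1 := (le_abs_self _).trans (hQ _ ((mem_closure_node_iff hp).1 hx)).1
    have h0 := hc.nodeProfile_nonneg ((mem_closure_node_iff hp).1 hx)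
    have h2 : M * ε * J.nodeProfile c (ε⁻¹ • x) ≤ M * 1 * P := by gcongr
    have h3 : 0 ≤ ∑ i, J.ℓ i := (J.ℓ_pos 0).le.trans (hℓ 0)
    have h4 : 0 < M * H := by positivity
    simp only [exponent, nodeExponent]
    linarith
  | some i =>
    obtain ⟨⟨h1, h2⟩, h3⟩ := J.mem_closure_cylinder hp hx
    have hI := J.mem_Icc_of_closure_cylinder hp hx
    have h4 := ((hh i).1 _ hI).2.2
    have h5 : J.lateralLevel ε i x ≤ 0 := by
      have : (ε ^ 2)⁻¹ * transSq i x ≤ J.h i (x i) ^ 2 := by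
        rw [inv_mul_le_iff₀ (by positivity)]; exact h3
      rw [lateralLevel, hSq]; linarith
    have h6 : -H ≤ J.lateralLevel ε i x := by
      have := transSq_nonneg i x
      have : 0 ≤ (ε ^ 2)⁻¹ * transSq i x := by positivity
      rw [lateralLevel]; linarith
    have h7 : M * ε * -J.lateralLevel ε i x ≤ M * 1 * H := by
      gcongr
      · linarith
      · linarith
    have h8 : 0 ≤ M * ε * -J.lateralLevel ε i x :=
      mul_nonneg (by positivity) (by linarith)
    have h9 : 0 < M * P := by positivity
    have h10 := hℓ i
    have h11 := (hε.base_mem i).1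
    simp only [exponent, cylinderExponent]
    constructor <;> linarith

end Geometry

namespace IsClassicalSolution

variable {J : Geometry} {K : Coefficients J} {T ε : ℝ} {F₀ : E3 → ℝ → ℝ}
  {F Φ : Fin 3 → E3 → ℝ → ℝ} {ψ : E3 → ℝ → ℝ}

/-- If a positive multiple `μ` of the barrier touches the solution from above, then `μ` is
controlled by the data. -/
theorem contact (h : IsClassicalSolution K T ε F₀ F Φ ψ) (hε : J.Admissible ε)
    {c M lam μ T' γ S : ℝ} (hc : J.IsCollar c) (hM : 0 < M) (hT' : T' < T) (hμ : 0 < μ)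
    {Λ₀ : ℝ} {Λ : Fin 3 → ℝ}
    (hΛ₀ : ∀ x ∈ J.node ε,
      ε * divForm (K.D₀ ε) (fun y => Real.exp (J.nodeExponent c M ε y)) x
        - ∑ k, K.V₀ ε x k * pd k (fun y => Real.exp (J.nodeExponent c M ε y)) x
        ≤ Λ₀ * Real.exp (J.nodeExponent c M ε x))
    (hΛ : ∀ i, ∀ x ∈ J.cylinder ε i,
      ε * divForm (K.D ε i) (fun y => Real.exp (J.cylinderExponent M ε i y)) x
        - ∑ k, K.V ε i x k * pd k (fun y => Real.exp (J.cylinderExponent M ε i y)) x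
        - (∑ k, pd k (fun y => K.V ε i y k) x) * Real.exp (J.cylinderExponent M ε i x)
        ≤ Λ i * Real.exp (J.cylinderExponent M ε i x))
    (hlat : ∀ i, ∀ x ∈ J.lateral ε i, ∃ ν, IsOutwardNormal (J.cylinder ε i) x ν ∧
      inner ℝ (K.V ε i x) ν + ε ≤
        ε * fderiv ℝ (J.cylinderExponent M ε i) x (applyMat (K.D ε i x) ν))
    (hlam₀ : Λ₀ + 1 ≤ lam) (hlam : ∀ i, Λ i + 1 ≤ lam) (hlam0 : 0 ≤ lam) (hγ0 : 0 < γ)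
    (hγ : ∀ o, ∀ x ∈ piece J ε o, γ ≤ Real.exp (exponent J c M ε o x))
    (hF₀ : ∀ x ∈ J.node ε, ∀ t ∈ Ioo 0 T, F₀ x t ≤ S)
    (hF : ∀ i, ∀ x ∈ J.cylinder ε i, ∀ t ∈ Ioo 0 T, F i x t ≤ S)
    (hΦ : ∀ i, ∀ x ∈ J.lateral ε i, ∀ t ∈ Ioo 0 T, -Φ i x t ≤ S)
    (hle : ∀ o, ∀ y ∈ piece J ε o, ∀ t ∈ Icc 0 T',
      ψ y t ≤ μ * Real.exp (lam * t) * Real.exp (exponent J c M ε o y))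
    {o : Option (Fin 3)} {x : E3} (hx : x ∈ piece J ε o) {t : ℝ} (ht : t ∈ Icc 0 T')
    (hcon : ψ x t = μ * Real.exp (lam * t) * Real.exp (exponent J c M ε o x)) :
    μ * γ ≤ S := by
  have hp := hε.pos
  have hT : 0 < T := (ht.1.trans ht.2).trans_lt hT'
  have hψ : 0 < ψ x t := by rw [hcon]; positivity
  have ht0 : 0 < t := by
    refine lt_of_le_of_ne ht.1 fun h0 => hψ.ne' ?_
    rw [← h0]
    exact h.initial_closure hT (hε.piece_subset o hx)
  have htT : t ∈ Ioo 0 T := ⟨ht0, ht.2.trans_lt hT'⟩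
  have hG : μ * γ ≤ ψ x t := by
    have h1 : 1 ≤ Real.exp (lam * t) := Real.one_le_exp (mul_nonneg hlam0 ht.1)
    rw [hcon]
    calc μ * γ = μ * 1 * γ := by ring
      _ ≤ _ := by gcongr; exact hγ o x hx
  have hC : 0 < μ * Real.exp (lam * t) := by positivity
  have hpast : ∀ s ∈ Icc 0 t, s ∈ Icc 0 T' := fun s hs => ⟨hs.1, hs.2.trans ht.2⟩
  -- contact at the base of a cylinder is impossible
  have hbase : ∀ i, x ∈ J.crossSection ε i (ε * J.ℓ₀) →
      ψ x t = μ * Real.exp (lam * t) * Real.exp (J.cylinderExponent M ε i x) → False :=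
    fun i hi hci => by
      have hside : x ∈ J.sideDomain ε := by
        refine hε.mem_sideDomain_of_cylinder (i := i) (hε.mem_closure_cylinder_iff.2 ⟨?_, ?_⟩) ?_
        · rw [hi.1]; exact ⟨le_rfl, (hε.base_lt i).le⟩
        · rw [hi.1]; exact hi.2
        · rw [hi.1]; exact hε.base_lt i
      exact h.base_contact hε hc hi hside htT hC (fun y hy => hle none y hy t ht)
        (fun y hy => hle (some i) y hy t ht) hci
  cases o with
  | none =>
    by_cases hn : x ∈ J.node ε
    · have hspace : IsLocalMax (fun y => ψ y t -
          (μ * Real.exp (lam * t) * Real.exp (J.nodeExponent c M ε y) + 0)) x := by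
        filter_upwards [(Geometry.isOpen_node hp).mem_nhds hn] with y hy
        have := hle none y (subset_closure hy) t ht
        simp only [exponent] at this hcon
        linarith
      have := h.node_contact hε hn htT hμ (hΛ₀ x hn) hlam₀ (r := fun _ => 0) contDiffAt_const
        hspace fun s hs => by
          have := hle none x hx s (hpast s hs)
          simp only [exponent] at this hcon
          linarith
      have h0 : ∀ k, pd k (fun _ : E3 => (0 : ℝ)) x = 0 := fun k => by simp [pd]
      have h1 : divForm (K.D₀ ε) (fun _ : E3 => (0 : ℝ)) x = 0 := by
        have := divForm_const_mul (K.D₀ ε) 0 (fun _ => 0) x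
        simpa using this
      simp only [h0, h1, mul_zero, Finset.sum_const_zero, sub_zero, add_zero] at this
      have h2 := hF₀ x hn t htT
      simp only [exponent] at hcon
      linarith
    · by_cases hd : ∃ i, x ∈ J.crossSection ε i (ε * J.ℓ₀)
      · obtain ⟨i, hi⟩ := hd
        refine (hbase i hi ?_).elim
        have := hε.nodeExponent_base hc M hi (s := 0) (by have := hc.pos; positivity)
        rw [zero_smul, add_zero] at this
        rw [← this]; exact hcon
      · have hxb : x ∈ J.nodeBoundary ε := by
          refine ⟨⟨hx, fun hi => hn (interior_subset hi)⟩, ?_⟩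
          simpa using hd
        exact h.nodeBoundary_contact hε hc hM hxb ht hT' hμ hΛ₀ hlam₀ hlam0 hγ0
          (hγ none) hF₀ (hle none) hcon
  | some i =>
    obtain ⟨⟨h1, h2⟩, h3⟩ := J.mem_closure_cylinder hp hx
    rcases h1.eq_or_lt with h1' | h1'
    · exact (hbase i ⟨h1'.symm, by rw [h1']; exact h3⟩ hcon).elim
    · rcases h2.eq_or_lt with h2' | h2'
      · exact absurd (h.dirichlet i x ⟨h2', by rw [← h2']; exact h3⟩ t htT) hψ.ne'
      · by_cases hin : x ∈ J.cylinder ε i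
        · have hspace : IsLocalMax (fun y => ψ y t -
              μ * Real.exp (lam * t) * Real.exp (J.cylinderExponent M ε i y)) x := by
            filter_upwards [(J.isOpen_cylinder hp i).mem_nhds hin] with y hy
            have := hle (some i) y (subset_closure hy) t ht
            simp only [exponent] at this hcon
            linarith
          have := h.cylinder_contact hε hin htT hμ (hΛ i x hin) (hlam i) hspace
            (fun s hs => hle (some i) x hx s (hpast s hs)) hcon
          have h2 := hF i x hin t htT
          simp only [exponent] at hcon
          linarith
        · have hl : x ∈ J.lateral ε i := ⟨⟨hx, fun hi => hin (interior_subset hi)⟩, h1', h2'⟩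
          obtain ⟨ν, hν, hM'⟩ := hlat i x hl
          have := h.lateral_contact hε hl htT hC hν hM' (fun y hy => hle (some i) y hy t ht) hcon
          have h2 := hΦ i x hl t htT
          simp only [exponent] at hcon
          linarith

end IsClassicalSolution

/-- The estimate from above, with a constant that does not depend on `ε`. -/
theorem exists_upper_bound {J : Geometry} (K : Coefficients J) {T : ℝ} (hT : 0 < T) :
    ∃ C₀ : ℝ, 0 < C₀ ∧ ∀ ε, J.Admissible ε → ∀ (F₀ : E3 → ℝ → ℝ) (F Φ : Fin 3 → E3 → ℝ → ℝ)
      (ψ : E3 → ℝ → ℝ) (S : ℝ), IsClassicalSolution K T ε F₀ F Φ ψ → 0 ≤ S →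
      (∀ x ∈ J.node ε, ∀ t ∈ Ioo 0 T, F₀ x t ≤ S) →
      (∀ i, ∀ x ∈ J.cylinder ε i, ∀ t ∈ Ioo 0 T, F i x t ≤ S) →
      (∀ i, ∀ x ∈ J.lateral ε i, ∀ t ∈ Ioo 0 T, -Φ i x t ≤ S) →
      ∀ x ∈ closure (J.junction ε), ∀ t ∈ Icc 0 T, ψ x t ≤ C₀ * S := by
  by_cases hadm : ∃ ε, J.Admissible ε
  swap
  · exact ⟨1, one_pos, fun ε hε => (hadm ⟨ε, hε⟩).elim⟩
  obtain ⟨ε₀, hε₀⟩ := hadm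
  obtain ⟨c, hc⟩ := hε₀.exists_isCollar
  choose M₀ hM₀ hlat using K.exists_lateral_bound
  obtain ⟨i₀, hi₀⟩ := Finite.exists_max M₀
  set M := M₀ i₀
  have hM : 0 < M := hM₀ i₀
  obtain ⟨Λ₀, hΛ₀⟩ := K.exists_operator_bound_node c hM
  choose Λ hΛ using fun i => K.exists_operator_bound_cylinder i hM
  obtain ⟨i₁, hi₁⟩ := Finite.exists_max Λ
  obtain ⟨B, hB⟩ := J.exists_bound_exponent hc hM
  set lam := max (max (Λ₀ + 1) (Λ i₁ + 1)) 0 with hlamd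
  have hlam0 : 0 ≤ lam := le_max_right _ _
  refine ⟨Real.exp (lam * T) / Real.exp (-B), by positivity,
    fun ε hε F₀ F Φ ψ S h hS hF₀ hF hΦ => ?_⟩
  -- the bound up to a time `T' < T`
  have key : ∀ T' ∈ Ioo 0 T, ∀ x ∈ closure (J.junction ε), ∀ t ∈ Icc 0 T',
      ψ x t ≤ Real.exp (lam * T) / Real.exp (-B) * S := by
    intro T' hT' x hx t ht
    set E : Option (Fin 3) → E3 × ℝ → ℝ := fun o q =>
      Real.exp (lam * q.2) * Real.exp (exponent J c M ε o q.1) with hE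
    have hE0 : ∀ o q, 0 < E o q := fun o q => by positivity
    have hcont : ∀ o, ContinuousOn (fun q : E3 × ℝ => ψ q.1 q.2 / E o q)
        (piece J ε o ×ˢ Icc 0 T') := fun o => by
      refine (h.continuous.mono fun q hq =>
        ⟨hε.piece_subset o hq.1, hq.2.1, hq.2.2.trans hT'.2.le⟩).div ?_ fun q _ => (hE0 o q).ne'
      have := (hε.continuousOn_exponent c M o).comp (f := Prod.fst)
        (s := piece J ε o ×ˢ Icc (0 : ℝ) T') continuousOn_fst fun q hq => hq.1
      exact (by fun_prop : Continuous fun q : E3 × ℝ => Real.exp (lam * q.2)).continuousOn.mul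
        this.rexp
    have hmax : ∀ o, ∃ q ∈ piece J ε o ×ˢ Icc 0 T',
        IsMaxOn (fun q : E3 × ℝ => ψ q.1 q.2 / E o q) (piece J ε o ×ˢ Icc 0 T') q := fun o =>
      ((hε.isCompact_piece o).prod isCompact_Icc).exists_isMaxOn
        ((hε.piece_nonempty o).prod ⟨0, le_rfl, hT'.1.le⟩) (hcont o)
    choose q hq hqmax using hmax
    obtain ⟨o₁, ho₁⟩ := Finite.exists_max fun o => ψ (q o).1 (q o).2 / E o (q o)
    set μ := ψ (q o₁).1 (q o₁).2 / E o₁ (q o₁) with hμ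
    have hle : ∀ o, ∀ y ∈ piece J ε o, ∀ s ∈ Icc 0 T',
        ψ y s ≤ μ * Real.exp (lam * s) * Real.exp (exponent J c M ε o y) := by
      intro o y hy s hs
      have h1 : ψ y s / E o (y, s) ≤ μ :=
        (hqmax o (show (y, s) ∈ piece J ε o ×ˢ Icc 0 T' from ⟨hy, hs⟩)).trans (ho₁ o)
      rw [div_le_iff₀ (hE0 _ _)] at h1
      rw [mul_assoc]; exact h1
    obtain ⟨o, ho⟩ := Geometry.exists_mem_piece hx
    have hψ := hle o x ho t ht
    rcases le_or_gt μ 0 with hμ0 | hμ0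
    · have h1 : μ * Real.exp (lam * t) * Real.exp (exponent J c M ε o x) ≤ 0 := by
        rw [mul_assoc]; exact mul_nonpos_of_nonpos_of_nonneg hμ0 (by positivity)
      exact (hψ.trans h1).trans (by positivity)
    · have hμS : μ * Real.exp (-B) ≤ S := by
        refine h.contact hε hc hM hT'.2 hμ0 (hΛ₀ ε hε.pos hε.lt_one) (fun i => hΛ i ε hε)
          (fun i => hlat i M (hi₀ i) ε hε)
          ((le_max_left _ _).trans (le_max_left _ _))
          (fun i => ?_) hlam0 (Real.exp_pos _)
          (fun o y hy => Real.exp_le_exp.2 (hB ε hε o y hy).1) hF₀ hF hΦ hle (hq o₁).1 (hq o₁).2 ?_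
        · have := hi₁ i
          exact le_trans (by linarith) ((le_max_right _ _).trans (le_max_left _ _))
        · rw [mul_assoc]
          exact (div_mul_cancel₀ _ (hE0 o₁ (q o₁)).ne').symm
      have h1 : Real.exp (lam * t) ≤ Real.exp (lam * T) := by
        have := ht.2.trans hT'.2.le
        gcongr
      have h2 : Real.exp (exponent J c M ε o x) ≤ 1 := Real.exp_le_one_iff.2 (hB ε hε o x ho).2
      calc ψ x t ≤ μ * Real.exp (lam * t) * Real.exp (exponent J c M ε o x) := hψ
        _ ≤ S / Real.exp (-B) * Real.exp (lam * T) * 1 := by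
            gcongr
            rwa [le_div_iff₀ (Real.exp_pos _)]
        _ = _ := by ring
  intro x hx t ht
  have hc : ContinuousOn (ψ x) (closure (Ico 0 T)) := by
    rw [closure_Ico hT.ne]
    exact h.continuous.comp (f := fun t : ℝ => (x, t)) (by fun_prop) fun s hs => ⟨hx, hs⟩
  refine le_on_closure (fun s hs => ?_) hc continuousOn_const (by rwa [closure_Ico hT.ne])
  obtain ⟨T', h1, h2⟩ := exists_between hs.2
  exact key T' ⟨hs.1.trans_lt h1, h2⟩ x hx s ⟨hs.1, h1.le⟩

/-! ### Change of sign -/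

/-- The inward directions span the space, so derivatives at a point with an outward normal are
unique. -/
theorem IsOutwardNormal.uniqueDiffWithinAt {S : Set E3} {x ν : E3} (h : IsOutwardNormal S x ν) :
    UniqueDiffWithinAt ℝ S x := by
  have hcone : ∀ d : E3, 0 < inner ℝ ν d → -d ∈ tangentConeAt ℝ S x := fun d hd => by
    refine mem_tangentConeAt_of_add_smul_mem (l := 𝓝[>] (0 : ℝ)) ?_ (h.eventually_mem hd)
    exact tendsto_id'.mpr (nhdsGT_le_nhdsNE _)
  have hνν : inner ℝ ν ν = 1 := by rw [real_inner_self_eq_norm_sq, h.1, one_pow]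
  refine ⟨?_, ?_⟩
  · have : Submodule.span ℝ (tangentConeAt ℝ S x) = ⊤ := by
      refine Submodule.eq_top_iff'.2 fun v => ?_
      set N := |inner ℝ ν v| + 1 with hN
      have h1 := Submodule.subset_span (R := ℝ) (hcone (N • ν - v) (by
        rw [inner_sub_right, real_inner_smul_right, hνν]
        have := le_abs_self (inner ℝ ν v); linarith))
      have h2 := Submodule.subset_span (R := ℝ) (hcone (N • ν) (by
        rw [real_inner_smul_right, hνν]; positivity))
      have := Submodule.sub_mem _ h1 h2
      simpa using this
    rw [this]; exact dense_univ
  · have ht : Tendsto (fun s : ℝ => x + s • (-ν)) (𝓝[>] 0) (𝓝 x) := by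
      have : Continuous fun s : ℝ => x + s • (-ν) := by fun_prop
      have := this.tendsto 0
      rw [zero_smul, add_zero] at this
      exact this.mono_left nhdsWithin_le_nhds
    exact mem_closure_of_tendsto ht (h.eventually_mem (by rw [hνν]; exact one_pos))

theorem convexOn_transSq (i : Fin 3) : ConvexOn ℝ univ (transSq i) := by
  have h : ∀ j : Fin 3, ConvexOn ℝ univ fun y : E3 => y j ^ 2 := fun j =>
    (even_two.convexOn_pow (𝕜 := ℝ)).comp_linearMap
      (EuclideanSpace.proj j : E3 →L[ℝ] ℝ).toLinearMap
  refine ⟨convex_univ, fun x _ y _ a b ha hb hab => ?_⟩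
  simp only [transSq, Finset.smul_sum, ← Finset.sum_add_distrib]
  exact Finset.sum_le_sum fun j _ => (h j).2 (mem_univ x) (mem_univ y) ha hb hab

namespace Geometry

variable {J : Geometry} {ε : ℝ}

theorem Admissible.uniqueDiffWithinAt_base (hε : J.Admissible ε) {i : Fin 3} {x : E3}
    (hx : x ∈ J.crossSection ε i (ε * J.ℓ₀)) : UniqueDiffWithinAt ℝ (J.cylinder ε i) x := by
  -- the part of the cylinder in which the aperture is constant is convex
  set b := min J.δ (J.ℓ i) with hb
  have hbb : ε * J.ℓ₀ < b := lt_min hε.base (hε.base_lt i)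
  set R : Set E3 := {y | y i ∈ Ioo (ε * J.ℓ₀) b} ∩ {y | transSq i y < ε ^ 2 * J.h i 0 ^ 2} with hR
  have hRo : IsOpen R :=
    (isOpen_Ioo.preimage (by fun_prop : Continuous fun y : E3 => y i)).inter
      (isOpen_lt (continuous_transSq i) continuous_const)
  have hRc : Convex ℝ R := by
    refine ((convex_Ioo _ _).linear_preimage
      (EuclideanSpace.proj i : E3 →L[ℝ] ℝ).toLinearMap).inter ?_
    simpa using (convexOn_transSq i).convex_lt (ε ^ 2 * J.h i 0 ^ 2)
  have hsub : R ⊆ J.cylinder ε i := fun y hy => by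
    have h1 := hy.1.2.trans_le (min_le_left _ _)
    have h2 := hy.1.2.trans_le (min_le_right _ _)
    refine ⟨hy.1.1, h2, ?_⟩
    rw [J.h_left i _ ⟨(hε.base_mem i).1.trans hy.1.1.le, h2.le⟩ h1.le]
    exact hy.2
  have hcl : x ∈ closure R := by
    refine mem_closure_of_tendsto (tendsto_contract i 1 x) ?_
    filter_upwards [Ioo_mem_nhdsGT (zero_lt_one (α := ℝ)),
      Ioo_mem_nhdsGT (sub_pos.2 hbb)] with s hs hs'
    have hs2 := hs'.2
    have hs0 := hs.1
    refine ⟨⟨?_, ?_⟩, ?_⟩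
    · rw [contract_apply_self, hx.1]; linarith
    · rw [contract_apply_self, hx.1]; linarith
    · show transSq i (contract i 1 x s) < _
      rw [transSq_contract]
      have h1 := hx.2
      rw [hε.h_base] at h1
      have := J.h_pos i 0 (J.zero_mem_Icc i)
      have := hε.pos
      exact sq_one_sub_mul_lt hs.1 hs.2 h1 (by positivity)
  refine (uniqueDiffWithinAt_convex hRc ?_ hcl).mono hsub
  rw [hRo.interior_eq]
  exact closure_nonempty_iff.1 ⟨x, hcl⟩

/-- One-sided derivatives are unique on the closed junction without its outer bases. -/
theorem Admissible.uniqueDiffWithinAt_sideDomain (hε : J.Admissible ε) (K : Coefficients J)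
    {x : E3} (hx : x ∈ J.sideDomain ε) : UniqueDiffWithinAt ℝ (J.sideDomain ε) x := by
  have hnode : J.node ε ⊆ J.sideDomain ε := hε.node_subset.trans subset_union_left
  have hcyl : ∀ i, J.cylinder ε i ⊆ J.sideDomain ε :=
    fun i => (hε.cylinder_subset i).trans subset_union_left
  by_cases hb : ∃ i, x ∈ J.crossSection ε i (ε * J.ℓ₀)
  · obtain ⟨i, hi⟩ := hb
    exact (hε.uniqueDiffWithinAt_base hi).mono (hcyl i)
  rcases hx with hx | hx
  · exact (isOpen_interior.uniqueDiffWithinAt hx).mono subset_union_left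
  obtain ⟨o, ho⟩ := exists_mem_piece hx.1.1
  cases o with
  | none =>
    by_cases hn : x ∈ J.node ε
    · exact ((isOpen_node hε.pos).uniqueDiffWithinAt hn).mono hnode
    · have hxb : x ∈ J.nodeBoundary ε :=
        ⟨⟨ho, fun hi => hn (interior_subset hi)⟩, by simpa using hb⟩
      obtain ⟨ν, hν⟩ := hε.exists_normal_of_nodeBoundary hxb
      exact hν.uniqueDiffWithinAt.mono hnode
  | some i =>
    by_cases hn : x ∈ J.cylinder ε i
    · exact ((J.isOpen_cylinder hε.pos i).uniqueDiffWithinAt hn).mono (hcyl i)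
    · obtain ⟨⟨h1, h2⟩, h3⟩ := J.mem_closure_cylinder hε.pos ho
      have h1' : ε * J.ℓ₀ < x i := lt_of_le_of_ne h1 fun he =>
        hb ⟨i, he.symm, by rw [he]; exact h3⟩
      have h2' : x i < J.ℓ i := lt_of_le_of_ne h2 fun he =>
        hx.2 (mem_iUnion.2 ⟨i, he, by rw [← he]; exact h3⟩)
      obtain ⟨M₀, -, hM⟩ := K.exists_lateral_bound i
      obtain ⟨ν, hν, -⟩ := hM M₀ le_rfl ε hε x
        ⟨⟨ho, fun hi => hn (interior_subset hi)⟩, h1', h2'⟩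
      exact hν.uniqueDiffWithinAt.mono (hcyl i)

end Geometry

theorem sideGradient_neg {J : Geometry} {ε : ℝ} {ψ : E3 → ℝ → ℝ} {x : E3} {t : ℝ}
    (hu : UniqueDiffWithinAt ℝ (J.sideDomain ε) x) :
    sideGradient J ε (fun x t => -ψ x t) x t = -sideGradient J ε ψ x t := by
  have h : fderivWithin ℝ (fun y => -ψ y t) (J.sideDomain ε) x =
      -fderivWithin ℝ (fun y => ψ y t) (J.sideDomain ε) x := fderivWithin_fun_neg hu
  simp only [sideGradient, gradientWithin]
  change (InnerProductSpace.toDual ℝ E3).symm (fderivWithin ℝ _ (J.sideDomain ε) x) =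
    -(InnerProductSpace.toDual ℝ E3).symm (fderivWithin ℝ _ (J.sideDomain ε) x)
  rw [h, map_neg]

theorem IsC21.neg {T : ℝ} {S : Set E3} {ψ : E3 → ℝ → ℝ} (h : IsC21 T S ψ) :
    IsC21 T S fun x t => -ψ x t where
  space t ht := (h.space t ht).neg
  time x hx t ht := (h.time x hx t ht).neg
  time_continuous := by
    have : (fun q : E3 × ℝ => deriv (fun t => -ψ q.1 t) q.2) = fun q => -deriv (ψ q.1) q.2 := by
      funext q; exact deriv.fun_neg
    rw [this]; exact h.time_continuous.neg
  hessian_continuous := by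
    have : (fun q : E3 × ℝ => iteratedFDeriv ℝ 2 (fun y => -ψ y q.2) q.1) =
        fun q => -iteratedFDeriv ℝ 2 (fun y => ψ y q.2) q.1 := by
      funext q; exact iteratedFDeriv_neg_apply
    rw [this]; exact h.hessian_continuous.neg

theorem divergence_neg (G : E3 → E3) (x : E3) :
    divergence (fun y => -G y) x = -divergence G x := by
  simp [divergence, fderiv_fun_neg]

theorem applyMat_neg (A : Matrix (Fin 3) (Fin 3) ℝ) (v : E3) : applyMat A (-v) = -applyMat A v := by
  ext k; simp [applyMat_apply]

theorem gradient_neg (f : E3 → ℝ) (x : E3) : gradient (fun y => -f y) x = -gradient f x := by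
  simp [gradient, fderiv_fun_neg]

theorem IsClassicalSolution.neg {J : Geometry} {K : Coefficients J} {T ε : ℝ} {F₀ : E3 → ℝ → ℝ}
    {F Φ : Fin 3 → E3 → ℝ → ℝ} {ψ : E3 → ℝ → ℝ} (h : IsClassicalSolution K T ε F₀ F Φ ψ)
    (hε : J.Admissible ε) : IsClassicalSolution K T ε (fun x t => -F₀ x t) (fun i x t => -F i x t)
      (fun i x t => -Φ i x t) fun x t => -ψ x t where
  continuous := h.continuous.neg
  differentiable t ht := (h.differentiable t ht).neg
  gradient_continuous := by
    refine h.gradient_continuous.neg.congr fun q hq => ?_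
    exact sideGradient_neg (hε.uniqueDiffWithinAt_sideDomain K hq.1)
  regular_node := h.regular_node.neg
  regular_cylinder i := (h.regular_cylinder i).neg
  eq_cylinder i x hx t ht := by
    rw [← h.eq_cylinder i x hx t ht]
    simp only [gradient_neg, applyMat_neg, divergence_neg, neg_smul]
    rw [show deriv (fun t => -ψ x t) t = -deriv (ψ x) t from deriv.fun_neg]
    ring
  bc_lateral i x hx t ht ν hν := by
    have := h.bc_lateral i x hx t ht ν hν
    rw [sideGradient_neg (hε.uniqueDiffWithinAt_sideDomain K
      (hε.mem_sideDomain_of_cylinder hx.1.1 hx.2.2)), applyMat_neg, mul_neg, ← this, ← inner_neg_left]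
    congr 1
    simp only [smul_neg, neg_smul, neg_add]
  eq_node x hx t ht := by
    rw [← h.eq_node x hx t ht]
    simp only [gradient_neg, applyMat_neg, divergence_neg, inner_neg_right]
    rw [show deriv (fun t => -ψ x t) t = -deriv (ψ x) t from deriv.fun_neg]
    ring
  bc_node x hx t ht ν hν := by
    rw [sideGradient_neg (hε.uniqueDiffWithinAt_sideDomain K
      (hε.mem_sideDomain_of_node hx.1.1)), applyMat_neg, inner_neg_left, h.bc_node x hx t ht ν hν, neg_zero]
  dirichlet i x hx t ht := by rw [h.dirichlet i x hx t ht, neg_zero]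
  initial x hx := by rw [h.initial x hx, neg_zero]

/-! ### The two-sided estimate -/

theorem abs_le_supAbs {T : ℝ} {S : Set E3} {f : E3 → ℝ → ℝ} (h : ContBounded T S f) {x : E3}
    (hx : x ∈ S) {t : ℝ} (ht : t ∈ Ioo 0 T) : |f x t| ≤ supAbs T S f := by
  obtain ⟨M, hM⟩ := h.2
  refine le_csSup ⟨M, ?_⟩ ⟨(x, t), ⟨hx, ht⟩, rfl⟩
  rintro _ ⟨q, hq, rfl⟩
  exact hM q.1 hq.1 q.2 hq.2

theorem supAbs_nonneg (T : ℝ) (S : Set E3) (f : E3 → ℝ → ℝ) : 0 ≤ supAbs T S f := by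
  refine Real.sSup_nonneg ?_
  rintro _ ⟨q, -, rfl⟩
  exact abs_nonneg _

end

end ThinJunction

theorem mainTheorem2 (J : ThinJunction.Geometry) (K : ThinJunction.Coefficients J)
    (T : ℝ) (hT : 0 < T) :
    ∃ C₀ : ℝ, 0 < C₀ ∧
      ∀ ε : ℝ, J.Admissible ε →
      ∀ (F₀ : ThinJunction.E3 → ℝ → ℝ) (F Φ : Fin 3 → ThinJunction.E3 → ℝ → ℝ)
        (ψ : ThinJunction.E3 → ℝ → ℝ),
        ThinJunction.ContBounded T (J.node ε) F₀ →
        (∀ i, ThinJunction.ContBounded T (J.cylinder ε i) (F i)) →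
        (∀ i, ThinJunction.ContBounded T (J.lateral ε i) (Φ i)) →
        (∀ i, ThinJunction.LateralSupport J T ε i (Φ i)) →
        ThinJunction.IsClassicalSolution K T ε F₀ F Φ ψ →
        ∀ x ∈ closure (J.junction ε), ∀ t ∈ Set.Icc 0 T,
          |ψ x t| ≤ C₀ *
            (ThinJunction.supAbs T (J.node ε) F₀
              + ∑ i, ThinJunction.supAbs T (J.cylinder ε i) (F i)
              + ∑ i, ThinJunction.supAbs T (J.lateral ε i) (Φ i)) := by
  obtain ⟨C₀, hC₀, hbound⟩ := ThinJunction.exists_upper_bound K hT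
  refine ⟨C₀, hC₀, fun ε hε F₀ F Φ ψ hF₀ hF hΦ _ hψ x hx t ht => ?_⟩
  have h0 := ThinJunction.supAbs_nonneg T (J.node ε) F₀
  have h1 : ∀ i, 0 ≤ ThinJunction.supAbs T (J.cylinder ε i) (F i) :=
    fun i => ThinJunction.supAbs_nonneg _ _ _
  have h2 : ∀ i, 0 ≤ ThinJunction.supAbs T (J.lateral ε i) (Φ i) :=
    fun i => ThinJunction.supAbs_nonneg _ _ _
  have h1' : ∀ i, _ ≤ ∑ i, ThinJunction.supAbs T (J.cylinder ε i) (F i) :=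
    fun i => Finset.single_le_sum (fun i _ => h1 i) (Finset.mem_univ i)
  have h2' : ∀ i, _ ≤ ∑ i, ThinJunction.supAbs T (J.lateral ε i) (Φ i) :=
    fun i => Finset.single_le_sum (fun i _ => h2 i) (Finset.mem_univ i)
  have hs1 := Finset.sum_nonneg fun i (_ : i ∈ Finset.univ) => h1 i
  have hs2 := Finset.sum_nonneg fun i (_ : i ∈ Finset.univ) => h2 i
  set S := ThinJunction.supAbs T (J.node ε) F₀
    + ∑ i, ThinJunction.supAbs T (J.cylinder ε i) (F i)
    + ∑ i, ThinJunction.supAbs T (J.lateral ε i) (Φ i) with hSd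
  have hS : 0 ≤ S := by positivity
  have hS₀ : ∀ y ∈ J.node ε, ∀ s ∈ Set.Ioo 0 T, |F₀ y s| ≤ S := fun y hy s hs =>
    (ThinJunction.abs_le_supAbs hF₀ hy hs).trans (by linarith)
  have hSF : ∀ i, ∀ y ∈ J.cylinder ε i, ∀ s ∈ Set.Ioo 0 T, |F i y s| ≤ S := fun i y hy s hs =>
    (ThinJunction.abs_le_supAbs (hF i) hy hs).trans (by linarith [h1' i])
  have hSΦ : ∀ i, ∀ y ∈ J.lateral ε i, ∀ s ∈ Set.Ioo 0 T, |Φ i y s| ≤ S := fun i y hy s hs =>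
    (ThinJunction.abs_le_supAbs (hΦ i) hy hs).trans (by linarith [h2' i])
  refine abs_le.2 ⟨?_, ?_⟩
  · have := hbound ε hε _ _ _ _ S (hψ.neg hε) hS
      (fun y hy s hs => (neg_le_abs _).trans (hS₀ y hy s hs))
      (fun i y hy s hs => (neg_le_abs _).trans (hSF i y hy s hs))
      (fun i y hy s hs => by rw [neg_neg]; exact (le_abs_self _).trans (hSΦ i y hy s hs)) x hx t ht
    linarith
  · exact hbound ε hε _ _ _ _ S hψ hS
      (fun y hy s hs => (le_abs_self _).trans (hS₀ y hy s hs))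
      (fun i y hy s hs => (le_abs_self _).trans (hSF i y hy s hs))
      (fun i y hy s hs => (neg_le_abs _).trans (hSΦ i y hy s hs)) x hx t ht
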